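/- Let $\langle\mathcal C,\otimes,u\rangle$ be an additive monoidal category: a preadditive category with finite direct sums, with $\otimes$ additive in each variable, and with all idempotents split. Let $g$ be a finite progenerator of $\mathcal C$, i.e. every object of $\mathcal C$ is a direct summand of a finite direct sum of copies of $g$. Put $Z=\mathrm{End}\,u$ (a commutative ring) and $A=\mathrm{End}\,g$, and let $F=\mathrm{Hom}(g,-)\colon\mathcal C\to{}_Z\mathsf M_Z$, where $z\in Z$ acts on $\mathrm{Hom}(g,b)$ from the left and from the right by composition with the endomorphisms of $b$ induced by $z\otimes b$ and $b\otimes z$. *Split monoidal structures.* A split monoidal structure on a functor $F\colon\mathcal C\to\mathcal D$ to a monoidal category $\langle \mathcal D,\otimes,Z\rangle$ is a quadruple $\langle\mu,\zeta,\delta,\psi\rangle$ where $\langle F,\mu,\zeta\rangle$ is a (lax) monoidal functor, $\delta_{a,b}\colon F(a\otimes b)\to F(a)\otimes F(b)$ is natural and coassociative with counit $\psi\colon F(u)\to Z$, $\mu_{a,b}\circ\delta_{a,b}=\mathrm{id}$, and (up to associativity constraints) $$(\mu_{a,b}\otimes F(c))\circ(F(a)\otimes\delta_{b,c})=\delta_{a\otimes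 b,c}\circ\mu_{a,b\otimes c},\qquad (F(a)\otimes\mu_{b,c})\circ(\delta_{a,b}\otimes F(c))=\delta_{a,b\otimes c}\circ\mu_{a\otimes b,c}.$$ *Bialgebroids with separable base.* A bialgebroid structure on $A$ over a ring $R$ consists of ring homomorphisms $s\colon R\to A$, $t\colon R^{op}\to A$ with commuting images, which make $A$ an $R$-$R$-bimodule by $r\cdot a=at(r)$, $a\cdot r=as(r)$, and a comonoid structure $\gamma\colon A\to A\otimes_RA$, $\pi\colon A\to R$ in ${}_R\mathsf M_R$ such that $(s(r)\otimes1)\gamma(a)=(1\otimes t(r))\gamma(a)$, $\gamma(a)\gamma(b)=\gamma(ab)$, $\gamma(1)=1\otimes1$, $\pi(1)=1$ and $\pi(t(\pi(a))b)=\pi(ab)=\pi(s(\pi(a))b)$. Then the category $\mathsf M_A$ of right $A$-modules has a unique monoidal structure, given by $\gamma$ and $\pi$, for which the forgetful functor $\mathsf M_A\to{}_R\mathsf M_R$ is strictly monoidal. The base is separable (over $Z$) if $R$ is a $Z$-algebra such that $Z\to R$ is injective with image $s^{-1}(\mathrm{Center}\,A)=t^{-1}(\mathrm{Center}\,A)$,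 equipped with a $Z$-coalgebra structure $\langle\delta_R,\psi_R\rangle$ satisfying $(R\otimes m)(\delta_R\otimes R)=\delta_R m=(m\otimes R)(R\otimes\delta_R)$ and $m\,\delta_R=\mathrm{id}_R$, where $m$ is the multiplication of $R$. With $\delta_R(1)=\sum_ie_i\otimes f_i$, the maps $V\otimes_ZW\to V\otimes_RW$, $Z\to R$, $v\otimes_R w\mapsto\sum_i v\cdot e_i\otimes_Z f_i\cdot w$ and $\psi_R\colon R\to Z$ give the forgetful functor $\phi_Z\colon\mathsf M_A\to{}_Z\mathsf M_Z$ a monoidal and a comonoidal structure. By a *bialgebroid structure with separable base on $A=\mathrm{End}\,g$, compatible with the monoidal structure of $\mathcal C$*, we mean a bialgebroid structure on $A$ with base $R$ separable over $Z=\mathrm{End}\,u$, together with the structure $\kappa$ of a strong monoidal functor on $K=\mathrm{Hom}(g,-)\colon\mathcal C\to\mathsf M_A$, such that the $Z$-$Z$-bimodule structure of $\mathrm{Hom}(g,b)$ obtained from $Z\to R$ is the one of $F$. Two such structures are identified if they correspond to each other under an isomorphism $R\cong R'$ of $Z$-algebras, which respects $s,t,\gamma,\pi,\delta_R,\psi_R$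 and $\kappa$; such an isomorphism is unique if it exists. **Theorem.** Transporting the monoidal and comonoidal structures of $\mathcal C\xrightarrow{K}\mathsf M_A\xrightarrow{\phi_Z}{}_Z\mathsf M_Z$ along the identification $\phi_Z K= F$ defines a bijection from (isomorphism classes of) bialgebroid structures with separable base on $A=\mathrm{End}\,g$ compatible with the monoidal structure of $\mathcal C$ to split monoidal structures $\langle F,\mu,\zeta,\delta,\psi\rangle$ on $F$. Moreover, for any split monoidal structure on $F$ and the corresponding bialgebroid structure on $A$, the finitely generated projective right $A$-modules $\mathsf M_A^{fgp}$ are closed under the tensor product and contain the unit of $\mathsf M_A$, and there is an equivalence $E\colon\mathcal C\to\mathsf M_A^{fgp}$ of monoidal categories whose composite with the inclusion $\mathsf M_A^{fgp}\subset\mathsf M_A$ is monoidally isomorphic to $K$, such that the resulting isomorphism of the composite $\mathcal C\xrightarrow{E}\mathsf M_A^{fgp}\subset\mathsf M_A\xrightarrow{\phi_Z}{}_Z\mathsf M_Z$ with $F$ respects the structures $\mu,\zeta,\delta,\psi$. -/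

import Mathlib

open CategoryTheory MonoidalCategory CategoryTheory.Limits
open scoped TensorProduct
open MulOpposite (op unop)

universe v u

noncomputable section

/-! ## Bimodules over a (noncommutative) ring -/

/-- An `R`-`R`-bimodule: the right action of `R` is a left action of `Rᵐᵒᵖ`, so `v · r` is written
`op r • v`. -/
structure RBimod (R : Type v) [Ring R] where
  carrier : Type v
  [addCommGroup : AddCommGroup carrier]
  [left : Module R carrier]
  [right : Module Rᵐᵒᵖ carrier]
  [comm : SMulCommClass R Rᵐᵒᵖ carrier]

namespace RBimod

instance (R : Type v) [Ring R] : CoeSort (RBimod.{v} R) (Type v) := ⟨RBimod.carrier⟩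

attribute [instance] RBimod.addCommGroup RBimod.left RBimod.right RBimod.comm

/-- Bimodule maps. -/
@[ext]
structure Hom {R : Type v} [Ring R] (V W : RBimod.{v} R) where
  hom : V →+ W
  map_smul : ∀ (r : R) (x : V), hom (r • x) = r • hom x
  map_op_smul : ∀ (r : R) (x : V), hom (op r • x) = op r • hom x

instance (R : Type v) [Ring R] : Category.{v} (RBimod.{v} R) where
  Hom V W := Hom V W
  id V := ⟨AddMonoidHom.id V, fun _ _ => rfl, fun _ _ => rfl⟩
  comp f g := ⟨g.hom.comp f.hom,
    fun r x => by simp [f.map_smul, g.map_smul], fun r x => by simp [f.map_op_smul, g.map_op_smul]⟩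

variable {R : Type v} [Ring R]

/-- The additive map underlying a morphism of bimodules. -/
def homOf {V W : RBimod.{v} R} (f : V ⟶ W) : V →+ W := Hom.hom f

/-- Build a morphism of bimodules. -/
def mkHom {V W : RBimod.{v} R} (f : V →+ W) (h₁ : ∀ (r : R) (x : V), f (r • x) = r • f x)
    (h₂ : ∀ (r : R) (x : V), f (op r • x) = op r • f x) : V ⟶ W := Hom.mk f h₁ h₂

@[simp] lemma homOf_mkHom {V W : RBimod.{v} R} (f : V →+ W) (h₁ h₂) :
    homOf (mkHom f h₁ h₂) = f := rfl

@[simp] lemma homOf_id (V : RBimod.{v} R) (x : V) : homOf (𝟙 V) x = x := rfl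

@[simp] lemma homOf_comp {U V W : RBimod.{v} R} (f : U ⟶ V) (g : V ⟶ W) (x : U) :
    homOf (f ≫ g) x = homOf g (homOf f x) := rfl

@[simp] lemma homOf_smul {V W : RBimod.{v} R} (f : V ⟶ W) (r : R) (x : V) :
    homOf f (r • x) = r • homOf f x := Hom.map_smul f r x

@[simp] lemma homOf_op_smul {V W : RBimod.{v} R} (f : V ⟶ W) (r : R) (x : V) :
    homOf f (op r • x) = op r • homOf f x := Hom.map_op_smul f r x

lemma hom_ext {V W : RBimod.{v} R} {f g : V ⟶ W} (h : ∀ x, homOf f x = homOf g x) : f = g :=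
  Hom.ext (AddMonoidHom.ext h)

/-- Build an isomorphism of bimodules from mutually inverse morphisms. -/
def mkIso {V W : RBimod.{v} R} (f : V ⟶ W) (g : W ⟶ V) (h₁ : ∀ x, homOf g (homOf f x) = x)
    (h₂ : ∀ x, homOf f (homOf g x) = x) : V ≅ W :=
  ⟨f, g, hom_ext h₁, hom_ext h₂⟩

/-- The relations `v · r ⊗ w = v ⊗ r · w`. -/
def balance (V W : RBimod.{v} R) : AddSubgroup (V ⊗[ℤ] W) :=
  AddSubgroup.closure
    {x | ∃ (v : V) (r : R) (w : W), x = (op r • v) ⊗ₜ[ℤ] w - v ⊗ₜ[ℤ] (r • w)}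

/-- The abelian group `V ⊗_R W`. -/
def Tens (V W : RBimod.{v} R) : Type v := (V ⊗[ℤ] W) ⧸ balance V W

instance (V W : RBimod.{v} R) : AddCommGroup (Tens V W) :=
  inferInstanceAs (AddCommGroup ((V ⊗[ℤ] W) ⧸ balance V W))

/-- The projection `V ⊗_ℤ W → V ⊗_R W`. -/
def proj (V W : RBimod.{v} R) : (V ⊗[ℤ] W) →+ Tens V W := QuotientAddGroup.mk' (balance V W)

/-- The element `v ⊗ w` of `V ⊗_R W`. -/
def tmul {V W : RBimod.{v} R} (v : V) (w : W) : Tens V W := proj V W (v ⊗ₜ[ℤ] w)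

lemma tmul_add {V W : RBimod.{v} R} (v : V) (w w' : W) :
    tmul v (w + w') = tmul v w + tmul v w' := by
  unfold tmul; rw [TensorProduct.tmul_add, map_add]

lemma add_tmul {V W : RBimod.{v} R} (v v' : V) (w : W) :
    tmul (v + v') w = tmul v w + tmul v' w := by
  unfold tmul; rw [TensorProduct.add_tmul, map_add]

lemma balanced {V W : RBimod.{v} R} (v : V) (r : R) (w : W) :
    tmul (op r • v) w = tmul v (r • w) := by
  unfold tmul
  rw [← sub_eq_zero, ← map_sub]
  exact (QuotientAddGroup.eq_zero_iff _).2 (AddSubgroup.subset_closure ⟨v, r, w, rfl⟩)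

/-- `tmul` as a biadditive map. -/
def tmulHom (V W : RBimod.{v} R) : V →+ W →+ Tens V W :=
  AddMonoidHom.mk' (fun v => AddMonoidHom.mk' (fun w => tmul v w) (tmul_add v))
    (fun v v' => AddMonoidHom.ext (add_tmul v v'))

@[simp] lemma tmulHom_apply {V W : RBimod.{v} R} (v : V) (w : W) :
    tmulHom V W v w = tmul v w := rfl

/-- The universal property of `V ⊗_R W` for balanced biadditive maps. -/
def lift {V W : RBimod.{v} R} {P : Type v} [AddCommGroup P] (f : V →+ W →+ P)
    (hf : ∀ (v : V) (r : R) (w : W), f (op r • v) w = f v (r • w)) : Tens V W →+ P :=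
  QuotientAddGroup.lift (balance V W)
    (TensorProduct.liftAddHom f (fun n v w => by simp)) (by
      rw [balance, AddSubgroup.closure_le]
      rintro _ ⟨v, r, w, rfl⟩
      simp [hf])

@[simp] lemma lift_tmul {V W : RBimod.{v} R} {P : Type v} [AddCommGroup P] (f : V →+ W →+ P)
    (hf) (v : V) (w : W) : lift f hf (tmul v w) = f v w := rfl

@[elab_as_elim]
lemma tens_induction {V W : RBimod.{v} R} {p : Tens V W → Prop} (x : Tens V W)
    (h0 : p 0) (ht : ∀ v w, p (tmul v w)) (ha : ∀ x y, p x → p y → p (x + y)) : p x := by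
  obtain ⟨x, rfl⟩ : ∃ y, proj V W y = x := QuotientAddGroup.mk'_surjective _ x
  induction x using TensorProduct.induction_on with
  | zero => rw [map_zero]; exact h0
  | tmul v w => exact ht v w
  | add x y hx hy => rw [map_add]; exact ha _ _ hx hy

lemma tens_hom_ext {V W : RBimod.{v} R} {P : Type v} [AddCommGroup P] {f g : Tens V W →+ P}
    (h : ∀ v w, f (tmul v w) = g (tmul v w)) (x : Tens V W) : f x = g x := by
  induction x using tens_induction with
  | h0 => simp
  | ht v w => exact h v w
  | ha x y hx hy => simp [hx, hy]

/-- The map `V ⊗_R W → V' ⊗_R W'` induced by additive maps, right and left `R`-linear. -/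
def tensMap {V W V' W' : RBimod.{v} R} (f : V →+ V') (hf : ∀ (r : R) v, f (op r • v) = op r • f v)
    (g : W →+ W') (hg : ∀ (r : R) w, g (r • w) = r • g w) : Tens V W →+ Tens V' W' :=
  lift (((AddMonoidHom.compHom' g).comp (tmulHom V' W')).comp f)
    (fun v r w => by simp [hf, hg, balanced])

@[simp] lemma tensMap_tmul {V W V' W' : RBimod.{v} R} (f : V →+ V') (hf) (g : W →+ W') (hg)
    (v : V) (w : W) : tensMap f hf g hg (tmul v w) = tmul (f v) (g w) := rfl

/-- `v ⊗ w ↦ (r · v) ⊗ w`. -/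
def lact (V W : RBimod.{v} R) (r : R) : Tens V W →+ Tens V W :=
  tensMap (DistribSMul.toAddMonoidHom V r) (fun s v => smul_comm r (op s) v)
    (AddMonoidHom.id W) (fun _ _ => rfl)

@[simp] lemma lact_tmul {V W : RBimod.{v} R} (r : R) (v : V) (w : W) :
    lact V W r (tmul v w) = tmul (r • v) w := rfl

/-- `v ⊗ w ↦ v ⊗ (w · r)`. -/
def ract (V W : RBimod.{v} R) (r : Rᵐᵒᵖ) : Tens V W →+ Tens V W :=
  tensMap (AddMonoidHom.id V) (fun _ _ => rfl)
    (DistribSMul.toAddMonoidHom W r) (fun s w => (smul_comm s r w).symm)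

@[simp] lemma ract_tmul {V W : RBimod.{v} R} (r : Rᵐᵒᵖ) (v : V) (w : W) :
    ract V W r (tmul v w) = tmul v (r • w) := rfl

/-- `r · (v ⊗ w) = (r · v) ⊗ w`. -/
instance (V W : RBimod.{v} R) : Module R (Tens V W) where
  smul r x := lact V W r x
  one_smul x := tens_hom_ext (f := lact V W 1) (g := .id _) (fun v w => by simp) x
  mul_smul r s x := tens_hom_ext (f := lact V W (r * s)) (g := (lact V W r).comp (lact V W s))
    (fun v w => by simp [mul_smul]) x
  smul_zero r := map_zero (lact V W r)
  smul_add r := map_add (lact V W r)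
  add_smul r s x := tens_hom_ext (f := lact V W (r + s)) (g := lact V W r + lact V W s)
    (fun v w => by simp [add_smul, add_tmul]) x
  zero_smul x := tens_hom_ext (f := lact V W 0) (g := 0)
    (fun v w => by rw [lact_tmul, zero_smul]; exact map_zero ((tmulHom V W).flip w)) x

lemma smul_tmul {V W : RBimod.{v} R} (r : R) (v : V) (w : W) :
    r • tmul v w = tmul (r • v) w := rfl

/-- `(v ⊗ w) · r = v ⊗ (w · r)`. -/
instance (V W : RBimod.{v} R) : Module Rᵐᵒᵖ (Tens V W) where
  smul r x := ract V W r x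
  one_smul x := tens_hom_ext (f := ract V W 1) (g := .id _) (fun v w => by simp) x
  mul_smul r s x := tens_hom_ext (f := ract V W (r * s)) (g := (ract V W r).comp (ract V W s))
    (fun v w => by simp [mul_smul]) x
  smul_zero r := map_zero (ract V W r)
  smul_add r := map_add (ract V W r)
  add_smul r s x := tens_hom_ext (f := ract V W (r + s)) (g := ract V W r + ract V W s)
    (fun v w => by simp [add_smul, tmul_add]) x
  zero_smul x := tens_hom_ext (f := ract V W 0) (g := 0)
    (fun v w => by rw [ract_tmul, zero_smul]; exact map_zero (tmulHom V W v)) x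

lemma op_smul_tmul {V W : RBimod.{v} R} (r : R) (v : V) (w : W) :
    op r • tmul v w = tmul v (op r • w) := rfl

instance (V W : RBimod.{v} R) : SMulCommClass R Rᵐᵒᵖ (Tens V W) where
  smul_comm r s x := tens_hom_ext (f := (lact V W r).comp (ract V W s))
    (g := (ract V W s).comp (lact V W r)) (fun _ _ => rfl) x

/-- The bimodule `V ⊗_R W`. -/
abbrev tensor (V W : RBimod.{v} R) : RBimod.{v} R where
  carrier := Tens V W

/-- The regular bimodule `R`. -/
abbrev regular (R : Type v) [Ring R] : RBimod.{v} R where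
  carrier := R

/-- Build a morphism out of `V ⊗_R W`. -/
def liftHom {V W P : RBimod.{v} R} (f : V →+ W →+ P)
    (hf : ∀ (v : V) (r : R) (w : W), f (op r • v) w = f v (r • w))
    (h₁ : ∀ (r : R) (v : V) (w : W), f (r • v) w = r • f v w)
    (h₂ : ∀ (r : R) (v : V) (w : W), f v (op r • w) = op r • f v w) : tensor V W ⟶ P :=
  mkHom (V := tensor V W) (lift f hf)
    (fun r x => tens_hom_ext (f := (lift f hf).comp (lact V W r))
      (g := (DistribSMul.toAddMonoidHom P r).comp (lift f hf)) (fun v w => h₁ r v w) x)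
    (fun r x => tens_hom_ext
      (f := (lift f hf).comp (ract V W (op r)))
      (g := (DistribSMul.toAddMonoidHom P (op r)).comp (lift f hf)) (fun v w => h₂ r v w) x)

@[simp] lemma liftHom_tmul {V W P : RBimod.{v} R} (f : V →+ W →+ P) (hf h₁ h₂) (v : V) (w : W) :
    homOf (liftHom f hf h₁ h₂) (tmul v w) = f v w := rfl

lemma tensor_hom_ext {V W P : RBimod.{v} R} {f g : tensor V W ⟶ P}
    (h : ∀ v w, homOf f (tmul v w) = homOf g (tmul v w)) : f = g :=
  hom_ext (tens_hom_ext (f := homOf f) (g := homOf g) h)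

lemma tensor₃_hom_ext {U V W P : RBimod.{v} R} {f g : tensor (tensor U V) W ⟶ P}
    (h : ∀ u v w, homOf f (tmul (V := tensor U V) (tmul u v) w) =
      homOf g (tmul (V := tensor U V) (tmul u v) w)) : f = g := by
  refine tensor_hom_ext fun x w => ?_
  exact tens_hom_ext (f := (homOf f).comp ((tmulHom (tensor U V) W).flip w))
    (g := (homOf g).comp ((tmulHom (tensor U V) W).flip w)) (fun u v => h u v w) x

lemma tensor₃'_hom_ext {U V W P : RBimod.{v} R} {f g : tensor U (tensor V W) ⟶ P}
    (h : ∀ u v w, homOf f (tmul (W := tensor V W) u (tmul v w)) =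
      homOf g (tmul (W := tensor V W) u (tmul v w))) : f = g := by
  refine tensor_hom_ext fun u x => ?_
  exact tens_hom_ext (f := (homOf f).comp (tmulHom U (tensor V W) u))
    (g := (homOf g).comp (tmulHom U (tensor V W) u)) (fun v w => h u v w) x

/-- `f ⊗_R g`. -/
def tensorMap {V W V' W' : RBimod.{v} R} (f : V ⟶ V') (g : W ⟶ W') : tensor V W ⟶ tensor V' W' :=
  liftHom (P := tensor V' W')
    (((AddMonoidHom.compHom' (homOf g)).comp (tmulHom V' W')).comp (homOf f))
    (fun v r w => by simp [balanced]) (fun r v w => by simp [smul_tmul])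
    (fun r v w => by simp [op_smul_tmul])

@[simp] lemma tensorMap_tmul {V W V' W' : RBimod.{v} R} (f : V ⟶ V') (g : W ⟶ W') (v : V) (w : W) :
    homOf (tensorMap f g) (tmul v w) = tmul (homOf f v) (homOf g w) := rfl

/-- `(u ⊗ v) ⊗ w ↦ u ⊗ (v ⊗ w)`. -/
def assocHom (U V W : RBimod.{v} R) : tensor (tensor U V) W ⟶ tensor U (tensor V W) :=
  liftHom (V := tensor U V) (P := tensor U (tensor V W))
    (AddMonoidHom.flip (AddMonoidHom.mk' (fun w => lift (V := U) (W := V)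
      (((AddMonoidHom.compHom' ((tmulHom V W).flip w)).comp (tmulHom U (tensor V W))))
      (fun u r v => balanced (W := tensor V W) u r (tmul v w)))
      (fun w w' => AddMonoidHom.ext <| tens_hom_ext fun u v => by
        simp; rfl)))
    (fun x r w => tens_induction x (by simp) (fun u v => by
        change tmul (W := tensor V W) u (tmul (op r • v) w) = tmul (W := tensor V W) u (tmul v (r • w))
        rw [balanced]) (fun x y hx hy => by rw [smul_add, map_add, map_add]; simp_all))
    (fun r x w => tens_induction x (by simp) (fun u v => rfl)
      (fun x y hx hy => by rw [smul_add, map_add, map_add]; simp_all))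
    (fun r x w => tens_induction x (by simp) (fun u v => rfl)
      (fun x y hx hy => by rw [map_add]; simp_all))

@[simp] lemma assocHom_tmul {U V W : RBimod.{v} R} (u : U) (v : V) (w : W) :
    homOf (assocHom U V W) (tmul (V := tensor U V) (tmul u v) w) =
      tmul (W := tensor V W) u (tmul v w) := rfl

/-- `u ⊗ (v ⊗ w) ↦ (u ⊗ v) ⊗ w`. -/
def assocInv (U V W : RBimod.{v} R) : tensor U (tensor V W) ⟶ tensor (tensor U V) W :=
  liftHom (W := tensor V W) (P := tensor (tensor U V) W)
    (AddMonoidHom.mk' (fun u => lift (V := V) (W := W)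
      ((tmulHom (tensor U V) W).comp (tmulHom U V u))
      (fun v r w => balanced (V := tensor U V) (tmul u v) r w))
      (fun u u' => AddMonoidHom.ext <| tens_hom_ext fun v w => by
        simp; rfl))
    (fun u r x => tens_induction x (by simp) (fun v w => by
        change tmul (V := tensor U V) (tmul (op r • u) v) w = tmul (V := tensor U V) (tmul u (r • v)) w
        rw [balanced]) (fun x y hx hy => by rw [smul_add, map_add, map_add]; simp_all))
    (fun r u x => tens_induction x (by simp) (fun v w => rfl)
      (fun x y hx hy => by rw [map_add]; simp_all))
    (fun r u x => tens_induction x (by simp) (fun v w => rfl)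
      (fun x y hx hy => by rw [smul_add, map_add, map_add]; simp_all))

@[simp] lemma assocInv_tmul {U V W : RBimod.{v} R} (u : U) (v : V) (w : W) :
    homOf (assocInv U V W) (tmul (W := tensor V W) u (tmul v w)) =
      tmul (V := tensor U V) (tmul u v) w := rfl

/-- `r ⊗ v ↦ r · v`. -/
def lunitHom (V : RBimod.{v} R) : tensor (regular R) V ⟶ V :=
  liftHom (V := regular R) (AddMonoidHom.mk' (fun r : R => DistribSMul.toAddMonoidHom V r)
      (fun r s => AddMonoidHom.ext fun v => add_smul r s v))
    (fun (v : R) r w => mul_smul v r w) (fun r (v : R) w => mul_smul r v w)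
    (fun r (v : R) w => smul_comm v (op r) w)

@[simp] lemma lunitHom_tmul {V : RBimod.{v} R} (r : R) (v : V) :
    homOf (lunitHom V) (tmul (V := regular R) r v) = r • v := rfl

/-- `v ↦ 1 ⊗ v`. -/
def lunitInv (V : RBimod.{v} R) : V ⟶ tensor (regular R) V :=
  mkHom (W := tensor (regular R) V) (tmulHom (regular R) V (1 : R))
    (fun r v => (balanced (V := regular R) (1 : R) r v).symm.trans <| by
      change tmul (V := regular R) (1 * r) v = tmul (V := regular R) (r * 1) v
      rw [one_mul, mul_one]) (fun _ _ => rfl)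

@[simp] lemma lunitInv_apply {V : RBimod.{v} R} (v : V) :
    homOf (lunitInv V) v = tmul (V := regular R) (1 : R) v := rfl

/-- `v ⊗ r ↦ v · r`. -/
def runitHom (V : RBimod.{v} R) : tensor V (regular R) ⟶ V :=
  liftHom (W := regular R) (AddMonoidHom.flip (AddMonoidHom.mk'
      (fun r : R => DistribSMul.toAddMonoidHom V (op r))
      (fun r s => AddMonoidHom.ext fun v => add_smul (op r) (op s) v)))
    (fun v r (w : R) => (mul_smul (op w) (op r) v).symm)
    (fun r v (w : R) => (smul_comm r (op w) v).symm)
    (fun r v (w : R) => mul_smul (op r) (op w) v)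

@[simp] lemma runitHom_tmul {V : RBimod.{v} R} (r : R) (v : V) :
    homOf (runitHom V) (tmul (W := regular R) v r) = op r • v := rfl

/-- `v ↦ v ⊗ 1`. -/
def runitInv (V : RBimod.{v} R) : V ⟶ tensor V (regular R) :=
  mkHom (W := tensor V (regular R)) ((tmulHom V (regular R)).flip (1 : R))
    (fun _ _ => rfl) (fun r v => (balanced (W := regular R) v r (1 : R)).trans <| by
      change tmul (W := regular R) v (r * 1) = tmul (W := regular R) v (1 * r)
      rw [one_mul, mul_one])

@[simp] lemma runitInv_apply {V : RBimod.{v} R} (v : V) :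
    homOf (runitInv V) v = tmul (W := regular R) v (1 : R) := rfl

instance : MonoidalCategoryStruct (RBimod.{v} R) where
  tensorObj := tensor
  tensorUnit := regular R
  tensorHom f g := tensorMap f g
  whiskerLeft V _ _ g := tensorMap (𝟙 V) g
  whiskerRight f W := tensorMap f (𝟙 W)
  associator U V W := ⟨assocHom U V W, assocInv U V W,
    tensor₃_hom_ext fun _ _ _ => rfl, tensor₃'_hom_ext fun _ _ _ => rfl⟩
  leftUnitor V := ⟨lunitHom V, lunitInv V, tensor_hom_ext fun (r : R) v => by
      change tmul (V := regular R) (1 : R) (r • v) = tmul (V := regular R) r v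
      rw [← balanced]
      change tmul (V := regular R) ((1 : R) * r) v = _
      rw [one_mul], hom_ext fun v => one_smul R v⟩
  rightUnitor V := ⟨runitHom V, runitInv V, tensor_hom_ext fun v (r : R) => by
      change tmul (W := regular R) (op r • v) (1 : R) = tmul (W := regular R) v r
      rw [balanced]
      change tmul (W := regular R) v (r * (1 : R)) = _
      rw [mul_one], hom_ext fun v => one_smul Rᵐᵒᵖ v⟩

/-- The monoidal category of `R`-`R`-bimodules with `⊗_R`. -/
instance : MonoidalCategory (RBimod.{v} R) where
  tensorHom_def f g := tensor_hom_ext fun _ _ => rfl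
  id_tensorHom_id V W := tensor_hom_ext fun _ _ => rfl
  tensorHom_comp_tensorHom f₁ f₂ g₁ g₂ := tensor_hom_ext fun _ _ => rfl
  whiskerLeft_id V W := tensor_hom_ext fun _ _ => rfl
  id_whiskerRight V W := tensor_hom_ext fun _ _ => rfl
  associator_naturality f₁ f₂ f₃ := tensor₃_hom_ext fun _ _ _ => rfl
  leftUnitor_naturality f := tensor_hom_ext fun (r : R) v => (homOf_smul f r v).symm
  rightUnitor_naturality f := tensor_hom_ext fun v (r : R) => (homOf_op_smul f r v).symm
  pentagon U V W X := tensor₃_hom_ext (U := tensor U V) fun x c d => by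
    exact tens_hom_ext
      (f := (homOf ((α_ U V W).hom ▷ X ≫ (α_ U (V ⊗ W) X).hom ≫ U ◁ (α_ V W X).hom)).comp
        (((tmulHom (tensor (tensor U V) W) X).flip d).comp ((tmulHom (tensor U V) W).flip c)))
      (g := (homOf ((α_ (U ⊗ V) W X).hom ≫ (α_ U V (W ⊗ X)).hom)).comp
        (((tmulHom (tensor (tensor U V) W) X).flip d).comp ((tmulHom (tensor U V) W).flip c)))
      (fun a b => rfl) x
  triangle V W := tensor₃_hom_ext fun v (r : R) w => (balanced v r w).symm

lemma tensorHom_tmul {V W V' W' : RBimod.{v} R} (f : V ⟶ V') (g : W ⟶ W') (v : V) (w : W) :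
    homOf (f ⊗ₘ g) (tmul v w) = tmul (homOf f v) (homOf g w) := rfl

end RBimod

/-! ## Bialgebroids -/

/-- A diagram of rings `Rᵒᵖ → A ← R` such that the images of `s` and `t` commute. -/
structure SourceTarget (R A : Type v) [Ring R] [Ring A] where
  s : R →+* A
  t : Rᵐᵒᵖ →+* A
  commute : ∀ r r' : R, s r * t (op r') = t (op r') * s r

namespace SourceTarget

variable {R A : Type v} [Ring R] [Ring A] (σ : SourceTarget R A)

/-- The `R`-`R`-bimodule underlying a right `A`-module:
`r · v = v · t(r)` and `v · r = v · s(r)`. -/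
def bimod (V : Type v) [AddCommGroup V] [Module Aᵐᵒᵖ V] : RBimod.{v} R where
  carrier := V
  left := Module.compHom V (σ.t.op.comp (RingEquiv.opOp R).toRingHom)
  right := Module.compHom V σ.s.op
  comm := by
    let _ := Module.compHom V (σ.t.op.comp (RingEquiv.opOp R).toRingHom)
    let _ := Module.compHom V σ.s.op
    refine ⟨fun r r' v => ?_⟩
    change op (σ.t (op r)) • op (σ.s r'.unop) • v = op (σ.s r'.unop) • op (σ.t (op r)) • v
    rw [← mul_smul, ← mul_smul, ← MulOpposite.op_mul, ← MulOpposite.op_mul, σ.commute]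

/-- The bimodule `A`: `r · a = a t(r)` and `a · r = a s(r)`. -/
abbrev reg : RBimod.{v} R := σ.bimod A

variable {V W : Type v} [AddCommGroup V] [Module Aᵐᵒᵖ V] [AddCommGroup W] [Module Aᵐᵒᵖ W]

lemma left_smul_def (r : R) (v : σ.bimod V) :
    r • v = (show σ.bimod V from (op (σ.t (op r)) • (show V from v) : V)) := rfl

lemma right_smul_def (r : R) (v : σ.bimod V) :
    op r • v = (show σ.bimod V from (op (σ.s r) • (show V from v) : V)) := rfl

/-- The bimodule map underlying a map of right `A`-modules. -/
def bimodMap (f : V →ₗ[Aᵐᵒᵖ] W) : σ.bimod V ⟶ σ.bimod W :=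
  RBimod.mkHom (V := σ.bimod V) (W := σ.bimod W) f.toAddMonoidHom
    (fun r v => f.map_smul (op (σ.t (op r))) v) (fun r v => f.map_smul (op (σ.s r)) v)

lemma homOf_bimodMap (f : V →ₗ[Aᵐᵒᵖ] W) (v : V) :
    RBimod.homOf (σ.bimodMap f) v = f v := rfl

/-- For `v` in a right `A`-module `V`, the bimodule map `A → V`, `a ↦ v · a`. In particular
for `V = A` this is left multiplication by an element of `A`. -/
def orbit (v : V) : σ.reg ⟶ σ.bimod V :=
  σ.bimodMap (LinearMap.toSpanSingleton Aᵐᵒᵖ V v ∘ₗ (MulOpposite.opLinearEquiv Aᵐᵒᵖ).toLinearMap)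

lemma homOf_orbit (v : V) (a : A) : RBimod.homOf (σ.orbit v) a = op a • v := rfl

lemma orbit_add (v v' : V) (a : σ.reg) : RBimod.homOf (σ.orbit (v + v')) a =
    RBimod.homOf (σ.orbit v) a + RBimod.homOf (σ.orbit v') a := smul_add (op (show A from a)) v v'

/-- Left multiplication by `a` on the bimodule `A`. -/
def leftMul (a : A) : σ.reg ⟶ σ.reg := σ.orbit a

lemma homOf_leftMul (a b : A) : RBimod.homOf (σ.leftMul a) b = a * b := rfl

lemma leftMul_orbit (a : A) (v : V) : σ.leftMul a ≫ σ.orbit v = σ.orbit (op a • v) :=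
  RBimod.hom_ext fun b => mul_smul (op (show A from b)) (op a) v

/-- The subset `Γ ⊆ A ⊗_R A` of elements `x` with `(s(r) ⊗ 1) x = (1 ⊗ t(r)) x`. -/
def Takeuchi : Set (σ.reg ⊗ σ.reg : RBimod.{v} R) :=
  {x | ∀ r : R, RBimod.homOf (σ.leftMul (σ.s r) ⊗ₘ 𝟙 σ.reg) x =
    RBimod.homOf (𝟙 σ.reg ⊗ₘ σ.leftMul (σ.t (op r))) x}

lemma orbit_tensor_add_right (v : V) (w w' : W) (x : (σ.reg ⊗ σ.reg : RBimod.{v} R)) :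
    RBimod.homOf (σ.orbit v ⊗ₘ σ.orbit (w + w')) x =
      RBimod.homOf (σ.orbit v ⊗ₘ σ.orbit w) x + RBimod.homOf (σ.orbit v ⊗ₘ σ.orbit w') x :=
  RBimod.tens_hom_ext (f := RBimod.homOf (σ.orbit v ⊗ₘ σ.orbit (w + w')))
    (g := RBimod.homOf (σ.orbit v ⊗ₘ σ.orbit w) + RBimod.homOf (σ.orbit v ⊗ₘ σ.orbit w'))
    (fun _ b => (congrArg (RBimod.tmul _) (σ.orbit_add w w' b)).trans (RBimod.tmul_add _ _ _)) x

lemma orbit_tensor_add_left (v v' : V) (w : W) (x : (σ.reg ⊗ σ.reg : RBimod.{v} R)) :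
    RBimod.homOf (σ.orbit (v + v') ⊗ₘ σ.orbit w) x =
      RBimod.homOf (σ.orbit v ⊗ₘ σ.orbit w) x + RBimod.homOf (σ.orbit v' ⊗ₘ σ.orbit w) x :=
  RBimod.tens_hom_ext (f := RBimod.homOf (σ.orbit (v + v') ⊗ₘ σ.orbit w))
    (g := RBimod.homOf (σ.orbit v ⊗ₘ σ.orbit w) + RBimod.homOf (σ.orbit v' ⊗ₘ σ.orbit w))
    (fun a _ => (congrArg (RBimod.tmul · _) (σ.orbit_add v v' a)).trans
      (RBimod.add_tmul _ _ _)) x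

/-- For `x = ∑ aᵢ ⊗ bᵢ`, the biadditive map `(v, w) ↦ ∑ (v · aᵢ) ⊗ (w · bᵢ)`. -/
def preAct (V W : Type v) [AddCommGroup V] [Module Aᵐᵒᵖ V] [AddCommGroup W] [Module Aᵐᵒᵖ W]
    (x : (σ.reg ⊗ σ.reg : RBimod.{v} R)) :
    V →+ W →+ (σ.bimod V ⊗ σ.bimod W : RBimod.{v} R) :=
  AddMonoidHom.mk' (fun v => AddMonoidHom.mk'
      (fun w => RBimod.homOf (σ.orbit v ⊗ₘ σ.orbit w) x)
      (fun w w' => σ.orbit_tensor_add_right v w w' x))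
    (fun v v' => AddMonoidHom.ext fun w => σ.orbit_tensor_add_left v v' w x)

lemma preAct_balanced (x : (σ.reg ⊗ σ.reg : RBimod.{v} R)) (hx : x ∈ σ.Takeuchi)
    (v : V) (r : R) (w : W) :
    RBimod.homOf (σ.orbit (op (σ.s r) • v) ⊗ₘ σ.orbit w) x =
      RBimod.homOf (σ.orbit v ⊗ₘ σ.orbit (op (σ.t (op r)) • w)) x := by
  have h := congrArg (RBimod.homOf (σ.orbit v ⊗ₘ σ.orbit w)) (hx r)
  rw [← RBimod.homOf_comp, ← RBimod.homOf_comp, tensorHom_comp_tensorHom,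
    tensorHom_comp_tensorHom, Category.id_comp, Category.id_comp, leftMul_orbit,
    leftMul_orbit] at h
  exact h

/-- The operation of `x = ∑ aᵢ ⊗ bᵢ ∈ Γ` on `V ⊗_R W`: `v ⊗ w ↦ ∑ (v · aᵢ) ⊗ (w · bᵢ)`. -/
def act (V W : Type v) [AddCommGroup V] [Module Aᵐᵒᵖ V] [AddCommGroup W] [Module Aᵐᵒᵖ W]
    (x : (σ.reg ⊗ σ.reg : RBimod.{v} R)) (hx : x ∈ σ.Takeuchi) :
    (σ.bimod V ⊗ σ.bimod W : RBimod.{v} R) →+ (σ.bimod V ⊗ σ.bimod W : RBimod.{v} R) :=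
  RBimod.lift (V := σ.bimod V) (W := σ.bimod W) (σ.preAct V W x)
    (fun v r w => σ.preAct_balanced (V := V) (W := W) x hx v r w)

lemma act_tmul (x : (σ.reg ⊗ σ.reg : RBimod.{v} R)) (hx : x ∈ σ.Takeuchi)
    (v : V) (w : W) :
    σ.act V W x hx (RBimod.tmul (V := σ.bimod V) (W := σ.bimod W) v w) =
      RBimod.homOf (σ.orbit v ⊗ₘ σ.orbit w) x := rfl

end SourceTarget

/-- A (right) bialgebroid structure on the ring `A` with base ring `R`: the bimodule `A` carries a
comonoid structure `⟨A, γ, π⟩` in the monoidal category of `R`-`R`-bimodules, where `γ` takes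
values in `Γ` and is multiplicative and unital for the product `x y` in `Γ`, and `π` satisfies
the corresponding conditions. -/
structure Bialgebroid (R A : Type v) [Ring R] [Ring A] extends SourceTarget R A where
  γ : toSourceTarget.reg ⟶ toSourceTarget.reg ⊗ toSourceTarget.reg
  π : toSourceTarget.reg ⟶ 𝟙_ (RBimod.{v} R)
  coassoc : γ ≫ (γ ▷ toSourceTarget.reg) ≫ (α_ _ _ _).hom = γ ≫ (toSourceTarget.reg ◁ γ)
  counit_left : γ ≫ (π ▷ toSourceTarget.reg) ≫ (λ_ _).hom = 𝟙 _
  counit_right : γ ≫ (toSourceTarget.reg ◁ π) ≫ (ρ_ _).hom = 𝟙 _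
  γ_mem : ∀ a : A, RBimod.homOf γ a ∈ toSourceTarget.Takeuchi
  /-- `γ(a) γ(b) = γ(ab)` -/
  γ_mul : ∀ a b : A, toSourceTarget.act A A (RBimod.homOf γ b) (γ_mem b) (RBimod.homOf γ a) =
    RBimod.homOf γ (a * b : A)
  γ_one : RBimod.homOf γ (1 : A) =
    RBimod.tmul (V := toSourceTarget.reg) (W := toSourceTarget.reg) (1 : A) (1 : A)
  π_one : RBimod.homOf π (1 : A) = (1 : R)
  /-- `π(t(π(a)) b) = π(ab)` -/
  π_t : ∀ a b : A, RBimod.homOf π (t (op (RBimod.homOf π a)) * b : A) = RBimod.homOf π (a * b : A)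
  /-- `π(s(π(a)) b) = π(ab)` -/
  π_s : ∀ a b : A, RBimod.homOf π (s (RBimod.homOf π a) * b : A) = RBimod.homOf π (a * b : A)

namespace Bialgebroid

variable {R A : Type v} [Ring R] [Ring A] (B : Bialgebroid R A)

/-- The comultiplication `γ`. -/
def comul : A →+ (B.reg ⊗ B.reg : RBimod.{v} R) := RBimod.homOf B.γ

/-- The counit `π`. -/
def counit : A →+ R := RBimod.homOf B.π

/-- The element `a ⊗ b` of `A ⊗_R A`. -/
def tmulA (a b : A) : (B.reg ⊗ B.reg : RBimod.{v} R) := RBimod.tmul (V := B.reg) (W := B.reg) a b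

lemma comul_one : B.comul 1 = B.tmulA 1 1 := B.γ_one

lemma comul_mem (a : A) : B.comul a ∈ B.Takeuchi := B.γ_mem a

lemma comul_mul (a b : A) : B.comul (a * b) = B.act A A (B.comul b) (B.comul_mem b) (B.comul a) :=
  (B.γ_mul a b).symm

lemma comul_s (r : R) : B.comul (B.s r) = B.tmulA 1 (B.s r) := by
  have h : B.comul (1 * B.s r) = RBimod.ract B.reg B.reg (op r) (B.comul 1) :=
    RBimod.homOf_op_smul B.γ r (1 : A)
  rw [one_mul, comul_one] at h
  have h' : RBimod.ract B.reg B.reg (op r) (B.tmulA 1 1) = B.tmulA 1 (1 * B.s r) := rfl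
  rw [h, h', one_mul]

lemma comul_t (r : R) : B.comul (B.t (op r)) = B.tmulA (B.t (op r)) 1 := by
  have h : B.comul (1 * B.t (op r)) = RBimod.lact B.reg B.reg r (B.comul 1) :=
    RBimod.homOf_smul B.γ r (1 : A)
  rw [one_mul, comul_one] at h
  have h' : RBimod.lact B.reg B.reg r (B.tmulA 1 1) = B.tmulA (1 * B.t (op r)) 1 := rfl
  rw [h, h', one_mul]

lemma counit_one : B.counit 1 = 1 := B.π_one

lemma counit_s_mul (a b : A) : B.counit (B.s (B.counit a) * b) = B.counit (a * b) := B.π_s a b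

lemma counit_t_mul (a b : A) : B.counit (B.t (op (B.counit a)) * b) = B.counit (a * b) := B.π_t a b

lemma counit_mul_s (a : A) (r : R) : B.counit (a * B.s r) = B.counit a * r :=
  RBimod.homOf_op_smul B.π r a

lemma counit_mul_t (a : A) (r : R) : B.counit (a * B.t (op r)) = r * B.counit a :=
  RBimod.homOf_smul B.π r a

lemma counit_s (r : R) : B.counit (B.s r) = r := by
  rw [← one_mul (B.s r), counit_mul_s, counit_one, one_mul]

end Bialgebroid

/-! ## The monoidal category of right modules over a bialgebroid -/

namespace SourceTarget

variable {R A : Type v} [Ring R] [Ring A] (σ : SourceTarget R A)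
variable {V W V' W' : Type v} [AddCommGroup V] [Module Aᵐᵒᵖ V] [AddCommGroup W] [Module Aᵐᵒᵖ W]
  [AddCommGroup V'] [Module Aᵐᵒᵖ V'] [AddCommGroup W'] [Module Aᵐᵒᵖ W']

lemma orbit_bimodMap (f : V →ₗ[Aᵐᵒᵖ] W) (v : V) : σ.orbit v ≫ σ.bimodMap f = σ.orbit (f v) :=
  RBimod.hom_ext fun a => f.map_smul (op (show A from a)) v

/-- A bimodule map between right `A`-modules which is `A`-linear. -/
def IsLin (f : σ.bimod V ⟶ σ.bimod W) : Prop :=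
  ∀ v : V, σ.orbit v ≫ f = σ.orbit (V := W) (RBimod.homOf f v)

/-- The `A`-linear map defined by an `A`-linear bimodule map. -/
def toLin (f : σ.bimod V ⟶ σ.bimod W) (hf : σ.IsLin f) : V →ₗ[Aᵐᵒᵖ] W where
  toFun := RBimod.homOf f
  map_add' := (RBimod.homOf f).map_add
  map_smul' a v := congrArg (fun h : σ.reg ⟶ σ.bimod W => RBimod.homOf h (unop a : A)) (hf v)

lemma bimodMap_toLin (f : σ.bimod V ⟶ σ.bimod W) (hf : σ.IsLin f) :
    σ.bimodMap (σ.toLin f hf) = f := rfl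

lemma isLin_bimodMap (f : V →ₗ[Aᵐᵒᵖ] W) : σ.IsLin (σ.bimodMap f) := σ.orbit_bimodMap f

lemma IsLin.inv {e : σ.bimod V ≅ σ.bimod W} (h : σ.IsLin e.hom) : σ.IsLin e.inv := fun w => by
  have h1 := h (RBimod.homOf e.inv w)
  have h2 : RBimod.homOf e.hom (RBimod.homOf e.inv w) = w :=
    congrArg (fun k => RBimod.homOf k w) e.inv_hom_id
  rw [h2] at h1
  exact (Iso.comp_inv_eq e).2 h1.symm

lemma act_natural (f : V →ₗ[Aᵐᵒᵖ] V') (g : W →ₗ[Aᵐᵒᵖ] W')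
    (x : (σ.reg ⊗ σ.reg : RBimod.{v} R)) (hx : x ∈ σ.Takeuchi)
    (y : (σ.bimod V ⊗ σ.bimod W : RBimod.{v} R)) :
    RBimod.homOf (σ.bimodMap f ⊗ₘ σ.bimodMap g) (σ.act V W x hx y) =
      σ.act V' W' x hx (RBimod.homOf (σ.bimodMap f ⊗ₘ σ.bimodMap g) y) := by
  refine RBimod.tens_hom_ext
    (f := (RBimod.homOf (σ.bimodMap f ⊗ₘ σ.bimodMap g)).comp (σ.act V W x hx))
    (g := (σ.act V' W' x hx).comp (RBimod.homOf (σ.bimodMap f ⊗ₘ σ.bimodMap g)))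
    (fun (v : V) (w : W) => ?_) y
  change RBimod.homOf (σ.bimodMap f ⊗ₘ σ.bimodMap g) (RBimod.homOf (σ.orbit v ⊗ₘ σ.orbit w) x) =
    RBimod.homOf (σ.orbit (f v) ⊗ₘ σ.orbit (g w)) x
  rw [← RBimod.homOf_comp, tensorHom_comp_tensorHom, orbit_bimodMap, orbit_bimodMap]

end SourceTarget

namespace Bialgebroid

variable {R A : Type v} [Ring R] [Ring A] (B : Bialgebroid R A)

/-- The abelian group `V ⊗_R W`, to be equipped with its `A`-module structure. -/
def TensMod (V W : Type v) [AddCommGroup V] [Module Aᵐᵒᵖ V] [AddCommGroup W] [Module Aᵐᵒᵖ W] :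
    Type v := (B.bimod V ⊗ B.bimod W : RBimod.{v} R)

section

variable (V W : Type v) [AddCommGroup V] [Module Aᵐᵒᵖ V] [AddCommGroup W] [Module Aᵐᵒᵖ W]

instance : AddCommGroup (B.TensMod V W) :=
  inferInstanceAs (AddCommGroup (B.bimod V ⊗ B.bimod W : RBimod.{v} R))

/-- The action of `a` on `V ⊗_R W` through `γ(a)`. -/
def actHom (a : A) : B.TensMod V W →+ B.TensMod V W :=
  B.act V W (RBimod.homOf B.γ a) (B.γ_mem a)

variable {V W} in
/-- The element `v ⊗ w` of `V ⊗_R W`. -/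
def tm (v : V) (w : W) : B.TensMod V W := RBimod.tmul (V := B.bimod V) (W := B.bimod W) v w

variable {V W} in
lemma tens_ext {P : Type v} [AddCommGroup P] {f g : B.TensMod V W →+ P}
    (h : ∀ v w, f (B.tm v w) = g (B.tm v w)) (x : B.TensMod V W) : f x = g x :=
  RBimod.tens_hom_ext (f := f) (g := g) h x

variable {V W} in
/-- The map `a ⊗ b ↦ (v · a) ⊗ (w · b)`. -/
def orbit₂ (v : V) (w : W) : (B.reg ⊗ B.reg : RBimod.{v} R) →+ B.TensMod V W :=
  RBimod.homOf (B.orbit v ⊗ₘ B.orbit w)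

variable {V W} in
lemma orbit₂_tmulA (v : V) (w : W) (a b : A) :
    B.orbit₂ v w (B.tmulA a b) = B.tm (op a • v) (op b • w) := rfl

variable {V W} in
lemma actHom_tm (a : A) (v : V) (w : W) :
    B.actHom V W a (B.tm v w) = B.orbit₂ v w (B.comul a) := rfl

variable {V W} in
lemma orbit₂_act (v : V) (w : W) (a : A) (x : (B.reg ⊗ B.reg : RBimod.{v} R)) :
    B.orbit₂ v w (B.act A A (B.comul a) (B.comul_mem a) x) = B.actHom V W a (B.orbit₂ v w x) :=
  B.act_natural _ _ _ _ _

/-- The right `A`-module `V ⊗_R W`: `(v ⊗ w) · a = ∑ (v · a₁) ⊗ (w · a₂)`. -/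
instance : Module Aᵐᵒᵖ (B.TensMod V W) where
  smul a x := B.actHom V W (unop a) x
  one_smul x := B.tens_ext (f := B.actHom V W 1) (g := .id _) (fun v w => by
    rw [actHom_tm, comul_one, orbit₂_tmulA, MulOpposite.op_one, one_smul, one_smul]; rfl) x
  mul_smul a b x := B.tens_ext (f := B.actHom V W (unop b * unop a))
    (g := (B.actHom V W (unop a)).comp (B.actHom V W (unop b))) (fun v w => by
      rw [actHom_tm, comul_mul, orbit₂_act]; rfl) x
  smul_zero a := map_zero (B.actHom V W (unop a))
  smul_add a := map_add (B.actHom V W (unop a))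
  add_smul a b x := B.tens_ext (f := B.actHom V W (unop a + unop b))
    (g := B.actHom V W (unop a) + B.actHom V W (unop b)) (fun v w => by
      rw [AddMonoidHom.add_apply, actHom_tm, actHom_tm, actHom_tm, map_add, map_add]) x
  zero_smul x := B.tens_ext (f := B.actHom V W 0) (g := 0) (fun v w => by
      rw [actHom_tm, map_zero, map_zero]; rfl) x

lemma smul_tensMod_def (a : A) (x : B.TensMod V W) : op a • x = B.actHom V W a x := rfl

lemma actHom_t (r : R) (x : B.TensMod V W) :
    RBimod.lact (B.bimod V) (B.bimod W) r x = B.actHom V W (B.t (op r)) x :=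
  B.tens_ext (f := RBimod.lact (B.bimod V) (B.bimod W) r)
    (g := B.actHom V W (B.t (op r))) (fun v w => by
      have h : B.actHom V W (B.t (op r)) (B.tm v w) = B.tm (op (B.t (op r)) • v) w := by
        rw [actHom_tm, comul_t, orbit₂_tmulA, MulOpposite.op_one, one_smul]
      exact h.symm) x

lemma actHom_s (r : R) (x : B.TensMod V W) :
    RBimod.ract (B.bimod V) (B.bimod W) (op r) x = B.actHom V W (B.s r) x :=
  B.tens_ext (f := RBimod.ract (B.bimod V) (B.bimod W) (op r))
    (g := B.actHom V W (B.s r)) (fun v w => by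
      have h : B.actHom V W (B.s r) (B.tm v w) = B.tm v (op (B.s r) • w) := by
        rw [actHom_tm, comul_s, orbit₂_tmulA, MulOpposite.op_one, one_smul]
      exact h.symm) x

/-- The identity map, as an isomorphism from the tensor product of the underlying bimodules to the
bimodule underlying the tensor product of right `A`-modules. -/
def tensIso : B.bimod V ⊗ B.bimod W ≅ B.bimod (B.TensMod V W) :=
  let f : (B.bimod V ⊗ B.bimod W : RBimod.{v} R) ⟶ B.bimod (B.TensMod V W) :=
    RBimod.mkHom (W := B.bimod (B.TensMod V W)) (AddMonoidHom.id (B.TensMod V W))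
      (B.actHom_t V W) (B.actHom_s V W)
  RBimod.mkIso f
    (RBimod.mkHom (V := B.bimod (B.TensMod V W)) (AddMonoidHom.id (B.TensMod V W))
      (fun r x => (RBimod.homOf_smul f r x).symm) (fun r x => (RBimod.homOf_op_smul f r x).symm))
    (fun _ => rfl) (fun _ => rfl)

variable {V W} in
lemma orbit_tm (v : V) (w : W) :
    B.orbit (B.tm v w) ≫ (B.tensIso V W).inv = B.γ ≫ (B.orbit v ⊗ₘ B.orbit w) := rfl

variable {V W} in
lemma isLin_of_tm {P : Type v} [AddCommGroup P] [Module Aᵐᵒᵖ P]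
    (f : B.bimod (B.TensMod V W) ⟶ B.bimod P)
    (h : ∀ v w, B.orbit (B.tm v w) ≫ f = B.orbit (V := P) (RBimod.homOf f (B.tm v w))) :
    B.IsLin f := fun x => RBimod.hom_ext fun (a : A) =>
  B.tens_ext (f := (RBimod.homOf f).comp (B.actHom V W a))
    (g := (DistribSMul.toAddMonoidHom P (op a)).comp (RBimod.homOf f))
    (fun v w => congrArg (fun k => RBimod.homOf k a) (h v w)) x

end

/-- The base ring `R`, to be equipped with its `A`-module structure. -/
def UnitMod (_ : Bialgebroid R A) : Type v := R

instance : AddCommGroup B.UnitMod := inferInstanceAs (AddCommGroup R)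

/-- The right action of `a` on `R`: `r ↦ π(s(r) a)`. -/
def unitAct (a : A) : R →+ R :=
  (B.counit.comp (AddMonoidHom.mulRight a)).comp B.s.toAddMonoidHom

lemma unitAct_apply (a : A) (r : R) : B.unitAct a r = B.counit (B.s r * a) := rfl

/-- The right `A`-module `R`: `r · a = π(s(r) a)`. -/
instance : Module Aᵐᵒᵖ B.UnitMod where
  smul a r := B.unitAct (unop a) r
  one_smul r := (congrArg B.counit (mul_one (B.s r))).trans (B.counit_s r)
  mul_smul a b (r : R) := by
    change B.unitAct (unop b * unop a) r = B.unitAct (unop a) (B.unitAct (unop b) r)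
    rw [unitAct_apply, unitAct_apply, unitAct_apply, counit_s_mul, mul_assoc]
  smul_zero a := map_zero (B.unitAct (unop a))
  smul_add a := map_add (B.unitAct (unop a))
  add_smul a b (r : R) := by
    change B.unitAct (unop a + unop b) r = (B.unitAct (unop a) r + B.unitAct (unop b) r : R)
    rw [unitAct_apply, mul_add, map_add]; rfl
  zero_smul (r : R) := by
    change B.unitAct 0 r = (0 : R)
    rw [unitAct_apply, mul_zero, map_zero]

lemma unitAct_t (r x : R) : r * x = B.unitAct (B.t (op r)) x := by
  rw [unitAct_apply, counit_mul_t, counit_s]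

lemma unitAct_s (r x : R) : x * r = B.unitAct (B.s r) x := by
  rw [unitAct_apply, counit_mul_s, counit_s]

/-- The identity map of `R`, as an isomorphism from the bimodule `R` to the bimodule underlying the
right `A`-module `R`. -/
def unitIso : 𝟙_ (RBimod.{v} R) ≅ B.bimod B.UnitMod :=
  let f : 𝟙_ (RBimod.{v} R) ⟶ B.bimod B.UnitMod :=
    RBimod.mkHom (V := RBimod.regular R) (W := B.bimod B.UnitMod) (AddMonoidHom.id R)
      B.unitAct_t B.unitAct_s
  RBimod.mkIso f
    (RBimod.mkHom (V := B.bimod B.UnitMod) (W := RBimod.regular R) (AddMonoidHom.id R)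
      (fun r x => (RBimod.homOf_smul f r x).symm) (fun r x => (RBimod.homOf_op_smul f r x).symm))
    (fun _ => rfl) (fun _ => rfl)

lemma orbit_unit (r : R) :
    B.orbit (V := B.UnitMod) r ≫ B.unitIso.inv = B.leftMul (B.s r) ≫ B.π := rfl

lemma leftMul_s_π (r : R) : B.leftMul (B.s r) ≫ B.π = B.leftMul (B.t (op r)) ≫ B.π :=
  RBimod.hom_ext fun (a : A) => by
    have h := (B.counit_s_mul (B.s r) a).trans (B.counit_t_mul (B.s r) a).symm
    rw [counit_s] at h
    exact h

lemma γ_leftMul (r : R) : B.γ ≫ (B.leftMul (B.s r) ⊗ₘ 𝟙 B.reg) =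
    B.γ ≫ (𝟙 B.reg ⊗ₘ B.leftMul (B.t (op r))) :=
  RBimod.hom_ext fun (a : A) => B.γ_mem a r

/-- The category of right `A`-modules. -/
def RMod (_ : Bialgebroid R A) : Type (v + 1) := ModuleCat.{v} Aᵐᵒᵖ

instance : Category.{v} B.RMod := inferInstanceAs (Category.{v} (ModuleCat.{v} Aᵐᵒᵖ))

/-- The right `A`-module underlying an object of `B.RMod`. -/
def asModule (V : B.RMod) : ModuleCat.{v} Aᵐᵒᵖ := V

/-- A right `A`-module as an object of `B.RMod`. -/
def ofModule (V : Type v) [AddCommGroup V] [Module Aᵐᵒᵖ V] : B.RMod := ModuleCat.of Aᵐᵒᵖ V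

/-- A linear map as a morphism of `B.RMod`. -/
def ofLin {V W : B.RMod} (f : B.asModule V →ₗ[Aᵐᵒᵖ] B.asModule W) : V ⟶ W :=
  ModuleCat.ofHom (X := B.asModule V) (Y := B.asModule W) f

/-- The linear map underlying a morphism of `B.RMod`. -/
def asLin {V W : B.RMod} (f : V ⟶ W) : B.asModule V →ₗ[Aᵐᵒᵖ] B.asModule W :=
  ModuleCat.Hom.hom (A := B.asModule V) (B := B.asModule W) f

/-- The forgetful functor from right `A`-modules to `R`-`R`-bimodules. -/
def forget : B.RMod ⥤ RBimod.{v} R where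
  obj V := B.bimod (B.asModule V)
  map {V W} f := B.bimodMap (V := B.asModule V) (W := B.asModule W) (B.asLin f)
  map_id _ := rfl
  map_comp _ _ := rfl

instance : B.forget.Faithful where
  map_injective {V W} _ _ h :=
    ModuleCat.hom_ext (M := B.asModule V) (N := B.asModule W)
      (LinearMap.ext fun v => congrArg (fun k => RBimod.homOf k v) h)

/-- A morphism of `B.RMod` from an `A`-linear bimodule map. -/
def mkMor {V W : B.RMod} (f : B.forget.obj V ⟶ B.forget.obj W)
    (hf : B.IsLin (V := B.asModule V) (W := B.asModule W) f) : V ⟶ W :=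
  B.ofLin (B.toLin f hf)

lemma forget_mkMor {V W : B.RMod} (f : B.forget.obj V ⟶ B.forget.obj W)
    (hf : B.IsLin (V := B.asModule V) (W := B.asModule W) f) :
    B.forget.map (B.mkMor f hf) = f := rfl

lemma isLin_forget_map {V W : B.RMod} (f : V ⟶ W) :
    B.IsLin (V := B.asModule V) (W := B.asModule W) (B.forget.map f) :=
  B.isLin_bimodMap (B.asLin f)

/-- An isomorphism of `B.RMod` from an `A`-linear bimodule isomorphism. -/
def mkMorIso {V W : B.RMod} (e : B.forget.obj V ≅ B.forget.obj W)
    (he : B.IsLin (V := B.asModule V) (W := B.asModule W) e.hom) : V ≅ W where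
  hom := B.mkMor e.hom he
  inv := B.mkMor e.inv (he.inv (V := B.asModule V) (W := B.asModule W))
  hom_inv_id := B.forget.map_injective <| by
    rw [Functor.map_comp, forget_mkMor, forget_mkMor, e.hom_inv_id, CategoryTheory.Functor.map_id]
  inv_hom_id := B.forget.map_injective <| by
    rw [Functor.map_comp, forget_mkMor, forget_mkMor, e.inv_hom_id, CategoryTheory.Functor.map_id]

/-- `V ⊗_R W` as an object of `B.RMod`. -/
def tensorObj' (V W : B.RMod) : B.RMod := B.ofModule (B.TensMod (B.asModule V) (B.asModule W))

/-- `R` as an object of `B.RMod`. -/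
def unitObj : B.RMod := B.ofModule B.UnitMod

/-- The comparison of tensor products for the forgetful functor; the underlying map is the
identity. -/
def μIso (V W : B.RMod) : B.forget.obj V ⊗ B.forget.obj W ≅ B.forget.obj (B.tensorObj' V W) :=
  B.tensIso (B.asModule V) (B.asModule W)

/-- The comparison of units for the forgetful functor; the underlying map is the identity. -/
def εIso : 𝟙_ (RBimod.{v} R) ≅ B.forget.obj B.unitObj := B.unitIso

/-- For `v : V`, the bimodule map `A → V`, `a ↦ v · a`. -/
def orb {V : B.RMod} (v : B.asModule V) : B.reg ⟶ B.forget.obj V :=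
  B.orbit (V := B.asModule V) v

/-- The element `v ⊗ w`. -/
def tm' {V W : B.RMod} (v : B.asModule V) (w : B.asModule W) : B.asModule (B.tensorObj' V W) :=
  B.tm (V := B.asModule V) (W := B.asModule W) v w

/-- A bimodule map applied to an element. -/
def ap {V W : B.RMod} (f : B.forget.obj V ⟶ B.forget.obj W) (v : B.asModule V) : B.asModule W :=
  RBimod.homOf f v

/-- `A`-linearity of a bimodule map between objects of `B.RMod`. -/
def Lin {V W : B.RMod} (f : B.forget.obj V ⟶ B.forget.obj W) : Prop :=
  ∀ v, B.orb v ≫ f = B.orb (B.ap f v)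

lemma Lin.comp {U V W : B.RMod} {f : B.forget.obj U ⟶ B.forget.obj V}
    {g : B.forget.obj V ⟶ B.forget.obj W} (hf : B.Lin f) (hg : B.Lin g) : B.Lin (f ≫ g) :=
  fun v => by rw [← Category.assoc, hf v, hg]; rfl

lemma orb_tm {V W : B.RMod} (v : B.asModule V) (w : B.asModule W) :
    B.orb (B.tm' v w) = B.γ ≫ (B.orb v ⊗ₘ B.orb w) ≫ (B.μIso V W).hom := rfl

lemma lin_of_tm {V W P : B.RMod} {f : B.forget.obj (B.tensorObj' V W) ⟶ B.forget.obj P}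
    (h : ∀ (v : B.asModule V) (w : B.asModule W),
      B.orb (B.tm' v w) ≫ f = B.orb (B.ap f (B.tm' v w))) : B.Lin f :=
  B.isLin_of_tm (V := B.asModule V) (W := B.asModule W) (P := B.asModule P) f h

lemma lin_of_tm₃ {U V W P : B.RMod}
    {f : B.forget.obj (B.tensorObj' (B.tensorObj' U V) W) ⟶ B.forget.obj P}
    (h : ∀ (u : B.asModule U) (v : B.asModule V) (w : B.asModule W),
      B.orb (B.tm' (B.tm' u v) w) ≫ f = B.orb (B.ap f (B.tm' (B.tm' u v) w))) : B.Lin f :=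
  B.lin_of_tm fun x w => RBimod.hom_ext fun (a : A) =>
    B.tens_ext (V := B.asModule U) (W := B.asModule V) (P := B.asModule P)
      (f := ((RBimod.homOf f).comp (B.actHom (B.asModule (B.tensorObj' U V)) (B.asModule W) a)).comp
        ((RBimod.tmulHom (B.forget.obj (B.tensorObj' U V)) (B.forget.obj W)).flip w))
      (g := ((DistribSMul.toAddMonoidHom (B.asModule P) (op a)).comp (RBimod.homOf f)).comp
        ((RBimod.tmulHom (B.forget.obj (B.tensorObj' U V)) (B.forget.obj W)).flip w))
      (fun u v => congrArg (fun k => RBimod.homOf k a) (h u v w)) x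

/-- `f ⊗_R g`. -/
def tensorHom' {V W V' W' : B.RMod} (f : V ⟶ V') (g : W ⟶ W') :
    B.tensorObj' V W ⟶ B.tensorObj' V' W' :=
  B.mkMor ((B.μIso V W).inv ≫ (B.forget.map f ⊗ₘ B.forget.map g) ≫ (B.μIso V' W').hom)
    (B.lin_of_tm fun v w => by
      rw [orb_tm, Category.assoc, Category.assoc, Iso.hom_inv_id_assoc,
        tensorHom_comp_tensorHom_assoc]
      rw [show B.orb v ≫ B.forget.map f = B.orb (B.ap (B.forget.map f) v) from
        B.isLin_forget_map f v, show B.orb w ≫ B.forget.map g = B.orb (B.ap (B.forget.map g) w) from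
        B.isLin_forget_map g w, ← orb_tm]
      rfl)

lemma forget_tensorHom' {V W V' W' : B.RMod} (f : V ⟶ V') (g : W ⟶ W') :
    B.forget.map (B.tensorHom' f g) =
      (B.μIso V W).inv ≫ (B.forget.map f ⊗ₘ B.forget.map g) ≫ (B.μIso V' W').hom := rfl

/-- The associativity constraint, which on underlying groups is the usual one. -/
def assocIso (U V W : B.RMod) :
    B.tensorObj' (B.tensorObj' U V) W ≅ B.tensorObj' U (B.tensorObj' V W) :=
  B.mkMorIso ((((B.μIso _ _).symm ≪≫ ((B.μIso _ _).symm ⊗ᵢ .refl _))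
        ≪≫ α_ (B.forget.obj U) (B.forget.obj V) (B.forget.obj W)
        ≪≫ ((.refl _ ⊗ᵢ B.μIso _ _) ≪≫ B.μIso _ _)))
    (B.lin_of_tm₃ fun u v w => by
      have h : B.ap (((((B.μIso _ _).symm ≪≫ ((B.μIso _ _).symm ⊗ᵢ .refl _))
        ≪≫ α_ (B.forget.obj U) (B.forget.obj V) (B.forget.obj W)
        ≪≫ ((.refl _ ⊗ᵢ B.μIso _ _) ≪≫ B.μIso _ _))).hom) (B.tm' (B.tm' u v) w) =
          B.tm' u (B.tm' v w) := rfl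
      rw [h]
      simp only [orb_tm, Iso.trans_hom, Iso.symm_hom, tensorIso_hom, Iso.refl_hom,
        Category.assoc, Iso.hom_inv_id_assoc]
      rw [tensorHom_comp_tensorHom_assoc]
      simp only [Category.assoc, Iso.hom_inv_id, Category.comp_id]
      have h1 : (B.γ ≫ (B.orb u ⊗ₘ B.orb v)) ⊗ₘ B.orb w =
          (B.γ ▷ B.reg) ≫ ((B.orb u ⊗ₘ B.orb v) ⊗ₘ B.orb w) := by
        rw [← tensorHom_id, tensorHom_comp_tensorHom, Category.id_comp]
      rw [h1, Category.assoc, associator_naturality_assoc, reassoc_of% B.coassoc,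
        ← id_tensorHom, tensorHom_comp_tensorHom_assoc, tensorHom_comp_tensorHom_assoc]
      simp only [Category.assoc, Category.comp_id, Category.id_comp])

/-- An element of the unit object, as an element of `R`. -/
def baseOf (r : B.asModule B.unitObj) : R := r

/-- The left unit constraint, which on underlying groups is the usual one. -/
def leftUnitIso (V : B.RMod) : B.tensorObj' B.unitObj V ≅ V :=
  B.mkMorIso (((B.μIso _ _).symm ≪≫ (B.εIso.symm ⊗ᵢ .refl _)) ≪≫ λ_ (B.forget.obj V))
    (B.lin_of_tm fun r v => by
      have h : B.ap (((B.μIso _ _).symm ≪≫ (B.εIso.symm ⊗ᵢ .refl _)) ≪≫ λ_ (B.forget.obj V)).hom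
        (B.tm' (V := B.unitObj) r v) = op (B.t (op (B.baseOf r))) • v := rfl
      rw [h]
      simp only [orb_tm, Iso.trans_hom, Iso.symm_hom, tensorIso_hom, Iso.refl_hom,
        Category.assoc, Iso.hom_inv_id_assoc]
      have h1 : B.orb (V := B.unitObj) r ≫ B.εIso.inv = B.leftMul (B.s (B.baseOf r)) ≫ B.π := rfl
      have h2 : (B.leftMul (B.s (B.baseOf r)) ≫ B.π) ⊗ₘ B.orb v =
        (B.leftMul (B.s (B.baseOf r)) ⊗ₘ 𝟙 _) ≫ (B.π ⊗ₘ B.orb v) := by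
          rw [tensorHom_comp_tensorHom, Category.id_comp]
      have h3 : B.leftMul (B.t (op (B.baseOf r))) ≫ B.orb v = B.orb (op (B.t (op (B.baseOf r))) • v) :=
        B.leftMul_orbit _ _
      have h4 : B.π ⊗ₘ B.orb (op (B.t (op (B.baseOf r))) • v) =
        (B.π ▷ B.reg) ≫ (𝟙_ _ ◁ B.orb (op (B.t (op (B.baseOf r))) • v)) := by
          rw [MonoidalCategory.tensorHom_def]
      rw [tensorHom_comp_tensorHom_assoc, h1, Category.comp_id, h2, Category.assoc,
        reassoc_of% (B.γ_leftMul (B.baseOf r)), tensorHom_comp_tensorHom_assoc, Category.id_comp, h3, h4,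
        Category.assoc, leftUnitor_naturality, reassoc_of% B.counit_left])

/-- The right unit constraint, which on underlying groups is the usual one. -/
def rightUnitIso (V : B.RMod) : B.tensorObj' V B.unitObj ≅ V :=
  B.mkMorIso (((B.μIso _ _).symm ≪≫ (.refl _ ⊗ᵢ B.εIso.symm)) ≪≫ ρ_ (B.forget.obj V))
    (B.lin_of_tm fun v r => by
      have h : B.ap (((B.μIso _ _).symm ≪≫ (.refl _ ⊗ᵢ B.εIso.symm)) ≪≫ ρ_ (B.forget.obj V)).hom
        (B.tm' (W := B.unitObj) v r) = op (B.s (B.baseOf r)) • v := rfl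
      rw [h]
      simp only [orb_tm, Iso.trans_hom, Iso.symm_hom, tensorIso_hom, Iso.refl_hom,
        Category.assoc, Iso.hom_inv_id_assoc]
      have h1 : B.orb (V := B.unitObj) r ≫ B.εIso.inv = B.leftMul (B.t (op (B.baseOf r))) ≫ B.π :=
        B.leftMul_s_π (B.baseOf r)
      have h2 : B.orb v ⊗ₘ (B.leftMul (B.t (op (B.baseOf r))) ≫ B.π) =
        (𝟙 _ ⊗ₘ B.leftMul (B.t (op (B.baseOf r)))) ≫ (B.orb v ⊗ₘ B.π) := by
          rw [tensorHom_comp_tensorHom, Category.id_comp]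
      have h3 : B.leftMul (B.s (B.baseOf r)) ≫ B.orb v = B.orb (op (B.s (B.baseOf r)) • v) :=
        B.leftMul_orbit _ _
      have h4 : B.orb (op (B.s (B.baseOf r)) • v) ⊗ₘ B.π =
        (B.reg ◁ B.π) ≫ (B.orb (op (B.s (B.baseOf r)) • v) ▷ 𝟙_ _) := by
          rw [MonoidalCategory.tensorHom_def']
      rw [tensorHom_comp_tensorHom_assoc, h1, Category.comp_id, h2, Category.assoc,
        ← reassoc_of% (B.γ_leftMul (B.baseOf r)), tensorHom_comp_tensorHom_assoc, Category.id_comp, h3, h4,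
        Category.assoc, rightUnitor_naturality, reassoc_of% B.counit_right])

instance : MonoidalCategoryStruct B.RMod where
  tensorObj := B.tensorObj'
  tensorUnit := B.unitObj
  tensorHom f g := B.tensorHom' f g
  whiskerLeft V _ _ g := B.tensorHom' (𝟙 V) g
  whiskerRight f W := B.tensorHom' f (𝟙 W)
  associator := B.assocIso
  leftUnitor := B.leftUnitIso
  rightUnitor := B.rightUnitIso

/-- The forgetful functor to bimodules is strictly compatible with tensor products and units
(the comparison maps are identities on underlying groups). -/
def inducingData : Monoidal.InducingFunctorData B.forget where
  μIso := B.μIso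
  whiskerLeft_eq _ _ _ _ := by
    refine (B.forget_tensorHom' _ _).trans ?_
    rw [CategoryTheory.Functor.map_id, id_tensorHom]
  whiskerRight_eq _ _ := by
    refine (B.forget_tensorHom' _ _).trans ?_
    rw [CategoryTheory.Functor.map_id, tensorHom_id]
  tensorHom_eq _ _ := rfl
  εIso := B.εIso
  associator_eq _ _ _ := rfl
  leftUnitor_eq _ := rfl
  rightUnitor_eq _ := rfl

/-- The monoidal structure on right `A`-modules defined by the bialgebroid `A`. -/
instance : MonoidalCategory B.RMod := Monoidal.induced B.forget B.inducingData

instance : B.forget.Monoidal := Monoidal.fromInducedMonoidal B.forget B.inducingData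

/-- Finitely generated projective right `A`-modules. -/
def fgp : ObjectProperty B.RMod := fun V =>
  Module.Finite Aᵐᵒᵖ (B.asModule V) ∧ Module.Projective Aᵐᵒᵖ (B.asModule V)

end Bialgebroid

/-! ## Split monoidal functors -/

open Functor.LaxMonoidal Functor.OplaxMonoidal in
/-- A split monoidal structure on a functor `F`: a (lax) monoidal structure `⟨F, μ, ε⟩` and a
coassociative, counital natural transformation `δ_{X,Y} : F(X ⊗ Y) ⟶ F(X) ⊗ F(Y)` with counit
`η : F(𝟙) ⟶ 𝟙`, such that `δ` splits `μ` and is compatible with `μ`. -/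
structure SplitMonoidal {C : Type*} [Category C] [MonoidalCategory C] {D : Type*} [Category D]
    [MonoidalCategory D] (F : C ⥤ D) extends F.LaxMonoidal, F.OplaxMonoidal where
  split : ∀ X Y : C, δ X Y ≫ μ X Y = 𝟙 _
  compat_left : ∀ X Y Z : C,
    (F.obj X ◁ δ Y Z) ≫ (α_ _ _ _).inv ≫ (μ X Y ▷ F.obj Z) =
      μ X (Y ⊗ Z) ≫ F.map (α_ X Y Z).inv ≫ δ (X ⊗ Y) Z
  compat_right : ∀ X Y Z : C,
    (δ X Y ▷ F.obj Z) ≫ (α_ _ _ _).hom ≫ (F.obj X ◁ μ Y Z) =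
      μ (X ⊗ Y) Z ≫ F.map (α_ X Y Z).hom ≫ δ X (Y ⊗ Z)

/-! ## Separability structures and restriction of scalars for bimodules -/

/-- A separability structure on a `Z`-algebra `R`: a `Z`-coalgebra structure `⟨R, δ, ψ⟩`
which is compatible with the multiplication `m` in the sense of Frobenius algebras and
satisfies `m ∘ δ = id`. -/
structure SeparabilityStructure (Z R : Type v) [CommRing Z] [Ring R] [Algebra Z R] extends
    Coalgebra Z R where
  /-- `(R ⊗ m) ∘ (δ ⊗ R) = δ ∘ m` -/
  frobenius_left : (LinearMap.mul' Z R).lTensor R ∘ₗ (TensorProduct.assoc Z R R R).toLinearMap ∘ₗ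
    comul.rTensor R = comul ∘ₗ LinearMap.mul' Z R
  /-- `(m ⊗ R) ∘ (R ⊗ δ) = δ ∘ m` -/
  frobenius_right : (LinearMap.mul' Z R).rTensor R ∘ₗ
    (TensorProduct.assoc Z R R R).symm.toLinearMap ∘ₗ comul.lTensor R = comul ∘ₗ LinearMap.mul' Z R
  /-- `m ∘ δ = id` -/
  separable : LinearMap.mul' Z R ∘ₗ comul = LinearMap.id

namespace SeparabilityStructure

variable {Z R : Type v} [CommRing Z] [Ring R] [Algebra Z R] (S : SeparabilityStructure Z R)

/-- The element `δ(1) = ∑ eᵢ ⊗ fᵢ`. -/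
def idem : R ⊗[Z] R := S.comul 1

lemma comul_eq_left (r : R) : S.comul r = (r ⊗ₜ[Z] (1 : R)) * S.idem := by
  have h := LinearMap.congr_fun S.frobenius_right (r ⊗ₜ[Z] (1 : R))
  simp only [LinearMap.comp_apply, LinearMap.lTensor_tmul, LinearMap.mul'_apply, mul_one] at h
  rw [← h, idem]
  generalize S.comul 1 = x
  induction x using TensorProduct.induction_on with
  | zero => simp
  | tmul e f => simp
  | add x y hx hy => rw [TensorProduct.tmul_add, map_add, map_add, hx, hy, mul_add]

lemma comul_eq_right (r : R) : S.comul r = S.idem * ((1 : R) ⊗ₜ[Z] r) := by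
  have h := LinearMap.congr_fun S.frobenius_left ((1 : R) ⊗ₜ[Z] r)
  simp only [LinearMap.comp_apply, LinearMap.rTensor_tmul, LinearMap.mul'_apply, one_mul] at h
  rw [← h, idem]
  generalize S.comul 1 = x
  induction x using TensorProduct.induction_on with
  | zero => simp
  | tmul e f => simp
  | add x y hx hy => rw [TensorProduct.add_tmul, map_add, map_add, hx, hy, add_mul]

end SeparabilityStructure

namespace RBimod

variable (Z : Type v) {R : Type v} [CommRing Z] [Ring R] [Algebra Z R]

/-- Restriction of scalars of an `R`-`R`-bimodule to a `Z`-`Z`-bimodule. -/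
def res (V : RBimod.{v} R) : RBimod.{v} Z where
  carrier := V
  left := Module.compHom V (algebraMap Z R)
  right := Module.compHom V (algebraMap Z R).op
  comm := by
    let _ := Module.compHom V (algebraMap Z R)
    let _ := Module.compHom V (algebraMap Z R).op
    exact ⟨fun z z' v => smul_comm (algebraMap Z R z) (op (algebraMap Z R z'.unop)) v⟩

/-- The bimodule map between restrictions of scalars underlying a bimodule map. -/
def resMap {V W : RBimod.{v} R} (f : V ⟶ W) : res Z V ⟶ res Z W :=
  mkHom (V := res Z V) (W := res Z W) (homOf (V := V) (W := W) f)
    (fun z x => homOf_smul f (algebraMap Z R z) x) (fun z x => homOf_op_smul f (algebraMap Z R z) x)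

variable (R) in
/-- The restriction functor from `R`-`R`-bimodules to `Z`-`Z`-bimodules. -/
def resFunctor : RBimod.{v} R ⥤ RBimod.{v} Z where
  obj V := res Z V
  map f := resMap Z f
  map_id _ := rfl
  map_comp _ _ := rfl

variable {Z} in
/-- The element `v ⊗ w` of `V ⊗_Z W`. -/
def rtm {V W : RBimod.{v} R} (v : V) (w : W) : tensor (res Z V) (res Z W) :=
  tmul (V := res Z V) (W := res Z W) v w

lemma rtm_add {V W : RBimod.{v} R} (v : V) (w w' : W) :
    rtm (Z := Z) v (w + w') = rtm v w + rtm v w' := tmul_add (V := res Z V) (W := res Z W) v w w'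

lemma add_rtm {V W : RBimod.{v} R} (v v' : V) (w : W) :
    rtm (Z := Z) (v + v') w = rtm v w + rtm v' w := add_tmul (V := res Z V) (W := res Z W) v v' w

lemma rtm_balanced {V W : RBimod.{v} R} (v : V) (z : Z) (w : W) :
    rtm (Z := Z) (op (algebraMap Z R z) • v) w = rtm v (algebraMap Z R z • w) :=
  balanced (V := res Z V) (W := res Z W) v z w

/-- The canonical epimorphism `V ⊗_Z W → V ⊗_R W`. -/
def canon (V W : RBimod.{v} R) : tensor (res Z V) (res Z W) ⟶ res Z (tensor V W) :=
  liftHom (V := res Z V) (W := res Z W) (P := res Z (tensor V W)) (tmulHom V W)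
    (fun v z w => balanced (V := V) (W := W) v (algebraMap Z R z) w)
    (fun _ _ _ => rfl) (fun _ _ _ => rfl)

lemma canon_rtm {V W : RBimod.{v} R} (v : V) (w : W) :
    homOf (canon Z V W) (rtm v w) = tmul v w := rfl

variable (R) in
/-- The unit map `Z → R`. -/
def unitMap : regular Z ⟶ res Z (regular R) :=
  mkHom (V := regular Z) (W := res Z (regular R)) (algebraMap Z R).toAddMonoidHom
    (fun z z' => map_mul (algebraMap Z R) z z')
    (fun z (z' : Z) => map_mul (algebraMap Z R) z' z)

/-- The restriction functor is monoidal through `V ⊗_Z W → V ⊗_R W` and `Z → R`. -/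
instance : (resFunctor Z R).LaxMonoidal where
  ε := unitMap Z R
  μ := canon Z
  μ_natural_left _ _ := tensor_hom_ext fun _ _ => rfl
  μ_natural_right _ _ := tensor_hom_ext fun _ _ => rfl
  associativity _ _ _ := tensor₃_hom_ext fun _ _ _ => rfl
  left_unitality _ := tensor_hom_ext fun _ _ => rfl
  right_unitality _ := tensor_hom_ext fun _ _ => rfl

/-- For `v : V` and `w : W`, the map `e ⊗ f ↦ v · e ⊗ f · w`. -/
def expand {V W : RBimod.{v} R} (v : V) (w : W) : R ⊗[Z] R →+ tensor (res Z V) (res Z W) :=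
  TensorProduct.liftAddHom
    (AddMonoidHom.mk' (fun e => AddMonoidHom.mk' (fun f => rtm (Z := Z) (op e • v) (f • w))
      (fun f f' => by rw [add_smul, rtm_add]))
      (fun e e' => AddMonoidHom.ext fun f => by
        change rtm (Z := Z) (op (e + e') • v) (f • w) = rtm (op e • v) (f • w) +
          rtm (op e' • v) (f • w)
        rw [MulOpposite.op_add, add_smul, add_rtm]))
    (fun z e f => by
      change rtm (Z := Z) (op (z • e) • v) (f • w) = rtm (op e • v) ((z • f) • w)
      rw [Algebra.smul_def, Algebra.smul_def, Algebra.commutes, MulOpposite.op_mul, mul_smul,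
        mul_smul, rtm_balanced])

lemma expand_tmul {V W : RBimod.{v} R} (v : V) (w : W) (e f : R) :
    expand Z v w (e ⊗ₜ[Z] f) = rtm (op e • v) (f • w) := rfl

/-- A property of additive maps on `R ⊗_Z R` may be checked on elements `e ⊗ f`. -/
lemma addHom_ext₂ {P : Type v} [AddCommGroup P] {f g : R ⊗[Z] R →+ P}
    (h : ∀ a b, f (a ⊗ₜ[Z] b) = g (a ⊗ₜ[Z] b)) (x : R ⊗[Z] R) : f x = g x := by
  induction x using TensorProduct.induction_on with
  | zero => rw [map_zero, map_zero]
  | tmul a b => exact h a b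
  | add x y hx hy => rw [map_add, map_add, hx, hy]

lemma expand_add_left {V W : RBimod.{v} R} (v v' : V) (w : W) (x : R ⊗[Z] R) :
    expand Z (v + v') w x = expand Z v w x + expand Z v' w x :=
  addHom_ext₂ Z (f := expand Z (v + v') w) (g := expand Z v w + expand Z v' w)
    (fun e f => by
      change rtm (Z := Z) (op e • (v + v')) (f • w) = rtm (op e • v) (f • w) +
        rtm (op e • v') (f • w)
      rw [smul_add, add_rtm]) x

lemma expand_add_right {V W : RBimod.{v} R} (v : V) (w w' : W) (x : R ⊗[Z] R) :
    expand Z v (w + w') x = expand Z v w x + expand Z v w' x :=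
  addHom_ext₂ Z (f := expand Z v (w + w')) (g := expand Z v w + expand Z v w')
    (fun e f => by
      change rtm (Z := Z) (op e • v) (f • (w + w')) = rtm (op e • v) (f • w) +
        rtm (op e • v) (f • w')
      rw [smul_add, rtm_add]) x

lemma expand_op_smul_left {V W : RBimod.{v} R} (v : V) (w : W) (r : R) (x : R ⊗[Z] R) :
    expand Z (op r • v) w x = expand Z v w ((r ⊗ₜ[Z] (1 : R)) * x) :=
  addHom_ext₂ Z (f := expand Z (op r • v) w)
    (g := (expand Z v w).comp (AddMonoidHom.mulLeft (r ⊗ₜ[Z] (1 : R))))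
    (fun e f => by
      rw [AddMonoidHom.comp_apply, AddMonoidHom.coe_mulLeft, Algebra.TensorProduct.tmul_mul_tmul,
        expand_tmul, expand_tmul, one_mul, MulOpposite.op_mul, mul_smul]) x

lemma expand_smul_right {V W : RBimod.{v} R} (v : V) (w : W) (r : R) (x : R ⊗[Z] R) :
    expand Z v (r • w) x = expand Z v w (x * ((1 : R) ⊗ₜ[Z] r)) :=
  addHom_ext₂ Z (f := expand Z v (r • w))
    (g := (expand Z v w).comp (AddMonoidHom.mulRight ((1 : R) ⊗ₜ[Z] r)))
    (fun e f => by
      rw [AddMonoidHom.comp_apply, AddMonoidHom.mulRight_apply, Algebra.TensorProduct.tmul_mul_tmul,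
        expand_tmul, expand_tmul, mul_one, mul_smul]) x

variable {Z} in
/-- For a separability structure on `R` with `δ(1) = ∑ eᵢ ⊗ fᵢ`, the map
`V ⊗_R W → V ⊗_Z W`, `v ⊗ w ↦ ∑ v · eᵢ ⊗ fᵢ · w`. -/
def splitting (S : SeparabilityStructure Z R) (V W : RBimod.{v} R) :
    res Z (tensor V W) ⟶ tensor (res Z V) (res Z W) :=
  let φ : Tens V W →+ tensor (res Z V) (res Z W) := lift
    (AddMonoidHom.mk' (fun v => AddMonoidHom.mk' (fun w => expand Z v w S.idem)
      (fun w w' => expand_add_right Z v w w' S.idem))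
      (fun v v' => AddMonoidHom.ext fun w => expand_add_left Z v v' w S.idem))
    (fun v r w => by
      change expand Z (op r • v) w S.idem = expand Z v (r • w) S.idem
      rw [expand_op_smul_left, expand_smul_right, ← S.comul_eq_left, ← S.comul_eq_right])
  mkHom (V := res Z (tensor V W)) (W := tensor (res Z V) (res Z W)) φ
    (fun z x => tens_hom_ext (f := φ.comp (lact V W (algebraMap Z R z)))
      (g := (lact (res Z V) (res Z W) z).comp φ) (fun v w =>
        addHom_ext₂ Z (f := expand Z (algebraMap Z R z • v) w)
          (g := (lact (res Z V) (res Z W) z).comp (expand Z v w))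
          (fun e f => congrArg (fun u => rtm (Z := Z) u (f • w))
            (smul_comm (algebraMap Z R z) (op e) v).symm) S.idem) x)
    (fun z x => tens_hom_ext (f := φ.comp (ract V W (op (algebraMap Z R z))))
      (g := (ract (res Z V) (res Z W) (op z)).comp φ) (fun v w =>
        addHom_ext₂ Z (f := expand Z v (op (algebraMap Z R z) • w))
          (g := (ract (res Z V) (res Z W) (op z)).comp (expand Z v w))
          (fun e f => congrArg (fun u => rtm (Z := Z) (op e • v) u)
            (smul_comm f (op (algebraMap Z R z)) w)) S.idem) x)

variable {Z} in
lemma splitting_tmul (S : SeparabilityStructure Z R) {V W : RBimod.{v} R} (v : V) (w : W) :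
    homOf (splitting S V W) (tmul v w) = expand Z v w S.idem := rfl

variable {Z} in
lemma tensor_hom_ext₂ {V W : RBimod.{v} R} {P : RBimod.{v} Z} {f g : res Z (tensor V W) ⟶ P}
    (h : ∀ (v : V) (w : W), homOf f (tmul v w : Tens V W) = homOf g (tmul v w : Tens V W)) :
    f = g :=
  hom_ext (tens_hom_ext (V := V) (W := W) (f := homOf f) (g := homOf g) h)

variable {Z} in
/-- The counit `ψ : R → Z` as a bimodule map. -/
def counitMap (S : SeparabilityStructure Z R) : res Z (regular R) ⟶ regular Z :=
  mkHom (V := res Z (regular R)) (W := regular Z) S.counit.toAddMonoidHom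
    (fun z (r : R) => by
      change S.counit (algebraMap Z R z * r) = z * S.counit r
      rw [← Algebra.smul_def, map_smul, smul_eq_mul])
    (fun z (r : R) => by
      change S.counit (r * algebraMap Z R z) = S.counit r * z
      rw [← Algebra.commutes, ← Algebra.smul_def, map_smul, smul_eq_mul, mul_comm])

end RBimod

namespace SeparabilityStructure

variable {Z R : Type v} [CommRing Z] [Ring R] [Algebra Z R] (S : SeparabilityStructure Z R)

lemma counit_left : TensorProduct.lid Z R (S.counit.rTensor R S.idem) = 1 := by
  have h := LinearMap.congr_fun S.rTensor_counit_comp_comul (1 : R)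
  rw [LinearMap.comp_apply] at h
  rw [idem, h]
  simp

lemma counit_right : TensorProduct.rid Z R (S.counit.lTensor R S.idem) = 1 := by
  have h := LinearMap.congr_fun S.lTensor_counit_comp_comul (1 : R)
  rw [LinearMap.comp_apply] at h
  rw [idem, h]
  simp

end SeparabilityStructure

namespace RBimod

variable {Z R : Type v} [CommRing Z] [Ring R] [Algebra Z R]

lemma tens₃_ext₂ {U V W : RBimod.{v} R} {P : RBimod.{v} Z}
    {f g : res Z (tensor (tensor U V) W) ⟶ P}
    (h : ∀ (u : U) (v : V) (w : W),
      homOf f (tmul (V := tensor U V) (tmul u v) w : Tens (tensor U V) W) =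
      homOf g (tmul (V := tensor U V) (tmul u v) w : Tens (tensor U V) W)) : f = g :=
  tensor_hom_ext₂ (V := tensor U V) fun x w => tens_hom_ext (V := U) (W := V)
    (f := (homOf f).comp ((tmulHom (tensor U V) W).flip w))
    (g := (homOf g).comp ((tmulHom (tensor U V) W).flip w)) (fun u v => h u v w) x

/-- A separability structure on `R` makes the restriction functor from `R`-`R`-bimodules to
`Z`-`Z`-bimodules comonoidal. -/
@[reducible] def resOplax (S : SeparabilityStructure Z R) : (resFunctor Z R).OplaxMonoidal where
  η := counitMap S
  δ := splitting S
  δ_natural_left {V V'} f W := tensor_hom_ext₂ fun v w => addHom_ext₂ Z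
    (f := (homOf (tensorMap (resMap Z f) (𝟙 (res Z W)))).comp (expand Z v w))
    (g := expand Z (homOf f v) w)
    (fun a b => congrArg (fun u => rtm (Z := Z) u (b • w)) (homOf_op_smul f a v)) S.idem
  δ_natural_right {W W'} V f := tensor_hom_ext₂ fun v w => addHom_ext₂ Z
    (f := (homOf (tensorMap (𝟙 (res Z V)) (resMap Z f))).comp (expand Z v w))
    (g := expand Z v (homOf f w))
    (fun a b => congrArg (fun u => rtm (Z := Z) (op a • v) u) (homOf_smul f b w)) S.idem
  oplax_associativity U V W := tens₃_ext₂ fun u v w => by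
    obtain ⟨s, hs⟩ := TensorProduct.exists_finset S.idem
    have E : ∀ {V W : RBimod.{v} R} (v : V) (w : W), expand Z v w S.idem =
        ∑ i ∈ s, rtm (Z := Z) (op i.1 • v) (i.2 • w) := fun v w => by
      rw [hs, map_sum]; rfl
    change homOf (assocHom (res Z U) (res Z V) (res Z W))
        (homOf (tensorMap (splitting S U V) (𝟙 (res Z W)))
          (expand Z (V := tensor U V) (tmul u v) w S.idem)) =
      homOf (tensorMap (𝟙 (res Z U)) (splitting S V W))
        (expand Z (W := tensor V W) u (tmul v w) S.idem)
    have h1 : ∀ e f : R, homOf (assocHom (res Z U) (res Z V) (res Z W))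
        (homOf (tensorMap (splitting S U V) (𝟙 (res Z W)))
          (rtm (V := tensor U V) (op e • tmul u v) (f • w))) =
        ∑ i ∈ s, tmul (V := res Z U) (W := tensor (res Z V) (res Z W)) (op i.1 • u)
          (rtm (i.2 • op e • v) (f • w)) := fun e f => by
      change (homOf (assocHom (res Z U) (res Z V) (res Z W))).comp
        ((tmulHom (tensor (res Z U) (res Z V)) (res Z W)).flip (f • w))
        (expand Z u (op e • v) S.idem) = _
      rw [E, map_sum]; rfl
    have h2 : ∀ e f : R, homOf (tensorMap (𝟙 (res Z U)) (splitting S V W))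
          (rtm (W := tensor V W) (op e • u) (f • tmul v w)) =
        ∑ i ∈ s, tmul (V := res Z U) (W := tensor (res Z V) (res Z W)) (op e • u)
          (rtm (op i.1 • f • v) (i.2 • w)) := fun e f => by
      change tmulHom (res Z U) (tensor (res Z V) (res Z W)) (op e • u)
        (expand Z (f • v) w S.idem) = _
      rw [E, map_sum]; rfl
    rw [E, E, map_sum, map_sum, map_sum]
    refine (Finset.sum_congr rfl fun i _ => h1 i.1 i.2).trans ?_
    refine Eq.trans ?_ (Finset.sum_congr rfl fun i _ => (h2 i.1 i.2).symm)
    rw [Finset.sum_comm]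
    refine Finset.sum_congr rfl fun i _ => Finset.sum_congr rfl fun j _ => ?_
    rw [smul_comm i.2 (op j.1) v]
  oplax_left_unitality V := hom_ext fun (v : V) => by
    have h := addHom_ext₂ Z
      (f := (homOf (tensorMap (counitMap S) (𝟙 (res Z V)))).comp
        (expand Z (V := regular R) (1 : R) v))
      (g := (tmulHom (regular Z) (res Z V) (1 : Z)).comp
        ((AddMonoidHom.mk' (fun r : R => r • v) (fun r s => add_smul r s _)).comp
        ((TensorProduct.lid Z R).toLinearMap ∘ₗ S.counit.rTensor R).toAddMonoidHom))
      (fun a b => by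
        change tmul (V := regular Z) (W := res Z V) (S.counit ((1 : R) * a)) (b • v) =
          tmul (V := regular Z) (W := res Z V) (1 : Z) ((S.counit a • b) • v)
        rw [one_mul, Algebra.smul_def, mul_smul]
        refine Eq.trans ?_ (balanced (V := regular Z) (W := res Z V) (1 : Z) (S.counit a) (b • v))
        exact congrArg (fun z : Z => tmul (V := regular Z) (W := res Z V) z (b • v))
          (one_mul (S.counit a)).symm) S.idem
    refine Eq.trans ?_ h.symm
    change tmul (V := regular Z) (W := res Z V) (1 : Z) v =
      tmul (V := regular Z) (W := res Z V) (1 : Z)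
        (TensorProduct.lid Z R (S.counit.rTensor R S.idem) • v)
    rw [S.counit_left, one_smul]
  oplax_right_unitality V := hom_ext fun (v : V) => by
    have h := addHom_ext₂ Z
      (f := (homOf (tensorMap (𝟙 (res Z V)) (counitMap S))).comp
        (expand Z (W := regular R) v (1 : R)))
      (g := ((tmulHom (res Z V) (regular Z)).flip (1 : Z)).comp
        ((AddMonoidHom.mk' (fun r : R => op r • v) (fun r s => add_smul (op r) (op s) _)).comp
        ((TensorProduct.rid Z R).toLinearMap ∘ₗ S.counit.lTensor R).toAddMonoidHom))
      (fun a b => by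
        change tmul (V := res Z V) (W := regular Z) (op a • v) (S.counit (b * (1 : R))) =
          tmul (V := res Z V) (W := regular Z) (op (S.counit b • a) • v) (1 : Z)
        rw [mul_one, Algebra.smul_def, Algebra.commutes, MulOpposite.op_mul, mul_smul]
        refine Eq.trans ?_
          (balanced (V := res Z V) (W := regular Z) (op a • v) (S.counit b) (1 : Z)).symm
        exact congrArg (fun z : Z => tmul (V := res Z V) (W := regular Z) (op a • v) z)
          (mul_one (S.counit b)).symm) S.idem
    refine Eq.trans ?_ h.symm
    change tmul (V := res Z V) (W := regular Z) v (1 : Z) =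
      tmul (V := res Z V) (W := regular Z)
        (op (TensorProduct.rid Z R (S.counit.lTensor R S.idem)) • v) (1 : Z)
    rw [S.counit_right, MulOpposite.op_one, one_smul]

end RBimod

/-! ## Finite progenerators and their hom-functors -/

/-- `g` is a finite progenerator: every object is a direct summand of a finite direct sum of
copies of `g`. -/
def IsFiniteProgenerator {C : Type u} [Category.{v} C] [Preadditive C] [HasFiniteBiproducts C]
    (g : C) : Prop :=
  ∀ X : C, ∃ n : ℕ, Nonempty (Retract X (⨁ fun _ : Fin n => g))

section HomFunctor

variable {C : Type u} [Category.{v} C] [MonoidalCategory C] [Preadditive C]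

/-- The commutative ring `End u` of endomorphisms of the monoidal unit. -/
instance : CommRing (End (𝟙_ C)) where
  __ := (inferInstance : Ring (End (𝟙_ C)))
  mul_comm f g := by
    change (g ≫ f : 𝟙_ C ⟶ 𝟙_ C) = f ≫ g
    have h1 : ∀ f : 𝟙_ C ⟶ 𝟙_ C, f = (λ_ (𝟙_ C)).inv ≫ (𝟙_ C ◁ f) ≫ (λ_ (𝟙_ C)).hom := by simp
    have h2 : ∀ g : 𝟙_ C ⟶ 𝟙_ C, g = (λ_ (𝟙_ C)).inv ≫ (g ▷ 𝟙_ C) ≫ (λ_ (𝟙_ C)).hom := fun g => by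
      simp only [unitors_equal, unitors_inv_equal, rightUnitor_naturality, Iso.inv_hom_id_assoc]
    rw [h1 f, h2 g]
    simp only [Category.assoc, Iso.hom_inv_id_assoc]
    rw [← whisker_exchange_assoc]

variable [MonoidalPreadditive C]

/-- The natural endomorphism `b ≅ u ⊗ b ⟶ u ⊗ b ≅ b` defined by `z : u ⟶ u`. -/
def leftEnd (b : C) : End (𝟙_ C) →+* End b where
  toFun z := (λ_ b).inv ≫ (z ▷ b) ≫ (λ_ b).hom
  map_one' := by
    change (λ_ b).inv ≫ (𝟙 (𝟙_ C) ▷ b) ≫ (λ_ b).hom = 𝟙 b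
    simp
  map_mul' z w := by
    change (λ_ b).inv ≫ ((w ≫ z : 𝟙_ C ⟶ 𝟙_ C) ▷ b) ≫ (λ_ b).hom =
      ((λ_ b).inv ≫ (w ▷ b) ≫ (λ_ b).hom) ≫ ((λ_ b).inv ≫ (z ▷ b) ≫ (λ_ b).hom)
    simp
  map_zero' := by
    change (λ_ b).inv ≫ ((0 : 𝟙_ C ⟶ 𝟙_ C) ▷ b) ≫ (λ_ b).hom = (0 : b ⟶ b)
    rw [MonoidalPreadditive.zero_whiskerRight, zero_comp, comp_zero]
  map_add' z w := by
    change (λ_ b).inv ≫ ((z + w : 𝟙_ C ⟶ 𝟙_ C) ▷ b) ≫ (λ_ b).hom =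
      ((λ_ b).inv ≫ (z ▷ b) ≫ (λ_ b).hom + (λ_ b).inv ≫ (w ▷ b) ≫ (λ_ b).hom : b ⟶ b)
    rw [MonoidalPreadditive.add_whiskerRight, Preadditive.add_comp, Preadditive.comp_add]

/-- The natural endomorphism `b ≅ b ⊗ u ⟶ b ⊗ u ≅ b` defined by `z : u ⟶ u`. -/
def rightEnd (b : C) : End (𝟙_ C) →+* End b where
  toFun z := (ρ_ b).inv ≫ (b ◁ z) ≫ (ρ_ b).hom
  map_one' := by
    change (ρ_ b).inv ≫ (b ◁ 𝟙 (𝟙_ C)) ≫ (ρ_ b).hom = 𝟙 b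
    simp
  map_mul' z w := by
    change (ρ_ b).inv ≫ (b ◁ (w ≫ z : 𝟙_ C ⟶ 𝟙_ C)) ≫ (ρ_ b).hom =
      ((ρ_ b).inv ≫ (b ◁ w) ≫ (ρ_ b).hom) ≫ ((ρ_ b).inv ≫ (b ◁ z) ≫ (ρ_ b).hom)
    simp
  map_zero' := by
    change (ρ_ b).inv ≫ (b ◁ (0 : 𝟙_ C ⟶ 𝟙_ C)) ≫ (ρ_ b).hom = (0 : b ⟶ b)
    rw [MonoidalPreadditive.whiskerLeft_zero, zero_comp, comp_zero]
  map_add' z w := by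
    change (ρ_ b).inv ≫ (b ◁ (z + w : 𝟙_ C ⟶ 𝟙_ C)) ≫ (ρ_ b).hom =
      ((ρ_ b).inv ≫ (b ◁ z) ≫ (ρ_ b).hom + (ρ_ b).inv ≫ (b ◁ w) ≫ (ρ_ b).hom : b ⟶ b)
    rw [MonoidalPreadditive.whiskerLeft_add, Preadditive.add_comp, Preadditive.comp_add]

lemma leftEnd_naturality {b c : C} (f : b ⟶ c) (z : End (𝟙_ C)) :
    f ≫ leftEnd c z = leftEnd b z ≫ f := by
  change f ≫ (λ_ c).inv ≫ ((z : 𝟙_ C ⟶ 𝟙_ C) ▷ c) ≫ (λ_ c).hom =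
    ((λ_ b).inv ≫ ((z : 𝟙_ C ⟶ 𝟙_ C) ▷ b) ≫ (λ_ b).hom) ≫ f
  rw [leftUnitor_inv_naturality_assoc, whisker_exchange_assoc, leftUnitor_naturality,
    Category.assoc, Category.assoc]

lemma rightEnd_naturality {b c : C} (f : b ⟶ c) (z : End (𝟙_ C)) :
    f ≫ rightEnd c z = rightEnd b z ≫ f := by
  change f ≫ (ρ_ c).inv ≫ (c ◁ (z : 𝟙_ C ⟶ 𝟙_ C)) ≫ (ρ_ c).hom =
    ((ρ_ b).inv ≫ (b ◁ (z : 𝟙_ C ⟶ 𝟙_ C)) ≫ (ρ_ b).hom) ≫ f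
  rw [rightUnitor_inv_naturality_assoc, ← whisker_exchange_assoc, rightUnitor_naturality,
    Category.assoc, Category.assoc]

/-- The `End u`-`End u`-bimodule `Hom(g, b)`: the left and right actions of `z : u ⟶ u` are
composition with the endomorphisms of `b` induced by `z ⊗ b` and by `b ⊗ z`. -/
def homBimod (g b : C) : RBimod.{v} (End (𝟙_ C)) :=
  let _ : Module (End (𝟙_ C)) (g ⟶ b) :=
    { smul z f := f ≫ leftEnd b z
      one_smul f := by
        change f ≫ leftEnd b 1 = f
        rw [map_one]; exact Category.comp_id f
      mul_smul z w f := by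
        change f ≫ leftEnd b (z * w) = (f ≫ leftEnd b w) ≫ leftEnd b z
        rw [map_mul, Category.assoc]; rfl
      smul_zero z := zero_comp
      smul_add z f f' := Preadditive.add_comp _ _ _ _ _ _
      add_smul z w f := by
        change f ≫ leftEnd b (z + w) = f ≫ leftEnd b z + f ≫ leftEnd b w
        rw [map_add]; exact Preadditive.comp_add _ _ _ _ _ _
      zero_smul f := by
        change f ≫ leftEnd b 0 = 0
        rw [map_zero]; exact comp_zero }
  let _ : Module (End (𝟙_ C))ᵐᵒᵖ (g ⟶ b) :=
    { smul z f := f ≫ rightEnd b z.unop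
      one_smul f := by
        change f ≫ rightEnd b 1 = f
        rw [map_one]; exact Category.comp_id f
      mul_smul z w f := by
        change f ≫ rightEnd b (w.unop * z.unop) = (f ≫ rightEnd b w.unop) ≫ rightEnd b z.unop
        rw [mul_comm, map_mul, Category.assoc]; rfl
      smul_zero z := zero_comp
      smul_add z f f' := Preadditive.add_comp _ _ _ _ _ _
      add_smul z w f := by
        change f ≫ rightEnd b (z.unop + w.unop) = f ≫ rightEnd b z.unop + f ≫ rightEnd b w.unop
        rw [map_add]; exact Preadditive.comp_add _ _ _ _ _ _
      zero_smul f := by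
        change f ≫ rightEnd b 0 = 0
        rw [map_zero]; exact comp_zero }
  have : SMulCommClass (End (𝟙_ C)) (End (𝟙_ C))ᵐᵒᵖ (g ⟶ b) := ⟨fun z w f => by
    change (f ≫ rightEnd b w.unop) ≫ leftEnd b z = (f ≫ leftEnd b z) ≫ rightEnd b w.unop
    rw [Category.assoc, leftEnd_naturality (rightEnd b w.unop : b ⟶ b) z, Category.assoc]⟩
  { carrier := g ⟶ b }

/-- The hom-functor `Hom(g, -)` to `End u`-`End u`-bimodules. -/
def homFunctor (g : C) : C ⥤ RBimod.{v} (End (𝟙_ C)) where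
  obj b := homBimod g b
  map {b c} f := RBimod.mkHom (V := homBimod g b) (W := homBimod g c)
    (AddMonoidHom.mk' (fun x : g ⟶ b => x ≫ f) (fun x y => Preadditive.add_comp _ _ _ x y f))
    (fun z (x : g ⟶ b) => by
      change (x ≫ leftEnd b z) ≫ f = (x ≫ f) ≫ leftEnd c z
      rw [Category.assoc, Category.assoc, leftEnd_naturality])
    (fun z (x : g ⟶ b) => by
      change (x ≫ rightEnd b z) ≫ f = (x ≫ f) ≫ rightEnd c z
      rw [Category.assoc, Category.assoc, rightEnd_naturality])
  map_id b := RBimod.hom_ext fun (x : g ⟶ b) => Category.comp_id x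
  map_comp f f' := RBimod.hom_ext fun x =>
    (Category.assoc (show g ⟶ _ from x) f f').symm

end HomFunctor

/-! ## Bialgebroids with separable base realizing a monoidal category -/

/-- A bialgebroid over a separable base: a ring `A`, a `Z`-algebra `R`, a bialgebroid `B` over `R`
on the ring `A`, and a separability structure on the `Z`-algebra `R`. Here `Z` is the subring of
those elements of `R` which `s`, or equivalently `t`, maps into the center of `A`. -/
structure SepBialgebroid (Z A : Type v) [CommRing Z] [Ring A] where
  R : Type v
  [ring : Ring R]
  [algebra : Algebra Z R]
  B : Bialgebroid R A
  sep : SeparabilityStructure Z R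
  injective : Function.Injective (algebraMap Z R)
  s_central : ∀ r : R, B.s r ∈ Subring.center A ↔ r ∈ Set.range (algebraMap Z R)
  t_central : ∀ r : R, B.t (op r) ∈ Subring.center A ↔ r ∈ Set.range (algebraMap Z R)

attribute [instance] SepBialgebroid.ring SepBialgebroid.algebra

/-- For bialgebroids (or just rings with source and target maps) on the same ring `A`, and a ring
homomorphism `φ` of the base rings which is compatible with the source and target maps, the
map `V ⊗_R W → V ⊗_R' W`, `v ⊗ w ↦ v ⊗ w`. -/
def SourceTarget.changeBase {R R' A : Type v} [Ring R] [Ring R'] [Ring A] (σ : SourceTarget R A)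
    (τ : SourceTarget R' A) (φ : R → R') (hs : ∀ r, τ.s (φ r) = σ.s r)
    (ht : ∀ r, τ.t (op (φ r)) = σ.t (op r)) (V W : Type v) [AddCommGroup V] [Module Aᵐᵒᵖ V]
    [AddCommGroup W] [Module Aᵐᵒᵖ W] :
    (σ.bimod V ⊗ σ.bimod W : RBimod.{v} R) →+ (τ.bimod V ⊗ τ.bimod W : RBimod.{v} R') :=
  RBimod.lift (V := σ.bimod V) (W := σ.bimod W) (RBimod.tmulHom (τ.bimod V) (τ.bimod W))
    (fun v r w => by
      have h := RBimod.balanced (V := τ.bimod V) (W := τ.bimod W) v (φ r) w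
      have hr : (op (τ.s (φ r)) • (show V from v) : V) = op (σ.s r) • (show V from v) := by
        rw [hs]
      have hl : (op (τ.t (op (φ r))) • (show W from w) : W) =
          op (σ.t (op r)) • (show W from w) := by
        rw [ht]
      exact (congrArg (fun u : V => RBimod.tmul (V := τ.bimod V) (W := τ.bimod W) u w) hr.symm).trans
        (h.trans (congrArg
          (fun u : W => RBimod.tmul (V := τ.bimod V) (W := τ.bimod W) v u) hl)))

section Realization

variable {C : Type u} [Category.{v} C] [MonoidalCategory C] [Preadditive C]

/-- The functor `Hom(g, -)` to right modules over `A = End g`. -/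
def Bialgebroid.hom {g : C} {R : Type v} [Ring R] (B : Bialgebroid R (End g)) : C ⥤ B.RMod :=
  preadditiveCoyonedaObj g

variable [MonoidalPreadditive C]

/-- A bialgebroid structure with separable base on the ring `A = End g` inducing the monoidal
structure of the category: the functor `Hom(g, -)` to the monoidal category of right
`A`-modules is equipped with the structure `κ` of a strong monoidal functor. The ring over which
the base is separable is `Z = End u`; it acts on `Hom(g, b)` through `κ`, as it does in the
category. -/
structure Realization (g : C) extends SepBialgebroid (End (𝟙_ C)) (End g) where
  κ : B.hom.Monoidal
  compat_left : ∀ (b : C) (z : End (𝟙_ C)) (x : g ⟶ b),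
    (B.t (op (algebraMap _ R z)) : g ⟶ g) ≫ x = x ≫ leftEnd b z
  compat_right : ∀ (b : C) (z : End (𝟙_ C)) (x : g ⟶ b),
    (B.s (algebraMap _ R z) : g ⟶ g) ≫ x = x ≫ rightEnd b z

namespace Realization

variable {g : C} (P : Realization g)

attribute [instance] Realization.κ

open Functor.LaxMonoidal Functor.OplaxMonoidal

/-- The image in `Hom(g, a ⊗ b)` of `x ⊗ y` under `Hom(g, a) ⊗_R Hom(g, b) ≅ Hom(g, a ⊗ b)`. -/
def mul {a b : C} (x : g ⟶ a) (y : g ⟶ b) : g ⟶ a ⊗ b :=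
  P.B.asLin (μ P.B.hom a b) (P.B.tm' (V := P.B.hom.obj a) (W := P.B.hom.obj b) x y)

/-- The image of `r` under `R ≅ Hom(g, u)`. -/
def unit (r : P.R) : g ⟶ 𝟙_ C :=
  P.B.asLin (ε P.B.hom) r

/-- The forgetful functor from right `A`-modules to `Z`-`Z`-bimodules. -/
def forgetZ : P.B.RMod ⥤ RBimod.{v} (End (𝟙_ C)) :=
  P.B.forget ⋙ RBimod.resFunctor (End (𝟙_ C)) P.R

/-- Its monoidal structure is given by `V ⊗_Z W → V ⊗_R W` and `Z → R`. -/
instance : P.forgetZ.LaxMonoidal :=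
  inferInstanceAs (P.B.forget ⋙ RBimod.resFunctor (End (𝟙_ C)) P.R).LaxMonoidal

/-- Its comonoidal structure is given by the separability structure of `R`: by
`V ⊗_R W → V ⊗_Z W`, `v ⊗ w ↦ ∑ v · eᵢ ⊗ fᵢ · w`, and `ψ : R → Z`. -/
instance : P.forgetZ.OplaxMonoidal :=
  let _ := RBimod.resOplax P.sep
  inferInstanceAs (P.B.forget ⋙ RBimod.resFunctor (End (𝟙_ C)) P.R).OplaxMonoidal

/-- The composite `C ⥤ M_A ⥤ Z-Z-bimodules` is the hom-functor; the underlying maps are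
identities. -/
def compIso : P.B.hom ⋙ P.forgetZ ≅ homFunctor g :=
  NatIso.ofComponents
    (fun b => RBimod.mkIso (V := (P.B.hom ⋙ P.forgetZ).obj b) (W := (homFunctor g).obj b)
      (RBimod.mkHom (V := (P.B.hom ⋙ P.forgetZ).obj b) (W := (homFunctor g).obj b)
        (AddMonoidHom.id (g ⟶ b)) (fun z x => P.compat_left b z x)
        (fun z x => P.compat_right b z x))
      (RBimod.mkHom (V := (homFunctor g).obj b) (W := (P.B.hom ⋙ P.forgetZ).obj b)
        (AddMonoidHom.id (g ⟶ b)) (fun z x => (P.compat_left b z x).symm)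
        (fun z x => (P.compat_right b z x).symm))
      (fun _ => rfl) (fun _ => rfl))
    (fun _ => rfl)

end Realization

open Functor.LaxMonoidal Functor.OplaxMonoidal in
/-- A natural isomorphism `e : F ≅ G` respects the monoidal and comonoidal structures of `F` and
the split monoidal structure `S` of `G`. -/
structure SplitMonoidal.Respects {C : Type*} [Category C] [MonoidalCategory C] {D : Type*}
    [Category D] [MonoidalCategory D] {F G : C ⥤ D} [F.LaxMonoidal] [F.OplaxMonoidal]
    (S : SplitMonoidal G) (e : F ≅ G) : Prop where
  μ_comp : ∀ X Y : C, μ F X Y ≫ e.hom.app (X ⊗ Y) = (e.hom.app X ⊗ₘ e.hom.app Y) ≫ S.μ X Y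
  ε_comp : ε F ≫ e.hom.app (𝟙_ C) = S.ε
  comp_δ : ∀ X Y : C, e.hom.app (X ⊗ Y) ≫ S.δ X Y = δ F X Y ≫ (e.hom.app X ⊗ₘ e.hom.app Y)
  comp_η : e.hom.app (𝟙_ C) ≫ S.η = η F

namespace Realization

variable {g : C}

/-- `P` induces the split monoidal structure `S` on the hom-functor, which is thus transported
from the composite `C ⥤ M_A ⥤ Z-Z-bimodules`. -/
def Induces (P : Realization g) (S : SplitMonoidal (homFunctor g)) : Prop :=
  S.Respects P.compIso

/-- An isomorphism between realizations: an isomorphism of the base rings which, together with the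
identity of `A = End g` and of the category, respects all structure. -/
structure Iso (P Q : Realization g) where
  φ : P.R ≃ₐ[End (𝟙_ C)] Q.R
  map_s : ∀ r, Q.B.s (φ r) = P.B.s r
  map_t : ∀ r, Q.B.t (op (φ r)) = P.B.t (op r)
  map_γ : ∀ a : End g, P.B.changeBase Q.B.toSourceTarget φ map_s map_t (End g) (End g)
    (P.B.comul a) = Q.B.comul a
  map_π : ∀ a : End g, φ (P.B.counit a) = Q.B.counit a
  map_δ : ∀ r, TensorProduct.map φ.toLinearMap φ.toLinearMap (P.sep.comul r) = Q.sep.comul (φ r)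
  map_ψ : ∀ r, Q.sep.counit (φ r) = P.sep.counit r
  map_mul : ∀ (a b : C) (x : g ⟶ a) (y : g ⟶ b), Q.mul x y = P.mul x y
  map_unit : ∀ r, Q.unit (φ r) = P.unit r

end Realization

end Realization

end

/-! By Yoneda, a monoidal structure on Hom(g,-) is a comonoid structure on g: naturality gives μ(x ⊗
y) = Δ ≫ (x ⊗ y) with Δ = μ(1 ⊗ 1) for 1 the identity of g (`SplitMonoidal.mulElt_ztm`), and the
image of 1 under the unit map is the counit of g. Convolution x * y = Δ ≫ (x ⊗ y) then makes R =
Hom(g,u) a ring that acts on both sides of every Hom(g,b). The actions are natural in b, so they are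
precomposition with endomorphisms of g, and these endomorphisms are t(r) and s(r).

The two compatibilities between δ and μ force δ(x * y) = ∑ x·eᵢ ⊗ fᵢ·y, where ∑ eᵢ ⊗ fᵢ in R ⊗_Z R
is the value of δ at the unit (`SplitMonoidal.comulElt_convol`). This has two consequences. The
element ∑ eᵢ ⊗ fᵢ commutes with R, has product 1 because δ splits μ, and is counital: this is the
separability structure. Moreover, δ followed by the projection to ⊗_R inverts the product map
Hom(g,a) ⊗_R Hom(g,b) → Hom(g,a ⊗ b) (`SplitMonoidal.mulMap_bijective`). Hence Hom(g,-) is strong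
monoidal into R-R-bimodules and sends the comonoid g to a comonoid on A = End g, which is the
bialgebroid.

In the other direction, strong monoidal functors and restriction of scalars along a separable base
are separable Frobenius functors. This class is closed under composition and transport, so every
realization induces exactly one split structure (`Realization.existsUnique_induces`). A realization
can be recovered up to isomorphism from what it induces: R is Hom(g,u), the maps s and t are
products with the identity of g, γ and π come from Δ and the counit, and the separability element is
a value of δ (`Realization.nonempty_iso`).

For the equivalence, Hom(g,-) is fully faithful because every object is a retract of some gⁿ. Its
essential image is the class of retracts of Aⁿ because idempotents split, and this class is closed
under tensor products because Hom(g,-) is strong monoidal. -/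

noncomputable section

/-! ### Separable Frobenius functors: composition and transport. -/

section SeparableFrobenius

open Functor.LaxMonoidal Functor.OplaxMonoidal

variable {C D E : Type*} [Category C] [MonoidalCategory C] [Category D] [MonoidalCategory D]
  [Category E] [MonoidalCategory E]

/-- The comonoidal structure of `F` splits its monoidal structure and is compatible with it. -/
structure IsSeparableFrobenius (F : C ⥤ D) [F.LaxMonoidal] [F.OplaxMonoidal] : Prop where
  split : ∀ X Y : C, δ F X Y ≫ μ F X Y = 𝟙 _
  compat_left : ∀ X Y Z : C,
    (F.obj X ◁ δ F Y Z) ≫ (α_ _ _ _).inv ≫ (μ F X Y ▷ F.obj Z) =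
      μ F X (Y ⊗ Z) ≫ F.map (α_ X Y Z).inv ≫ δ F (X ⊗ Y) Z
  compat_right : ∀ X Y Z : C,
    (δ F X Y ▷ F.obj Z) ≫ (α_ _ _ _).hom ≫ (F.obj X ◁ μ F Y Z) =
      μ F (X ⊗ Y) Z ≫ F.map (α_ X Y Z).hom ≫ δ F X (Y ⊗ Z)

namespace IsSeparableFrobenius

/-- Since δ is the inverse of μ, cancelling an invertible whiskered μ turns each compatibility into
the associativity axiom. -/
lemma of_monoidal (F : C ⥤ D) [F.Monoidal] : IsSeparableFrobenius F where
  split X Y := by simp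
  compat_left X Y Z := by
    rw [← cancel_epi (F.obj X ◁ μ F Y Z), ← MonoidalCategory.whiskerLeft_comp_assoc,
      Functor.Monoidal.μ_δ, MonoidalCategory.whiskerLeft_id, Category.id_comp,
      Functor.LaxMonoidal.associativity_inv_assoc, Functor.Monoidal.μ_δ, Category.comp_id]
  compat_right X Y Z := by
    rw [← cancel_epi (μ F X Y ▷ F.obj Z), ← comp_whiskerRight_assoc,
      Functor.Monoidal.μ_δ, id_whiskerRight, Category.id_comp,
      Functor.LaxMonoidal.associativity_assoc, Functor.Monoidal.μ_δ, Category.comp_id]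

/-- Naturality of μ and δ of G separates the contribution of F, taken under G, from that of G; the
condition for each functor is then applied once. -/
lemma comp {F : C ⥤ D} {G : D ⥤ E} [F.LaxMonoidal] [F.OplaxMonoidal] [G.LaxMonoidal]
    [G.OplaxMonoidal] (hF : IsSeparableFrobenius F) (hG : IsSeparableFrobenius G) :
    IsSeparableFrobenius (F ⋙ G) where
  split X Y := by
    change (G.map (δ F X Y) ≫ δ G _ _) ≫ μ G _ _ ≫ G.map (μ F X Y) = 𝟙 _
    rw [Category.assoc, reassoc_of% hG.split, ← G.map_comp, hF.split, G.map_id]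
  compat_left X Y Z := by
    change (_ ◁ (G.map (δ F Y Z) ≫ δ G _ _)) ≫ (α_ _ _ _).inv ≫ ((μ G _ _ ≫ G.map (μ F X Y)) ▷ _) =
      (μ G _ _ ≫ G.map (μ F X (Y ⊗ Z))) ≫ G.map (F.map (α_ X Y Z).inv) ≫
        G.map (δ F (X ⊗ Y) Z) ≫ δ G _ _
    have h := hG.compat_left (F.obj X) (F.obj Y) (F.obj Z)
    simp only [Category.assoc]
    rw [← G.map_comp_assoc, ← G.map_comp_assoc, Category.assoc, ← hF.compat_left, G.map_comp,
      G.map_comp, Category.assoc, Category.assoc, ← δ_natural_left, ← μ_natural_right_assoc,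
      ← reassoc_of% h, MonoidalCategory.whiskerLeft_comp, comp_whiskerRight, Category.assoc]
  compat_right X Y Z := by
    change ((G.map (δ F X Y) ≫ δ G _ _) ▷ _) ≫ (α_ _ _ _).hom ≫ (_ ◁ (μ G _ _ ≫ G.map (μ F Y Z))) =
      (μ G _ _ ≫ G.map (μ F (X ⊗ Y) Z)) ≫ G.map (F.map (α_ X Y Z).hom) ≫
        G.map (δ F X (Y ⊗ Z)) ≫ δ G _ _
    have h := hG.compat_right (F.obj X) (F.obj Y) (F.obj Z)
    simp only [Category.assoc]
    rw [← G.map_comp_assoc, ← G.map_comp_assoc, Category.assoc, ← hF.compat_right, G.map_comp,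
      G.map_comp, Category.assoc, Category.assoc, ← δ_natural_right, ← μ_natural_left_assoc,
      ← reassoc_of% h, MonoidalCategory.whiskerLeft_comp, comp_whiskerRight, Category.assoc]

end IsSeparableFrobenius

namespace SplitMonoidal

lemma ext_of_eq {F : C ⥤ D} {S T : SplitMonoidal F} (hμ : ∀ X Y, S.μ X Y = T.μ X Y)
    (hε : S.ε = T.ε) (hδ : ∀ X Y, S.δ X Y = T.δ X Y) (hη : S.η = T.η) : S = T := by
  have h₁ : S.toLaxMonoidal = T.toLaxMonoidal :=
    Functor.LaxMonoidal.ext hε (funext fun X => funext fun Y => hμ X Y)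
  have h₂ : S.toOplaxMonoidal = T.toOplaxMonoidal :=
    Functor.OplaxMonoidal.ext hη (funext fun X => funext fun Y => hδ X Y)
  cases S; cases T; cases h₁; cases h₂; rfl

/-- The components of `e` and their tensor products are invertible, so each of the four equations
determines one structure map of the target. -/
lemma Respects.unique {F G : C ⥤ D} [F.LaxMonoidal] [F.OplaxMonoidal] {S T : SplitMonoidal G}
    {e : F ≅ G} (hS : S.Respects e) (hT : T.Respects e) : S = T := by
  refine ext_of_eq (fun X Y => ?_) ?_ (fun X Y => ?_) ?_
  · rw [← cancel_epi (e.hom.app X ⊗ₘ e.hom.app Y), ← hS.μ_comp, hT.μ_comp]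
  · rw [← hS.ε_comp, hT.ε_comp]
  · rw [← cancel_epi (e.hom.app (X ⊗ Y)), hS.comp_δ, hT.comp_δ]
  · rw [← cancel_epi (e.hom.app (𝟙_ C)), hS.comp_η, hT.comp_η]

section Transport

variable {F G : C ⥤ D} (e : F ≅ G)

/-- The transport of `μ` along a natural isomorphism. -/
def transportμ [F.LaxMonoidal] (X Y : C) : G.obj X ⊗ G.obj Y ⟶ G.obj (X ⊗ Y) :=
  (e.inv.app X ⊗ₘ e.inv.app Y) ≫ μ F X Y ≫ e.hom.app _

/-- The transport of `δ` along a natural isomorphism. -/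
def transportδ [F.OplaxMonoidal] (X Y : C) : G.obj (X ⊗ Y) ⟶ G.obj X ⊗ G.obj Y :=
  e.inv.app _ ≫ δ F X Y ≫ (e.hom.app X ⊗ₘ e.hom.app Y)

/-- This and the following intertwining identities carry `e` through a composite of structure maps;
the axioms of the transported structure are checked with them alone, without unfolding the
definitions. -/
lemma tensorHom_transportμ [F.LaxMonoidal] (X Y : C) :
    (e.hom.app X ⊗ₘ e.hom.app Y) ≫ transportμ e X Y = μ F X Y ≫ e.hom.app _ := by
  simp [transportμ]

lemma hom_transportδ [F.OplaxMonoidal] (X Y : C) :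
    e.hom.app _ ≫ transportδ e X Y = δ F X Y ≫ (e.hom.app X ⊗ₘ e.hom.app Y) := by
  simp [transportδ]

lemma tensorHom_transportμ_whiskerRight [F.LaxMonoidal] (X Y Z : C) :
    ((e.hom.app X ⊗ₘ e.hom.app Y) ⊗ₘ e.hom.app Z) ≫ (transportμ e X Y ▷ G.obj Z) =
      (μ F X Y ▷ F.obj Z) ≫ (e.hom.app (X ⊗ Y) ⊗ₘ e.hom.app Z) := by
  rw [← tensorHom_id, tensorHom_comp_tensorHom, tensorHom_transportμ, ← tensorHom_id,
    tensorHom_comp_tensorHom, Category.comp_id, Category.id_comp]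

lemma tensorHom_transportμ_whiskerLeft [F.LaxMonoidal] (X Y Z : C) :
    (e.hom.app X ⊗ₘ (e.hom.app Y ⊗ₘ e.hom.app Z)) ≫ (G.obj X ◁ transportμ e Y Z) =
      (F.obj X ◁ μ F Y Z) ≫ (e.hom.app X ⊗ₘ e.hom.app (Y ⊗ Z)) := by
  rw [← id_tensorHom, tensorHom_comp_tensorHom, tensorHom_transportμ, ← id_tensorHom,
    tensorHom_comp_tensorHom, Category.comp_id, Category.id_comp]

lemma tensorHom_transportδ_whiskerRight [F.OplaxMonoidal] (X Y Z : C) :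
    (e.hom.app (X ⊗ Y) ⊗ₘ e.hom.app Z) ≫ (transportδ e X Y ▷ G.obj Z) =
      (δ F X Y ▷ F.obj Z) ≫ ((e.hom.app X ⊗ₘ e.hom.app Y) ⊗ₘ e.hom.app Z) := by
  rw [← tensorHom_id, tensorHom_comp_tensorHom, hom_transportδ, ← tensorHom_id,
    tensorHom_comp_tensorHom, Category.comp_id, Category.id_comp]

lemma tensorHom_transportδ_whiskerLeft [F.OplaxMonoidal] (X Y Z : C) :
    (e.hom.app X ⊗ₘ e.hom.app (Y ⊗ Z)) ≫ (G.obj X ◁ transportδ e Y Z) =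
      (F.obj X ◁ δ F Y Z) ≫ (e.hom.app X ⊗ₘ (e.hom.app Y ⊗ₘ e.hom.app Z)) := by
  rw [← id_tensorHom, tensorHom_comp_tensorHom, hom_transportδ, ← id_tensorHom,
    tensorHom_comp_tensorHom, Category.comp_id, Category.id_comp]

lemma tensorHom_map_whiskerRight {B : Type*} [Category B] {F G : B ⥤ D} (e : F ≅ G)
    {X X' : B} (f : X ⟶ X') (Y : B) :
    (e.hom.app X ⊗ₘ e.hom.app Y) ≫ (G.map f ▷ G.obj Y) =
      (F.map f ▷ F.obj Y) ≫ (e.hom.app X' ⊗ₘ e.hom.app Y) := by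
  rw [← tensorHom_id, tensorHom_comp_tensorHom, ← e.hom.naturality, ← tensorHom_id,
    tensorHom_comp_tensorHom, Category.comp_id, Category.id_comp]

lemma tensorHom_map_whiskerLeft {B : Type*} [Category B] {F G : B ⥤ D} (e : F ≅ G)
    (X : B) {Y Y' : B} (f : Y ⟶ Y') :
    (e.hom.app X ⊗ₘ e.hom.app Y) ≫ (G.obj X ◁ G.map f) =
      (F.obj X ◁ F.map f) ≫ (e.hom.app X ⊗ₘ e.hom.app Y') := by
  rw [← id_tensorHom, tensorHom_comp_tensorHom, ← e.hom.naturality, ← id_tensorHom,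
    tensorHom_comp_tensorHom, Category.comp_id, Category.id_comp]

/-- Transport of a separable Frobenius structure along a natural isomorphism. -/
def transport [F.LaxMonoidal] [F.OplaxMonoidal] (hF : IsSeparableFrobenius F) :
    SplitMonoidal G where
  ε := ε F ≫ e.hom.app _
  μ := transportμ e
  μ_natural_left {X X'} f Y := by
    -- All axioms of the transported structure follow this pattern: precompose with an invertible
    -- map built from `e`, push it to the other end, and use the axiom for `F`.
    rw [← cancel_epi (e.hom.app X ⊗ₘ e.hom.app Y),
      reassoc_of% tensorHom_map_whiskerRight e f Y, tensorHom_transportμ,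
      reassoc_of% tensorHom_transportμ e X Y, ← e.hom.naturality, μ_natural_left_assoc]
  μ_natural_right {Y Y'} X f := by
    rw [← cancel_epi (e.hom.app X ⊗ₘ e.hom.app Y),
      reassoc_of% tensorHom_map_whiskerLeft e X f, tensorHom_transportμ,
      reassoc_of% tensorHom_transportμ e X Y, ← e.hom.naturality, μ_natural_right_assoc]
  associativity X Y Z := by
    rw [← cancel_epi ((e.hom.app X ⊗ₘ e.hom.app Y) ⊗ₘ e.hom.app Z),
      reassoc_of% tensorHom_transportμ_whiskerRight e X Y Z,
      reassoc_of% tensorHom_transportμ e (X ⊗ Y) Z, ← e.hom.naturality,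
      associator_naturality_assoc, reassoc_of% tensorHom_transportμ_whiskerLeft e X Y Z,
      tensorHom_transportμ, Functor.LaxMonoidal.associativity_assoc]
  left_unitality X := by
    have h : (𝟙_ D ◁ e.hom.app X) ≫ ((ε F ≫ e.hom.app _) ▷ G.obj X) =
        (ε F ▷ F.obj X) ≫ (e.hom.app _ ⊗ₘ e.hom.app X) := by
      simp only [← tensorHom_id, ← id_tensorHom, tensorHom_comp_tensorHom, Category.id_comp,
        Category.comp_id]
    rw [← cancel_epi (𝟙_ D ◁ e.hom.app X), leftUnitor_naturality, reassoc_of% h,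
      Functor.LaxMonoidal.left_unitality, reassoc_of% tensorHom_transportμ e (𝟙_ C) X,
      Category.assoc, Category.assoc, e.hom.naturality]
  right_unitality X := by
    have h : (e.hom.app X ▷ 𝟙_ D) ≫ (G.obj X ◁ (ε F ≫ e.hom.app _)) =
        (F.obj X ◁ ε F) ≫ (e.hom.app X ⊗ₘ e.hom.app _) := by
      simp only [← tensorHom_id, ← id_tensorHom, tensorHom_comp_tensorHom, Category.id_comp,
        Category.comp_id]
    rw [← cancel_epi (e.hom.app X ▷ 𝟙_ D), rightUnitor_naturality, reassoc_of% h,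
      Functor.LaxMonoidal.right_unitality, reassoc_of% tensorHom_transportμ e X (𝟙_ C),
      Category.assoc, Category.assoc, e.hom.naturality]
  η := e.inv.app _ ≫ η F
  δ := transportδ e
  δ_natural_left {X X'} f Y := by
    rw [← cancel_epi (e.hom.app (X ⊗ Y)), reassoc_of% hom_transportδ e X Y,
      tensorHom_map_whiskerRight, δ_natural_left_assoc, ← e.hom.naturality_assoc, hom_transportδ]
  δ_natural_right {Y Y'} X f := by
    rw [← cancel_epi (e.hom.app (X ⊗ Y)), reassoc_of% hom_transportδ e X Y,
      tensorHom_map_whiskerLeft, δ_natural_right_assoc, ← e.hom.naturality_assoc, hom_transportδ]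
  oplax_associativity X Y Z := by
    rw [← cancel_epi (e.hom.app ((X ⊗ Y) ⊗ Z)), reassoc_of% hom_transportδ e (X ⊗ Y) Z,
      reassoc_of% tensorHom_transportδ_whiskerRight e X Y Z, associator_naturality,
      ← e.hom.naturality_assoc, reassoc_of% hom_transportδ e X (Y ⊗ Z),
      tensorHom_transportδ_whiskerLeft, Functor.OplaxMonoidal.associativity_assoc]
  oplax_left_unitality X := by
    have h : (e.hom.app _ ⊗ₘ e.hom.app X) ≫ ((e.inv.app _ ≫ η F) ▷ G.obj X) =
        (η F ▷ F.obj X) ≫ (𝟙_ D ◁ e.hom.app X) := by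
      simp only [← tensorHom_id, ← id_tensorHom, tensorHom_comp_tensorHom, Category.id_comp,
        Category.comp_id, Iso.hom_inv_id_app_assoc]
    rw [← cancel_epi (e.hom.app X), ← e.hom.naturality_assoc,
      reassoc_of% hom_transportδ e (𝟙_ C) X, h, leftUnitor_inv_naturality,
      Functor.OplaxMonoidal.left_unitality, Category.assoc, Category.assoc]
  oplax_right_unitality X := by
    have h : (e.hom.app X ⊗ₘ e.hom.app _) ≫ (G.obj X ◁ (e.inv.app _ ≫ η F)) =
        (F.obj X ◁ η F) ≫ (e.hom.app X ▷ 𝟙_ D) := by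
      simp only [← tensorHom_id, ← id_tensorHom, tensorHom_comp_tensorHom, Category.id_comp,
        Category.comp_id, Iso.hom_inv_id_app_assoc]
    rw [← cancel_epi (e.hom.app X), ← e.hom.naturality_assoc,
      reassoc_of% hom_transportδ e X (𝟙_ C), h, rightUnitor_inv_naturality,
      Functor.OplaxMonoidal.right_unitality, Category.assoc, Category.assoc]
  split X Y := by
    rw [← cancel_epi (e.hom.app (X ⊗ Y)), reassoc_of% hom_transportδ e X Y, tensorHom_transportμ,
      reassoc_of% hF.split, Category.comp_id]
  compat_left X Y Z := by
    rw [← cancel_epi (e.hom.app X ⊗ₘ e.hom.app (Y ⊗ Z)),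
      reassoc_of% tensorHom_transportδ_whiskerLeft e X Y Z, associator_inv_naturality_assoc,
      tensorHom_transportμ_whiskerRight, reassoc_of% tensorHom_transportμ e X (Y ⊗ Z),
      ← e.hom.naturality_assoc, hom_transportδ, reassoc_of% hF.compat_left X Y Z]
  compat_right X Y Z := by
    rw [← cancel_epi (e.hom.app (X ⊗ Y) ⊗ₘ e.hom.app Z),
      reassoc_of% tensorHom_transportδ_whiskerRight e X Y Z, associator_naturality_assoc,
      tensorHom_transportμ_whiskerLeft, reassoc_of% tensorHom_transportμ e (X ⊗ Y) Z,
      ← e.hom.naturality_assoc, hom_transportδ, reassoc_of% hF.compat_right X Y Z]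

lemma respects_transport [F.LaxMonoidal] [F.OplaxMonoidal] (hF : IsSeparableFrobenius F) :
    (transport e hF).Respects e where
  μ_comp X Y := (tensorHom_transportμ e X Y).symm
  ε_comp := rfl
  comp_δ X Y := hom_transportδ e X Y
  comp_η := e.hom_inv_id_app_assoc _ _

end Transport

/-- Whiskering a monoidal isomorphism of strong monoidal functors and composing with an isomorphism
respecting the structures gives an isomorphism respecting the structures. -/
lemma Respects.whiskerRight_trans {F F' : C ⥤ D} [F.Monoidal] [F'.Monoidal] {H : D ⥤ E}
    [H.LaxMonoidal] [H.OplaxMonoidal] {G : C ⥤ E} {S : SplitMonoidal G} (i : F ≅ F')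
    [NatTrans.IsMonoidal i.hom] {e : F' ⋙ H ≅ G} (he : S.Respects e) :
    S.Respects (F := F ⋙ H) (Functor.isoWhiskerRight i H ≪≫ e) where
  μ_comp X Y := by
    change (μ H _ _ ≫ H.map (μ F X Y)) ≫ H.map (i.hom.app _) ≫ e.hom.app _ =
      ((H.map (i.hom.app X) ≫ e.hom.app X) ⊗ₘ (H.map (i.hom.app Y) ≫ e.hom.app Y)) ≫ S.μ X Y
    have h : (μ H _ _ ≫ H.map (μ F' X Y)) ≫ e.hom.app _ =
      (e.hom.app X ⊗ₘ e.hom.app Y) ≫ S.μ X Y := he.μ_comp X Y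
    rw [← tensorHom_comp_tensorHom, Category.assoc, Category.assoc, ← h, Category.assoc,
      μ_natural_assoc, ← H.map_comp_assoc, ← H.map_comp_assoc, NatTrans.IsMonoidal.tensor]
  ε_comp := by
    change (ε H ≫ H.map (ε F)) ≫ H.map (i.hom.app _) ≫ e.hom.app _ = S.ε
    have h : (ε H ≫ H.map (ε F')) ≫ e.hom.app _ = S.ε := he.ε_comp
    rw [← h, Category.assoc, Category.assoc, ← H.map_comp_assoc, NatTrans.IsMonoidal.unit]
  comp_δ X Y := by
    change (H.map (i.hom.app _) ≫ e.hom.app _) ≫ S.δ X Y = (H.map (δ F X Y) ≫ δ H _ _) ≫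
      ((H.map (i.hom.app X) ≫ e.hom.app X) ⊗ₘ (H.map (i.hom.app Y) ≫ e.hom.app Y))
    have h : e.hom.app _ ≫ S.δ X Y = (H.map (δ F' X Y) ≫ δ H _ _) ≫
      (e.hom.app X ⊗ₘ e.hom.app Y) := he.comp_δ X Y
    -- A monoidal transformation is only required to respect μ; between strong monoidal functors it
    -- respects δ as well, because δ is inverse to μ.
    have h' : i.hom.app _ ≫ δ F' X Y = δ F X Y ≫ (i.hom.app X ⊗ₘ i.hom.app Y) := by
      rw [← cancel_epi (μ F X Y), NatTrans.IsMonoidal.tensor_assoc, Functor.Monoidal.μ_δ,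
        Functor.Monoidal.μ_δ_assoc, Category.comp_id]
    rw [Category.assoc, h, ← tensorHom_comp_tensorHom, Category.assoc, Category.assoc,
      δ_natural_assoc, ← H.map_comp_assoc, ← H.map_comp_assoc, h']
  comp_η := by
    change (H.map (i.hom.app _) ≫ e.hom.app _) ≫ S.η = H.map (η F) ≫ η H
    have h : e.hom.app _ ≫ S.η = H.map (η F') ≫ η H := he.comp_η
    have h' : i.hom.app _ ≫ η F' = η F := by
      rw [← cancel_epi (ε F), NatTrans.IsMonoidal.unit_assoc, Functor.Monoidal.ε_η,
        Functor.Monoidal.ε_η]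
    rw [Category.assoc, h, ← H.map_comp_assoc, h']

end SplitMonoidal

end SeparableFrobenius

/-! ### Restriction of scalars along a separable base is separable Frobenius. -/

namespace RBimod

variable {Z R : Type v} [CommRing Z] [Ring R] [Algebra Z R]

/-- Over R, the first leg of `x` can be moved across the tensor sign, so only the product of the
legs survives. For δ(1) this product is 1, which is why the splitting is a section of the
projection. -/
lemma canon_expand {V W : RBimod.{v} R} (v : V) (w : W) (x : R ⊗[Z] R) :
    homOf (canon Z V W) (expand Z v w x) = tmul v (LinearMap.mul' Z R x • w) :=
  addHom_ext₂ Z (f := (homOf (canon Z V W)).comp (expand Z v w))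
    (g := ((tmulHom V W v).comp (AddMonoidHom.mk' (fun r : R => r • w)
      (fun r s => add_smul r s _))).comp (LinearMap.mul' Z R).toAddMonoidHom)
    (fun a b => by
      change tmul (op a • v) (b • w) = tmul v ((a * b) • w)
      rw [balanced, mul_smul]) x

/-- On pure tensors both sides are ∑ (u ⊗ v·eᵢ) ⊗ fᵢ·w, because the right action of R on U ⊗_R V is
the one on V. The mirror image below uses the left action on V ⊗_R W. -/
lemma splitting_compat_left (S : SeparabilityStructure Z R) (U V W : RBimod.{v} R) :
    tensorMap (𝟙 (res Z U)) (splitting S V W) ≫ assocInv (res Z U) (res Z V) (res Z W) ≫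
      tensorMap (canon Z U V) (𝟙 (res Z W)) =
    canon Z U (tensor V W) ≫ resMap Z (assocInv U V W) ≫ splitting S (tensor U V) W := by
  refine tensor_hom_ext (V := res Z U) (W := res Z (tensor V W)) fun u y => ?_
  refine tens_hom_ext (V := V) (W := W)
    (f := (homOf (tensorMap (𝟙 (res Z U)) (splitting S V W) ≫
      assocInv (res Z U) (res Z V) (res Z W) ≫ tensorMap (canon Z U V) (𝟙 (res Z W)))).comp
        (tmulHom (res Z U) (res Z (tensor V W)) u))
    (g := (homOf (canon Z U (tensor V W) ≫ resMap Z (assocInv U V W) ≫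
      splitting S (tensor U V) W)).comp (tmulHom (res Z U) (res Z (tensor V W)) u))
    (fun v w => ?_) y
  exact addHom_ext₂ Z
    (f := (homOf ((assocInv (res Z U) (res Z V) (res Z W)) ≫
      tensorMap (canon Z U V) (𝟙 (res Z W)))).comp
        ((tmulHom (res Z U) (tensor (res Z V) (res Z W)) u).comp (expand Z v w)))
    (g := expand Z (V := tensor U V) (tmul u v) w)
    (fun a b => congrArg (fun z => rtm (V := tensor U V) (W := W) z (b • w))
      (op_smul_tmul a u v).symm) S.idem

lemma splitting_compat_right (S : SeparabilityStructure Z R) (U V W : RBimod.{v} R) :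
    tensorMap (splitting S U V) (𝟙 (res Z W)) ≫ assocHom (res Z U) (res Z V) (res Z W) ≫
      tensorMap (𝟙 (res Z U)) (canon Z V W) =
    canon Z (tensor U V) W ≫ resMap Z (assocHom U V W) ≫ splitting S U (tensor V W) := by
  refine tensor_hom_ext (V := res Z (tensor U V)) (W := res Z W) fun y w => ?_
  refine tens_hom_ext (V := U) (W := V)
    (f := (homOf (tensorMap (splitting S U V) (𝟙 (res Z W)) ≫
      assocHom (res Z U) (res Z V) (res Z W) ≫ tensorMap (𝟙 (res Z U)) (canon Z V W))).comp
        ((tmulHom (res Z (tensor U V)) (res Z W)).flip w))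
    (g := (homOf (canon Z (tensor U V) W ≫ resMap Z (assocHom U V W) ≫
      splitting S U (tensor V W))).comp ((tmulHom (res Z (tensor U V)) (res Z W)).flip w))
    (fun u v => ?_) y
  exact addHom_ext₂ Z
    (f := (homOf ((assocHom (res Z U) (res Z V) (res Z W)) ≫
      tensorMap (𝟙 (res Z U)) (canon Z V W))).comp
        (((tmulHom (tensor (res Z U) (res Z V)) (res Z W)).flip w).comp (expand Z u v)))
    (g := expand Z (W := tensor V W) u (tmul v w))
    (fun a b => congrArg (fun z => rtm (V := U) (W := tensor V W) (op a • u) z)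
      (smul_tmul b v w).symm) S.idem

/-- For a separability structure on `R`, restriction of scalars is a separable Frobenius functor. -/
lemma isSeparableFrobenius_resFunctor (S : SeparabilityStructure Z R) :
    let _ := resOplax S
    IsSeparableFrobenius (resFunctor Z R) := by
  let _ := resOplax S
  refine ⟨fun V W => ?_, splitting_compat_left S, splitting_compat_right S⟩
  refine tensor_hom_ext₂ fun v w => ?_
  change homOf (canon Z V W) (expand Z v w S.idem) = tmul v w
  rw [canon_expand]
  -- The axiom m ∘ δ = id evaluated at 1.
  have h : LinearMap.mul' Z R S.idem = 1 := LinearMap.congr_fun S.separable 1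
  rw [h, one_smul]

end RBimod

lemma Bialgebroid.asLin_asLin {R A : Type v} [Ring R] [Ring A] (B : Bialgebroid R A) {V W : B.RMod}
    {f : V ⟶ W} {h : W ⟶ V} (e : f ≫ h = 𝟙 V) (x : B.asModule V) : B.asLin h (B.asLin f x) = x :=
  congrArg (fun k : V ⟶ V => B.asLin k x) e

/-! ### The split monoidal structure induced by a realization. -/

namespace Realization

open Functor.LaxMonoidal Functor.OplaxMonoidal

variable {C : Type u} [Category.{v} C] [MonoidalCategory C] [Preadditive C]
  [MonoidalPreadditive C] {g : C}

/-- The functor is a composite of two strong monoidal functors, to right modules and to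
R-R-bimodules, with restriction of scalars to Z. -/
lemma isSeparableFrobenius (P : Realization g) : IsSeparableFrobenius (P.B.hom ⋙ P.forgetZ) :=
  let _ := RBimod.resOplax P.sep
  (IsSeparableFrobenius.of_monoidal P.B.hom).comp
    ((IsSeparableFrobenius.of_monoidal P.B.forget).comp
      (RBimod.isSeparableFrobenius_resFunctor P.sep))

lemma existsUnique_induces (P : Realization g) : ∃! S, P.Induces S :=
  ⟨SplitMonoidal.transport P.compIso P.isSeparableFrobenius,
    SplitMonoidal.respects_transport P.compIso P.isSeparableFrobenius,
    fun _ h => h.unique (SplitMonoidal.respects_transport P.compIso P.isSeparableFrobenius)⟩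

/-- The element `x ⊗ y` of `Hom(g, a) ⊗_Z Hom(g, b)`. -/
def ztm (a b : C) (x : g ⟶ a) (y : g ⟶ b) :
    ((homFunctor g).obj a ⊗ (homFunctor g).obj b : RBimod.{v} (End (𝟙_ C))) :=
  RBimod.tmul (V := homBimod g a) (W := homBimod g b) x y

/-- For `x : g ⟶ a` and `y : g ⟶ b`, the map `e ⊗ f ↦ x · e ⊗ f · y`. -/
def insert (P : Realization g) {a b : C} (x : g ⟶ a) (y : g ⟶ b) :
    P.R ⊗[End (𝟙_ C)] P.R →+ ((homFunctor g).obj a ⊗ (homFunctor g).obj b :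
      RBimod.{v} (End (𝟙_ C))) :=
  (RBimod.homOf (P.compIso.hom.app a ⊗ₘ P.compIso.hom.app b)).comp
    (RBimod.expand (End (𝟙_ C)) (V := P.B.bimod (g ⟶ a)) (W := P.B.bimod (g ⟶ b)) x y)

lemma insert_tmul (P : Realization g) {a b : C} (x : g ⟶ a) (y : g ⟶ b) (e f : P.R) :
    P.insert x y (e ⊗ₜ f) = ztm a b ((P.B.s e : g ⟶ g) ≫ x) ((P.B.t (op f) : g ⟶ g) ≫ y) := rfl

/-- The canonical isomorphism `Hom(g, a) ⊗_R Hom(g, b) ≅ Hom(g, a ⊗ b)`. -/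
def mulEquiv (P : Realization g) (a b : C) :
    (P.B.bimod (g ⟶ a) ⊗ P.B.bimod (g ⟶ b) : RBimod.{v} P.R) ≃+ (g ⟶ a ⊗ b) where
  toFun := P.B.asLin (μ P.B.hom a b)
  invFun := P.B.asLin (δ P.B.hom a b)
  left_inv x := P.B.asLin_asLin (Functor.Monoidal.μ_δ P.B.hom a b) x
  right_inv x := P.B.asLin_asLin (Functor.Monoidal.δ_μ P.B.hom a b) x
  map_add' := map_add (P.B.asLin (μ P.B.hom a b))

/-- The canonical isomorphism `R ≅ Hom(g, u)`. -/
def unitEquiv (P : Realization g) : P.R ≃+ (g ⟶ 𝟙_ C) where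
  toFun := P.unit
  invFun := P.B.asLin (η P.B.hom)
  left_inv x := P.B.asLin_asLin (Functor.Monoidal.ε_η P.B.hom) x
  right_inv x := P.B.asLin_asLin (Functor.Monoidal.η_ε P.B.hom) x
  map_add' := map_add (P.B.asLin (ε P.B.hom))

lemma mulEquiv_tmul (P : Realization g) {a b : C} (x : g ⟶ a) (y : g ⟶ b) :
    P.mulEquiv a b (RBimod.tmul (V := P.B.bimod (g ⟶ a)) (W := P.B.bimod (g ⟶ b)) x y) =
      P.mul x y := rfl

/-- Additive maps on `Hom(g, a ⊗ b)` agree if they agree on products. -/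
lemma addHom_ext_mul (P : Realization g) {a b : C} {M : Type v} [AddCommGroup M]
    {φ ψ : (g ⟶ a ⊗ b) →+ M} (h : ∀ x y, φ (P.mul x y) = ψ (P.mul x y)) (f : g ⟶ a ⊗ b) :
    φ f = ψ f := by
  obtain ⟨z, rfl⟩ := (P.mulEquiv a b).surjective f
  exact RBimod.tens_hom_ext (V := P.B.bimod (g ⟶ a)) (W := P.B.bimod (g ⟶ b))
    (f := φ.comp (P.mulEquiv a b).toAddMonoidHom) (g := ψ.comp (P.mulEquiv a b).toAddMonoidHom)
    (fun x y => h x y) z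

/-- The comonoidal map of the composite first applies the inverse of κ, which turns the product of x
and y back into x ⊗ y, and then inserts the separability element. -/
lemma comp_δ_apply (P : Realization g) {a b : C} (x : g ⟶ a) (y : g ⟶ b) :
    RBimod.homOf (δ (P.B.hom ⋙ P.forgetZ) a b ≫ (P.compIso.hom.app a ⊗ₘ P.compIso.hom.app b))
      (P.mul x y) = P.insert x y P.sep.idem := by
  have h : δ (P.B.hom ⋙ P.forgetZ) a b = P.forgetZ.map (δ P.B.hom a b) ≫ δ P.forgetZ _ _ := rfl
  rw [h]
  have h' : P.B.asLin (δ P.B.hom a b) (P.mul x y) =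
      P.B.tm' (V := P.B.hom.obj a) (W := P.B.hom.obj b) x y :=
    (P.mulEquiv a b).left_inv (RBimod.tmul (V := P.B.bimod (g ⟶ a)) (W := P.B.bimod (g ⟶ b)) x y)
  refine (congrArg (fun z => RBimod.homOf (δ P.forgetZ (P.B.hom.obj a) (P.B.hom.obj b) ≫
    (P.compIso.hom.app a ⊗ₘ P.compIso.hom.app b)) z) h').trans ?_
  rfl

/-- Since κ is strong, products generate Hom(g, a ⊗ b) additively and every element of Hom(g,u) has
the form `P.unit r`, so δ and η need only be tested there. Uniqueness and existence of realizations
both use this elementwise form. -/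
lemma induces_iff (P : Realization g) (S : SplitMonoidal (homFunctor g)) :
    P.Induces S ↔
      (∀ (a b : C) (x : g ⟶ a) (y : g ⟶ b), RBimod.homOf (S.μ a b) (ztm a b x y) = P.mul x y) ∧
      (∀ z : End (𝟙_ C), RBimod.homOf S.ε z = P.unit (algebraMap _ _ z)) ∧
      (∀ (a b : C) (x : g ⟶ a) (y : g ⟶ b),
        RBimod.homOf (S.δ a b) (P.mul x y) = P.insert x y P.sep.idem) ∧
      (∀ r, RBimod.homOf S.η (P.unit r) = P.sep.counit r) := by
  constructor
  · intro h
    refine ⟨fun a b x y => ?_, fun z => ?_, fun a b x y => ?_, fun r => ?_⟩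
    · exact (congrArg (fun f => RBimod.homOf f (RBimod.tmul
        (V := (P.B.hom ⋙ P.forgetZ).obj a) (W := (P.B.hom ⋙ P.forgetZ).obj b) x y))
        (h.μ_comp a b)).symm
    · exact (congrArg (fun f => RBimod.homOf f z) h.ε_comp).symm
    · exact (congrArg (fun f => RBimod.homOf f (P.mul x y)) (h.comp_δ a b)).trans
        (P.comp_δ_apply x y)
    · refine (congrArg (fun f => RBimod.homOf f (P.unit r)) h.comp_η).trans ?_
      exact congrArg P.sep.counit (P.unitEquiv.left_inv r)
  · rintro ⟨h1, h2, h3, h4⟩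
    refine ⟨fun a b => ?_, ?_, fun a b => ?_, ?_⟩
    · exact RBimod.tensor_hom_ext (V := (P.B.hom ⋙ P.forgetZ).obj a)
        (W := (P.B.hom ⋙ P.forgetZ).obj b) fun x y => (h1 a b x y).symm
    · exact RBimod.hom_ext fun z => (h2 z).symm
    · refine RBimod.hom_ext fun f => P.addHom_ext_mul
        (φ := RBimod.homOf (P.compIso.hom.app (a ⊗ b) ≫ S.δ a b))
        (ψ := RBimod.homOf (δ (P.B.hom ⋙ P.forgetZ) a b ≫
          (P.compIso.hom.app a ⊗ₘ P.compIso.hom.app b))) (fun x y => ?_) f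
      exact (h3 a b x y).trans (P.comp_δ_apply x y).symm
    · refine RBimod.hom_ext fun f => ?_
      obtain ⟨r, rfl⟩ := P.unitEquiv.surjective f
      exact (h4 r).trans (congrArg P.sep.counit (P.unitEquiv.left_inv r)).symm

end Realization

/-! ### A realization is determined up to unique isomorphism by what it induces. -/

namespace Realization

open Functor.LaxMonoidal Functor.OplaxMonoidal

variable {C : Type u} [Category.{v} C] [MonoidalCategory C] [Preadditive C]
  [MonoidalPreadditive C] {g : C}

section

variable (P : Realization g)

/-- The unit axiom of κ on pure tensors: the unit constraint of right modules sends v ⊗ r to v·s(r),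
and A acts on Hom(g,a) by precomposition. For `unit_mul`, s is replaced by t. -/
lemma mul_unit {a : C} (x : g ⟶ a) (r : P.R) :
    P.mul x (P.unit r) ≫ (ρ_ a).hom = (P.B.s r : g ⟶ g) ≫ x :=
  (congrArg (fun k => P.B.asLin k (P.B.tm' (V := P.B.hom.obj a) (W := P.B.unitObj) x r))
    (Functor.LaxMonoidal.right_unitality P.B.hom a)).symm

lemma unit_mul {a : C} (x : g ⟶ a) (r : P.R) :
    P.mul (P.unit r) x ≫ (λ_ a).hom = (P.B.t (op r) : g ⟶ g) ≫ x :=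
  (congrArg (fun k => P.B.asLin k (P.B.tm' (V := P.B.unitObj) (W := P.B.hom.obj a) r x))
    (Functor.LaxMonoidal.left_unitality P.B.hom a)).symm

/-- This is the A-linearity of κ: the action of c is precomposition on Hom(g, a ⊗ b) and goes
through γ(c) on the tensor product. -/
lemma comp_mulEquiv {a b : C} (c : g ⟶ g)
    (z : (P.B.bimod (g ⟶ a) ⊗ P.B.bimod (g ⟶ b) : RBimod.{v} P.R)) :
    c ≫ P.mulEquiv a b z = P.mulEquiv a b (P.B.actHom (g ⟶ a) (g ⟶ b) c z) :=
  ((P.B.asLin (μ P.B.hom a b)).map_smul (op (show End g from c)) z).symm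

lemma comp_unit (c : g ⟶ g) (r : P.R) : c ≫ P.unit r = P.unit (P.B.unitAct c r) :=
  ((P.B.asLin (ε P.B.hom)).map_smul (op (show End g from c)) r).symm

lemma s_comp_unit (e r : P.R) : (P.B.s e : g ⟶ g) ≫ P.unit r = P.unit (r * e) := by
  rw [comp_unit]; exact congrArg P.unit (P.B.unitAct_s e r).symm

lemma t_comp_unit (e r : P.R) : (P.B.t (op e) : g ⟶ g) ≫ P.unit r = P.unit (e * r) := by
  rw [comp_unit]; exact congrArg P.unit (P.B.unitAct_t e r).symm

lemma unit_injective : Function.Injective P.unit := P.unitEquiv.injective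

lemma unit_comp_leftEnd (z : End (𝟙_ C)) (r : P.R) :
    P.unit r ≫ leftEnd (𝟙_ C) z = P.unit (algebraMap _ P.R z * r) := by
  rw [← P.compat_left, t_comp_unit]

lemma unit_comp_rightEnd (z : End (𝟙_ C)) (r : P.R) :
    P.unit r ≫ rightEnd (𝟙_ C) z = P.unit (r * algebraMap _ P.R z) := by
  rw [← P.compat_right, s_comp_unit]

/-- The map `Hom(g, u) ⊗_Z Hom(g, u) → R ⊗_Z R` defined by `Hom(g, u) ≅ R`. -/
def toTensor : ((homFunctor g).obj (𝟙_ C) ⊗ (homFunctor g).obj (𝟙_ C) :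
    RBimod.{v} (End (𝟙_ C))) →+ P.R ⊗[End (𝟙_ C)] P.R :=
  RBimod.lift (V := homBimod g (𝟙_ C)) (W := homBimod g (𝟙_ C))
    (AddMonoidHom.mk' (fun x : g ⟶ 𝟙_ C => AddMonoidHom.mk'
      (fun y : g ⟶ 𝟙_ C => P.unitEquiv.symm x ⊗ₜ[End (𝟙_ C)] P.unitEquiv.symm y)
      (fun y y' => (congrArg (P.unitEquiv.symm x ⊗ₜ[End (𝟙_ C)] ·)
        (map_add P.unitEquiv.symm (show g ⟶ 𝟙_ C from y) y')).trans (TensorProduct.tmul_add _ _ _)))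
      (fun x x' => AddMonoidHom.ext fun y => (congrArg (· ⊗ₜ[End (𝟙_ C)] P.unitEquiv.symm y)
        (map_add P.unitEquiv.symm (show g ⟶ 𝟙_ C from x) x')).trans (TensorProduct.add_tmul _ _ _)))
    (fun x z y => by
      obtain ⟨r, rfl⟩ := P.unitEquiv.surjective x
      obtain ⟨r', rfl⟩ := P.unitEquiv.surjective y
      change P.unitEquiv.symm (P.unit r ≫ rightEnd (𝟙_ C) z) ⊗ₜ[End (𝟙_ C)]
        P.unitEquiv.symm (P.unitEquiv r') = P.unitEquiv.symm (P.unitEquiv r) ⊗ₜ[End (𝟙_ C)]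
          P.unitEquiv.symm (P.unit r' ≫ leftEnd (𝟙_ C) z)
      -- The two Z-actions on Hom(g,u) become multiplication by the central image of Z in R on the
      -- right and on the left, so the map is balanced.
      rw [unit_comp_rightEnd, unit_comp_leftEnd]
      change P.unitEquiv.symm (P.unitEquiv _) ⊗ₜ[End (𝟙_ C)] _ = _ ⊗ₜ[End (𝟙_ C)]
        P.unitEquiv.symm (P.unitEquiv _)
      simp only [AddEquiv.symm_apply_apply]
      rw [← Algebra.commutes, ← Algebra.smul_def, ← Algebra.smul_def, TensorProduct.smul_tmul])

lemma toTensor_ztm (x y : g ⟶ 𝟙_ C) :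
    P.toTensor (ztm _ _ x y) = P.unitEquiv.symm x ⊗ₜ P.unitEquiv.symm y := rfl

end

variable {P Q : Realization g}

/-- The map from the base to Hom(g,u) is injective and is preserved by isomorphisms, so it fixes the
ring map; the remaining fields are propositions. -/
instance (P Q : Realization g) : Subsingleton (P.Iso Q) where
  allEq i j := by
    have h : i.φ = j.φ := AlgEquiv.ext fun r =>
      Q.unit_injective ((i.map_unit r).trans (j.map_unit r).symm)
    cases i; cases j; cases h; rfl

/-- Insertion uses the base only through s on the first leg and t on the second, and an isomorphism
preserves s, t and δ(1). -/
lemma Iso.insert_idem (i : P.Iso Q) {a b : C} (x : g ⟶ a) (y : g ⟶ b) :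
    Q.insert x y Q.sep.idem = P.insert x y P.sep.idem := by
  have h := i.map_δ 1
  rw [map_one i.φ] at h
  change TensorProduct.map i.φ.toLinearMap i.φ.toLinearMap P.sep.idem = Q.sep.idem at h
  rw [← h]
  exact RBimod.addHom_ext₂ _ (f := (Q.insert x y).comp
    (TensorProduct.map i.φ.toLinearMap i.φ.toLinearMap).toAddMonoidHom) (g := P.insert x y)
    (fun e f => by
      change Q.insert x y (i.φ e ⊗ₜ i.φ f) = P.insert x y (e ⊗ₜ f)
      rw [insert_tmul, insert_tmul, i.map_s, i.map_t]) P.sep.idem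

lemma Iso.induces (i : P.Iso Q) {S : SplitMonoidal (homFunctor g)} (h : P.Induces S) :
    Q.Induces S := by
  rw [induces_iff] at h ⊢
  obtain ⟨h1, h2, h3, h4⟩ := h
  refine ⟨fun a b x y => ?_, fun z => ?_, fun a b x y => ?_, fun r => ?_⟩
  · rw [h1, i.map_mul]
  · rw [h2, ← i.map_unit, AlgEquiv.commutes]
  · rw [i.map_mul, h3, i.insert_idem]
  · obtain ⟨r, rfl⟩ := i.φ.surjective r
    rw [i.map_unit, h4, i.map_ψ]

/-- The isomorphism `R ≅ Hom(g, u) ≅ R'` of base rings. -/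
def baseEquiv (hm : ∀ (a b : C) (x : g ⟶ a) (y : g ⟶ b), Q.mul x y = P.mul x y)
    (hu : Q.unit 1 = P.unit 1) : P.R ≃ₐ[End (𝟙_ C)] Q.R :=
  AlgEquiv.ofRingEquiv
    (f := { P.unitEquiv.trans Q.unitEquiv.symm with
      map_mul' := fun r r' => Q.unit_injective <| by
        have hφ : ∀ r : P.R, Q.unit ((P.unitEquiv.trans Q.unitEquiv.symm) r) = P.unit r :=
          fun r => Q.unitEquiv.apply_symm_apply _
        change Q.unit ((P.unitEquiv.trans Q.unitEquiv.symm) (r * r')) =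
          Q.unit ((P.unitEquiv.trans Q.unitEquiv.symm) r * (P.unitEquiv.trans Q.unitEquiv.symm) r')
        -- Under R ≅ Hom(g,u), multiplication in R is the product into Hom(g, u ⊗ u) followed by the
        -- left unit constraint, so it depends only on `mul`.
        rw [hφ, ← t_comp_unit, ← t_comp_unit, ← unit_mul, ← unit_mul, hφ, hφ, hm] })
    (fun z => Q.unit_injective <| by
      change Q.unit (Q.unitEquiv.symm (P.unit _)) = _
      refine (Q.unitEquiv.apply_symm_apply _).trans ?_
      -- The image of z in Hom(g,u) is the image of 1 composed with an endomorphism of u that does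
      -- not depend on the realization.
      rw [← mul_one (algebraMap _ P.R z), ← mul_one (algebraMap _ Q.R z), ← unit_comp_leftEnd,
        ← unit_comp_leftEnd, hu])

lemma unit_baseEquiv (hm : ∀ (a b : C) (x : g ⟶ a) (y : g ⟶ b), Q.mul x y = P.mul x y)
    (hu : Q.unit 1 = P.unit 1) (r : P.R) : Q.unit (baseEquiv hm hu r) = P.unit r :=
  Q.unitEquiv.apply_symm_apply _

/-- Taking x to be the identity of g expresses the source map through `mul` and `unit` alone; `t_eq`
does so for the target map. -/
lemma s_eq (P : Realization g) (r : P.R) :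
    P.B.s r = (P.mul (𝟙 g) (P.unit r) ≫ (ρ_ g).hom : g ⟶ g) := by
  rw [mul_unit]; exact (Category.comp_id _).symm

lemma t_eq (P : Realization g) (r : P.R) :
    P.B.t (op r) = (P.mul (P.unit r) (𝟙 g) ≫ (λ_ g).hom : g ⟶ g) := by
  rw [unit_mul]; exact (Category.comp_id _).symm

/-- By γ(1·a) = γ(1)γ(a) and γ(1) = 1 ⊗ 1, the element γ(a) is the action of a on 1 ⊗ 1, and κ is
A-linear. So γ is determined by the products. -/
lemma mulEquiv_comul (P : Realization g) (a : g ⟶ g) :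
    P.mulEquiv g g (P.B.comul a) = a ≫ P.mul (𝟙 g) (𝟙 g) := by
  rw [← mulEquiv_tmul, comp_mulEquiv]
  refine congrArg (P.mulEquiv g g) ?_
  have h := P.B.comul_mul 1 (show End g from a)
  rw [one_mul, P.B.comul_one] at h
  exact h

lemma unit_counit (P : Realization g) (a : g ⟶ g) : P.unit (P.B.counit a) = a ≫ P.unit 1 := by
  rw [comp_unit, P.B.unitAct_apply, map_one, one_mul]

/-- Inserting between two copies of the unit loses no information, so the separability element can
be read off from δ on the product of the unit with itself. -/
lemma insert_unit (P : Realization g) (x : P.R ⊗[End (𝟙_ C)] P.R) :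
    P.toTensor (P.insert (P.unit 1) (P.unit 1) x) = x :=
  RBimod.addHom_ext₂ _ (f := P.toTensor.comp (P.insert (P.unit 1) (P.unit 1)))
    (g := AddMonoidHom.id _) (fun e f => by
      change P.toTensor (P.insert (P.unit 1) (P.unit 1) (e ⊗ₜ f)) = e ⊗ₜ f
      rw [insert_tmul, s_comp_unit, t_comp_unit, one_mul, mul_one, toTensor_ztm]
      exact congrArg₂ (fun a b => a ⊗ₜ b) (P.unitEquiv.symm_apply_apply e)
        (P.unitEquiv.symm_apply_apply f)) x

/-- The structure S fixes the products through μ and the image of 1 in Hom(g,u) through ε. All other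
data are expressed by these together with δ and η. -/
lemma nonempty_iso {S : SplitMonoidal (homFunctor g)} (hP : P.Induces S) (hQ : Q.Induces S) :
    Nonempty (P.Iso Q) := by
  rw [induces_iff] at hP hQ
  obtain ⟨p1, p2, p3, p4⟩ := hP
  obtain ⟨q1, q2, q3, q4⟩ := hQ
  have hm : ∀ (a b : C) (x : g ⟶ a) (y : g ⟶ b), Q.mul x y = P.mul x y :=
    fun a b x y => by rw [← q1, p1]
  have hu : Q.unit 1 = P.unit 1 := by
    rw [← map_one (algebraMap (End (𝟙_ C)) P.R), ← map_one (algebraMap (End (𝟙_ C)) Q.R), ← p2,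
      ← q2]
  have hs : ∀ r, Q.B.s (baseEquiv hm hu r) = P.B.s r := fun r => by
    rw [s_eq, s_eq, unit_baseEquiv, hm]
  have ht : ∀ r, Q.B.t (op (baseEquiv hm hu r)) = P.B.t (op r) := fun r => by
    rw [t_eq, t_eq, unit_baseEquiv, hm]
  -- Both separability elements come from the value of δ at one and the same element of Hom(g, u ⊗
  -- u).
  have hidem : TensorProduct.map (baseEquiv hm hu).toLinearMap (baseEquiv hm hu).toLinearMap
      P.sep.idem = Q.sep.idem := by
    rw [← Q.insert_unit Q.sep.idem, ← q3, hu, hm, p3]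
    exact RBimod.addHom_ext₂ _ (f := (TensorProduct.map (baseEquiv hm hu).toLinearMap
      (baseEquiv hm hu).toLinearMap).toAddMonoidHom)
      (g := Q.toTensor.comp (P.insert (P.unit 1) (P.unit 1))) (fun e f => by
      change (baseEquiv hm hu e) ⊗ₜ (baseEquiv hm hu f) =
        Q.toTensor (P.insert (P.unit 1) (P.unit 1) (e ⊗ₜ f))
      rw [insert_tmul, s_comp_unit, t_comp_unit, one_mul, mul_one, toTensor_ztm]
      rfl) P.sep.idem
  refine ⟨⟨baseEquiv hm hu, hs, ht, fun a => ?_, fun a => ?_, fun r => ?_, fun r => ?_, hm,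
    unit_baseEquiv hm hu⟩⟩
  -- Inside Hom(g, g ⊗ g) both comultiplications of a become a followed by the common product of the
  -- identity with itself.
  · refine (Q.mulEquiv g g).injective ?_
    rw [mulEquiv_comul, hm]
    refine Eq.trans ?_ (P.mulEquiv_comul a)
    exact RBimod.tens_hom_ext (V := P.B.bimod (g ⟶ g)) (W := P.B.bimod (g ⟶ g))
      (f := (Q.mulEquiv g g).toAddMonoidHom.comp (P.B.changeBase Q.B.toSourceTarget
        (baseEquiv hm hu) hs ht (End g) (End g)))
      (g := (P.mulEquiv g g).toAddMonoidHom) (fun x y => hm g g x y) (P.B.comul a)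
  · refine Q.unit_injective ?_
    rw [unit_baseEquiv, unit_counit, unit_counit, hu]
  · rw [P.sep.comul_eq_left, Q.sep.comul_eq_left, ← hidem]
    exact RBimod.addHom_ext₂ _ (f := (TensorProduct.map (baseEquiv hm hu).toLinearMap
      (baseEquiv hm hu).toLinearMap).toAddMonoidHom.comp
        (AddMonoidHom.mulLeft (r ⊗ₜ[End (𝟙_ C)] (1 : P.R))))
      (g := (AddMonoidHom.mulLeft ((baseEquiv hm hu r) ⊗ₜ[End (𝟙_ C)] (1 : Q.R))).comp
        (TensorProduct.map (baseEquiv hm hu).toLinearMap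
          (baseEquiv hm hu).toLinearMap).toAddMonoidHom) (fun e f => by
      change TensorProduct.map (baseEquiv hm hu).toLinearMap (baseEquiv hm hu).toLinearMap
        ((r ⊗ₜ[End (𝟙_ C)] (1 : P.R)) * (e ⊗ₜ f)) = ((baseEquiv hm hu r) ⊗ₜ[End (𝟙_ C)] (1 : Q.R)) *
          ((baseEquiv hm hu e) ⊗ₜ (baseEquiv hm hu f))
      rw [Algebra.TensorProduct.tmul_mul_tmul, Algebra.TensorProduct.tmul_mul_tmul,
        TensorProduct.map_tmul, one_mul, one_mul]
      exact congrArg (· ⊗ₜ _) (map_mul (baseEquiv hm hu) r e)) P.sep.idem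
  · rw [← q4, unit_baseEquiv, p4]

end Realization

/-! ### Convolution by a comonoid g. -/

section

open scoped ComonObj

section Convolution

variable {C : Type u} [Category.{v} C] [MonoidalCategory C] {g : C} [ComonObj g]

/-- The product `Hom(g, a) × Hom(g, b) → Hom(g, a ⊗ b)` defined by a comonoid `g`. -/
def convol {a b : C} (x : g ⟶ a) (y : g ⟶ b) : g ⟶ a ⊗ b := Δ[g] ≫ (x ⊗ₘ y)

lemma convol_comp {a b a' b' : C} (x : g ⟶ a) (y : g ⟶ b) (f : a ⟶ a') (h : b ⟶ b') :
    convol (x ≫ f) (y ≫ h) = convol x y ≫ (f ⊗ₘ h) := by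
  simp only [convol, Category.assoc, tensorHom_comp_tensorHom]

lemma convol_comp_left {a b a' : C} (x : g ⟶ a) (y : g ⟶ b) (f : a ⟶ a') :
    convol (x ≫ f) y = convol x y ≫ (f ▷ b) := by
  have h := convol_comp x y f (𝟙 b)
  rwa [Category.comp_id, tensorHom_id] at h

lemma convol_comp_right {a b b' : C} (x : g ⟶ a) (y : g ⟶ b) (f : b ⟶ b') :
    convol x (y ≫ f) = convol x y ≫ (a ◁ f) := by
  have h := convol_comp x y (𝟙 a) f
  rwa [Category.comp_id, id_tensorHom] at h

lemma convol_id_id : convol (𝟙 g) (𝟙 g) = Δ[g] := by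
  rw [convol, id_tensorHom_id, Category.comp_id]

lemma convol_assoc {a b c : C} (x : g ⟶ a) (y : g ⟶ b) (z : g ⟶ c) :
    convol (convol x y) z ≫ (α_ a b c).hom = convol x (convol y z) := by
  have h1 : (Δ[g] ≫ (x ⊗ₘ y)) ⊗ₘ z = (Δ[g] ▷ g) ≫ ((x ⊗ₘ y) ⊗ₘ z) := by
    rw [← tensorHom_id, tensorHom_comp_tensorHom, Category.id_comp]
  have h2 : x ⊗ₘ (Δ[g] ≫ (y ⊗ₘ z)) = (g ◁ Δ[g]) ≫ (x ⊗ₘ (y ⊗ₘ z)) := by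
    rw [← id_tensorHom, tensorHom_comp_tensorHom, Category.id_comp]
  simp only [convol]
  rw [h1, h2, Category.assoc, Category.assoc, associator_naturality,
    ComonObj.comul_assoc_assoc]

lemma convol_assoc_inv {a b c : C} (x : g ⟶ a) (y : g ⟶ b) (z : g ⟶ c) :
    convol x (convol y z) ≫ (α_ a b c).inv = convol (convol x y) z := by
  rw [← convol_assoc, Category.assoc, Iso.hom_inv_id, Category.comp_id]

lemma counit_convol {b : C} (y : g ⟶ b) : convol ε[g] y = y ≫ (λ_ b).inv := by
  rw [convol, MonoidalCategory.tensorHom_def, ComonObj.counit_comul_assoc, leftUnitor_inv_naturality]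

lemma convol_counit {a : C} (x : g ⟶ a) : convol x ε[g] = x ≫ (ρ_ a).inv := by
  rw [convol, MonoidalCategory.tensorHom_def', ComonObj.comul_counit_assoc, rightUnitor_inv_naturality]

/-- The left action of `Hom(g, u)` on `Hom(g, b)`. -/
def convLeft {b : C} (r : g ⟶ 𝟙_ C) (y : g ⟶ b) : g ⟶ b := convol r y ≫ (λ_ b).hom

/-- The right action of `Hom(g, u)` on `Hom(g, a)`. -/
def convRight {a : C} (x : g ⟶ a) (r : g ⟶ 𝟙_ C) : g ⟶ a := convol x r ≫ (ρ_ a).hom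

lemma convLeft_comp {b b' : C} (r : g ⟶ 𝟙_ C) (y : g ⟶ b) (f : b ⟶ b') :
    convLeft r (y ≫ f) = convLeft r y ≫ f := by
  rw [convLeft, convLeft, convol_comp_right, Category.assoc, Category.assoc, leftUnitor_naturality]

lemma convRight_comp {a a' : C} (x : g ⟶ a) (f : a ⟶ a') (r : g ⟶ 𝟙_ C) :
    convRight (x ≫ f) r = convRight x r ≫ f := by
  rw [convRight, convRight, convol_comp_left, Category.assoc, Category.assoc,
    rightUnitor_naturality]

/-- The action of r is natural in b, so by Yoneda it is precomposition with an endomorphism of g.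
This endomorphism becomes t(r); the analogue for the right action gives s(r). -/
lemma convLeft_id_comp {b : C} (r : g ⟶ 𝟙_ C) (y : g ⟶ b) :
    convLeft r (𝟙 g) ≫ y = convLeft r y := by
  rw [← convLeft_comp, Category.id_comp]

lemma convRight_id_comp {b : C} (r : g ⟶ 𝟙_ C) (y : g ⟶ b) :
    convRight (𝟙 g) r ≫ y = convRight y r := by
  rw [← convRight_comp, Category.id_comp]

lemma convLeft_counit {b : C} (y : g ⟶ b) : convLeft ε[g] y = y := by
  rw [convLeft, counit_convol, Category.assoc, Iso.inv_hom_id, Category.comp_id]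

lemma convRight_counit {a : C} (x : g ⟶ a) : convRight x ε[g] = x := by
  rw [convRight, convol_counit, Category.assoc, Iso.inv_hom_id, Category.comp_id]

/-- The left and right unit constraints of u ⊗ u agree, so both actions of Hom(g,u) on itself are
one multiplication. -/
lemma convLeft_eq_convRight (r r' : g ⟶ 𝟙_ C) : convLeft r r' = convRight r r' := by
  rw [convLeft, convRight, unitors_equal]

lemma convLeft_counit_right (r : g ⟶ 𝟙_ C) : convLeft r ε[g] = r := by
  rw [convLeft_eq_convRight, convRight_counit]

lemma convRight_counit_left (r : g ⟶ 𝟙_ C) : convRight ε[g] r = r := by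
  rw [← convLeft_eq_convRight, convLeft_counit]

/-- Both sides are the triple convolution of x, r and y with the factor u removed, by
coassociativity and the triangle axiom. Therefore the product descends to ⊗_R. With x and y the
identity it is also the condition that places γ(a) in the subset Γ. -/
lemma convol_balanced {a b : C} (x : g ⟶ a) (r : g ⟶ 𝟙_ C) (y : g ⟶ b) :
    convol (convRight x r) y = convol x (convLeft r y) := by
  rw [convRight, convLeft, convol_comp_left, convol_comp_right, ← triangle, ← convol_assoc,
    Category.assoc]

lemma convLeft_convol {a b : C} (r : g ⟶ 𝟙_ C) (x : g ⟶ a) (y : g ⟶ b) :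
    convLeft r (convol x y) = convol (convLeft r x) y := by
  rw [convLeft, convLeft, convol_comp_left, ← convol_assoc, leftUnitor_tensor_hom, Category.assoc,
    Iso.hom_inv_id_assoc]

lemma convRight_convol {a b : C} (x : g ⟶ a) (y : g ⟶ b) (r : g ⟶ 𝟙_ C) :
    convRight (convol x y) r = convol x (convRight y r) := by
  rw [convRight, convRight, convol_comp_right, ← convol_assoc, rightUnitor_tensor_hom,
    Category.assoc]

lemma convLeft_convLeft {b : C} (r r' : g ⟶ 𝟙_ C) (y : g ⟶ b) :
    convLeft (convLeft r r') y = convLeft r (convLeft r' y) := by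
  have h : convLeft r (convol r' y ≫ (λ_ b).hom) = convol (convLeft r r') y ≫ (λ_ b).hom := by
    rw [convLeft_comp, convLeft_convol]
  exact h.symm

lemma convRight_convRight {a : C} (x : g ⟶ a) (r r' : g ⟶ 𝟙_ C) :
    convRight (convRight x r) r' = convRight x (convRight r r') := by
  have h : convRight (convol x r ≫ (ρ_ a).hom) r' = convol x (convRight r r') ≫ (ρ_ a).hom := by
    rw [convRight_comp, convRight_convol]
  exact h

lemma convLeft_convRight {a : C} (r : g ⟶ 𝟙_ C) (x : g ⟶ a) (r' : g ⟶ 𝟙_ C) :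
    convLeft r (convRight x r') = convRight (convLeft r x) r' := by
  rw [convRight, convLeft_comp, convLeft_convol]; rfl

end Convolution

/-! ### The convolution ring R and Hom(g,-) as a functor to R-R-bimodules. -/

section Additive

variable {C : Type u} [Category.{v} C] [MonoidalCategory C] [Preadditive C] [MonoidalPreadditive C]
  {g : C} [ComonObj g]

lemma convol_add {a b : C} (x : g ⟶ a) (y y' : g ⟶ b) :
    convol x (y + y') = convol x y + convol x y' := by
  simp only [convol, MonoidalPreadditive.tensor_add, Preadditive.comp_add]

lemma add_convol {a b : C} (x x' : g ⟶ a) (y : g ⟶ b) :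
    convol (x + x') y = convol x y + convol x' y := by
  simp only [convol, MonoidalPreadditive.add_tensor, Preadditive.comp_add]

lemma convLeft_add {b : C} (r : g ⟶ 𝟙_ C) (y y' : g ⟶ b) :
    convLeft r (y + y') = convLeft r y + convLeft r y' := by
  simp only [convLeft, convol_add, Preadditive.add_comp]

lemma add_convLeft {b : C} (r r' : g ⟶ 𝟙_ C) (y : g ⟶ b) :
    convLeft (r + r') y = convLeft r y + convLeft r' y := by
  simp only [convLeft, add_convol, Preadditive.add_comp]

lemma convRight_add {a : C} (x : g ⟶ a) (r r' : g ⟶ 𝟙_ C) :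
    convRight x (r + r') = convRight x r + convRight x r' := by
  simp only [convRight, convol_add, Preadditive.add_comp]

lemma add_convRight {a : C} (x x' : g ⟶ a) (r : g ⟶ 𝟙_ C) :
    convRight (x + x') r = convRight x r + convRight x' r := by
  simp only [convRight, add_convol, Preadditive.add_comp]

/-- The product on `Hom(g, a) × Hom(g, b)` as a biadditive map. -/
def convolHom (g a b : C) [ComonObj g] : (g ⟶ a) →+ (g ⟶ b) →+ (g ⟶ a ⊗ b) :=
  AddMonoidHom.mk' (fun x => AddMonoidHom.mk' (fun y => convol x y) (convol_add x))
    (fun x x' => AddMonoidHom.ext (add_convol x x'))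

/-- The left action of `Hom(g, u)` on `Hom(g, b)` as a biadditive map. -/
def convLeftHom (g b : C) [ComonObj g] : (g ⟶ 𝟙_ C) →+ (g ⟶ b) →+ (g ⟶ b) :=
  AddMonoidHom.mk' (fun r => AddMonoidHom.mk' (fun y => convLeft r y) (convLeft_add r))
    (fun r r' => AddMonoidHom.ext (add_convLeft r r'))

/-- The right action of `Hom(g, u)` on `Hom(g, a)` as a biadditive map. -/
def convRightHom (g a : C) [ComonObj g] : (g ⟶ a) →+ (g ⟶ 𝟙_ C) →+ (g ⟶ a) :=
  AddMonoidHom.mk' (fun x => AddMonoidHom.mk' (fun r => convRight x r) (convRight_add x))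
    (fun x x' => AddMonoidHom.ext (add_convRight x x'))

/-- The convolution ring `Hom(g, u)` of a comonoid `g`. -/
def ConvRing (g : C) : Type v := g ⟶ 𝟙_ C

/-- An element of the convolution ring as a morphism. -/
def ConvRing.toHom (r : ConvRing g) : g ⟶ 𝟙_ C := r

instance : AddCommGroup (ConvRing g) := inferInstanceAs (AddCommGroup (g ⟶ 𝟙_ C))

instance : Ring (ConvRing g) where
  __ := (inferInstance : AddCommGroup (ConvRing g))
  mul r r' := convLeft r.toHom r'.toHom
  one := ε[g]
  left_distrib r r' r'' := convLeft_add r.toHom r'.toHom r''.toHom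
  right_distrib r r' r'' := add_convLeft r.toHom r'.toHom r''.toHom
  zero_mul r := map_zero ((convLeftHom g (𝟙_ C)).flip r.toHom)
  mul_zero r := map_zero (convLeftHom g (𝟙_ C) r.toHom)
  mul_assoc r r' r'' := convLeft_convLeft r.toHom r'.toHom r''.toHom
  one_mul r := convLeft_counit r.toHom
  mul_one r := (convLeft_eq_convRight r.toHom ε[g]).trans (convRight_counit r.toHom)

namespace ConvRing

lemma mul_def (r r' : ConvRing g) : r * r' = convLeft r.toHom r'.toHom := rfl

lemma mul_def' (r r' : ConvRing g) : r * r' = convRight r.toHom r'.toHom :=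
  convLeft_eq_convRight r.toHom r'.toHom

variable (g) in
/-- The diagram `Rᵒᵖ → End g ← R` for the convolution ring `R` of `g`. -/
def sourceTarget : SourceTarget (ConvRing g) (End g) where
  s :=
    { toFun := fun r => convRight (𝟙 g) r.toHom
      map_one' := convRight_counit (𝟙 g)
      map_mul' := fun r r' => by
        -- The product in `End g` is composition in reverse order, which makes s multiplicative and
        -- t antimultiplicative in R.
        change convRight (𝟙 g) (r * r').toHom = convRight (𝟙 g) r'.toHom ≫ convRight (𝟙 g) r.toHom
        rw [convRight_id_comp, convRight_convRight]
        exact congrArg (convRight (𝟙 g)) (mul_def' r r')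
      map_zero' := map_zero (convRightHom g g (𝟙 g))
      map_add' := fun r r' => convRight_add (𝟙 g) r.toHom r'.toHom }
  t :=
    { toFun := fun r => convLeft (unop r).toHom (𝟙 g)
      map_one' := convLeft_counit (𝟙 g)
      map_mul' := fun r r' => by
        change convLeft (unop r' * unop r).toHom (𝟙 g) =
          convLeft (unop r').toHom (𝟙 g) ≫ convLeft (unop r).toHom (𝟙 g)
        rw [convLeft_id_comp, ← convLeft_convLeft]
        rfl
      map_zero' := map_zero ((convLeftHom g g).flip (𝟙 g))
      map_add' := fun r r' => add_convLeft (unop r).toHom (unop r').toHom (𝟙 g) }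
  commute r r' := by
    change convLeft r'.toHom (𝟙 g) ≫ convRight (𝟙 g) r.toHom =
      convRight (𝟙 g) r.toHom ≫ convLeft r'.toHom (𝟙 g)
    rw [convLeft_id_comp, convRight_id_comp, convLeft_convRight]

/-- The bimodule `Hom(g, b)` over the convolution ring. -/
abbrev homBimod (g b : C) [ComonObj g] : RBimod.{v} (ConvRing g) := (sourceTarget g).bimod (g ⟶ b)

lemma smul_def {b : C} (r : ConvRing g) (x : g ⟶ b) :
    (r • (show homBimod g b from x) : homBimod g b) = convLeft r.toHom x :=
  convLeft_id_comp r.toHom x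

lemma op_smul_def {b : C} (r : ConvRing g) (x : g ⟶ b) :
    (op r • (show homBimod g b from x) : homBimod g b) = convRight x r.toHom :=
  convRight_id_comp r.toHom x

/-- The map `Hom(g, a) ⊗_R Hom(g, b) → Hom(g, a ⊗ b)`. -/
def mulMap (g a b : C) [ComonObj g] : homBimod g a ⊗ homBimod g b ⟶ homBimod g (a ⊗ b) :=
  RBimod.liftHom (V := homBimod g a) (W := homBimod g b) (P := homBimod g (a ⊗ b))
    (convolHom g a b)
    (fun x r y => (congrArg (fun z => convol z _) (op_smul_def r x)).trans
      ((convol_balanced _ _ _).trans (congrArg (fun z => convol _ z) (smul_def r y)).symm))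
    (fun r x _ => (congrArg (fun z => convol z _) (smul_def r x)).trans
      ((convLeft_convol _ _ _).symm.trans (smul_def r (convol _ _)).symm))
    (fun r _ y => (congrArg (fun z => convol _ z) (op_smul_def r y)).trans
      ((convRight_convol _ _ _).symm.trans (op_smul_def r (convol _ _)).symm))

/-- The functor `Hom(g, -)` to bimodules over the convolution ring. -/
def homFunctor (g : C) [ComonObj g] : C ⥤ RBimod.{v} (ConvRing g) where
  obj b := homBimod g b
  map {a b} f := (sourceTarget g).bimodMap (V := g ⟶ a) (W := g ⟶ b)
    ((preadditiveCoyonedaObj g).map f).hom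
  map_id a := RBimod.hom_ext fun x => Category.comp_id (show g ⟶ a from x)
  map_comp f h := RBimod.hom_ext fun x => (Category.assoc (show g ⟶ _ from x) f h).symm

/-- The isomorphism `Hom(g, a) ⊗_R Hom(g, b) ≅ Hom(g, a ⊗ b)`. -/
def mulIso {a b : C} (h : Function.Bijective (RBimod.homOf (mulMap g a b))) :
    homBimod g a ⊗ homBimod g b ≅ homBimod g (a ⊗ b) :=
  let e := AddEquiv.ofBijective _ h
  RBimod.mkIso (mulMap g a b)
    (RBimod.mkHom (V := homBimod g (a ⊗ b)) (W := homBimod g a ⊗ homBimod g b) e.symm.toAddMonoidHom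
      (fun r x => e.injective <| by
        obtain ⟨x, rfl⟩ := e.surjective x
        refine (e.apply_symm_apply _).trans ?_
        refine (RBimod.homOf_smul (mulMap g a b) r x).symm.trans ?_
        exact congrArg (fun z => e (r • z)) (e.symm_apply_apply x).symm)
      (fun r x => e.injective <| by
        obtain ⟨x, rfl⟩ := e.surjective x
        refine (e.apply_symm_apply _).trans ?_
        refine (RBimod.homOf_op_smul (mulMap g a b) r x).symm.trans ?_
        exact congrArg (fun z => e (op r • z)) (e.symm_apply_apply x).symm))
    e.symm_apply_apply e.apply_symm_apply

lemma mulMap_naturality {a b a' b' : C} (f : a ⟶ a') (h : b ⟶ b') :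
    ((homFunctor g).map f ⊗ₘ (homFunctor g).map h) ≫ mulMap g a' b' =
      mulMap g a b ≫ (homFunctor g).map (f ⊗ₘ h) :=
  RBimod.tensor_hom_ext (V := homBimod g a) (W := homBimod g b) fun _ _ => convol_comp _ _ f h

/-- If the maps `Hom(g, a) ⊗_R Hom(g, b) → Hom(g, a ⊗ b)` are bijective, then `Hom(g, -)` is a strong
monoidal functor to bimodules over the convolution ring `R`. -/
def coreMonoidal (h : ∀ a b : C, Function.Bijective (RBimod.homOf (mulMap g a b))) :
    (homFunctor g).CoreMonoidal where
  -- The ring R is Hom(g,u) by definition, so the comparison of units is the identity map.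
  εIso := RBimod.mkIso (V := RBimod.regular (ConvRing g)) (W := homBimod g (𝟙_ C))
    (RBimod.mkHom (V := RBimod.regular (ConvRing g)) (W := homBimod g (𝟙_ C))
      (AddMonoidHom.id (ConvRing g)) (fun r _ => (smul_def r _).symm)
      (fun r (x : ConvRing g) => (mul_def' x r).trans (op_smul_def r _).symm))
    (RBimod.mkHom (V := homBimod g (𝟙_ C)) (W := RBimod.regular (ConvRing g))
      (AddMonoidHom.id (ConvRing g)) (fun r _ => (smul_def r _))
      (fun r (x : ConvRing g) => (op_smul_def r _).trans (mul_def' x r).symm))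
    (fun _ => rfl) (fun _ => rfl)
  μIso a b := mulIso (h a b)
  μIso_hom_natural_left f _ := RBimod.tensor_hom_ext fun _ _ => convol_comp_left _ _ f
  μIso_hom_natural_right _ f := RBimod.tensor_hom_ext fun _ _ => convol_comp_right _ _ f
  associativity _ _ _ := RBimod.tensor₃_hom_ext fun _ _ _ => convol_assoc _ _ _
  left_unitality _ := RBimod.tensor_hom_ext fun _ _ => smul_def _ _
  right_unitality _ := RBimod.tensor_hom_ext fun _ _ => op_smul_def _ _

end ConvRing

end Additive

end

/-! ### The bialgebroid on End g for a comonoid g with bijective product maps. -/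

section

open scoped ComonObj

namespace Bialgebroid

variable {R A : Type v} [Ring R] [Ring A] (B : Bialgebroid R A)

lemma hom_ext_tm {V W P : B.RMod} {f k : V ⊗ W ⟶ P}
    (h : ∀ v w, B.asLin f (B.tm' v w) = B.asLin k (B.tm' v w)) : f = k :=
  B.forget.map_injective <| RBimod.hom_ext fun x =>
    B.tens_ext (V := B.asModule V) (W := B.asModule W) (P := B.asModule P)
      (f := (B.asLin f).toAddMonoidHom) (g := (B.asLin k).toAddMonoidHom) h x

lemma hom_ext_tm₃ {U V W P : B.RMod} {f k : (U ⊗ V) ⊗ W ⟶ P}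
    (h : ∀ u v w, B.asLin f (B.tm' (V := U ⊗ V) (B.tm' u v) w) =
      B.asLin k (B.tm' (V := U ⊗ V) (B.tm' u v) w)) : f = k :=
  B.hom_ext_tm fun x w =>
    B.tens_ext (V := B.asModule U) (W := B.asModule V) (P := B.asModule P)
      (f := (B.asLin f).toAddMonoidHom.comp
        ((RBimod.tmulHom (B.forget.obj (U ⊗ V)) (B.forget.obj W)).flip w))
      (g := (B.asLin k).toAddMonoidHom.comp
        ((RBimod.tmulHom (B.forget.obj (U ⊗ V)) (B.forget.obj W)).flip w))
      (fun u v => h u v w) x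

end Bialgebroid

namespace ConvRing

variable {C : Type u} [Category.{v} C] [MonoidalCategory C] [Preadditive C] [MonoidalPreadditive C]
  {g : C} [ComonObj g]

section

variable (h : ∀ a b : C, Function.Bijective (RBimod.homOf (mulMap g a b)))

/-- The orbit map of x is Hom(g,x), so this is naturality of the product. -/
lemma mulMap_orbit {a b : C} (x : g ⟶ a) (y : g ⟶ b) (z : (homBimod g g ⊗ homBimod g g :
    RBimod.{v} (ConvRing g))) :
    RBimod.homOf (mulMap g a b)
      (RBimod.homOf ((sourceTarget g).orbit x ⊗ₘ (sourceTarget g).orbit y) z) =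
        (RBimod.homOf (mulMap g g g) z : g ⟶ g ⊗ g) ≫ (x ⊗ₘ y) :=
  congrArg (fun f => RBimod.homOf f z) (mulMap_naturality x y)

/-- Applied to x = γ(c), this yields both the multiplicativity of γ and the A-linearity of the
comparison maps for tensor products. -/
lemma mulMap_act {a b : C} (c : g ⟶ g) (x : (homBimod g g ⊗ homBimod g g : RBimod.{v} (ConvRing g)))
    (hx : x ∈ (sourceTarget g).Takeuchi) (hc : RBimod.homOf (mulMap g g g) x = c ≫ Δ[g])
    (z : (homBimod g a ⊗ homBimod g b : RBimod.{v} (ConvRing g))) :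
    RBimod.homOf (mulMap g a b) ((sourceTarget g).act (g ⟶ a) (g ⟶ b) x hx z) =
      c ≫ (RBimod.homOf (mulMap g a b) z : g ⟶ a ⊗ b) :=
  RBimod.tens_hom_ext (V := homBimod g a) (W := homBimod g b)
    (f := (RBimod.homOf (mulMap g a b)).comp ((sourceTarget g).act (g ⟶ a) (g ⟶ b) x hx))
    (g := AddMonoidHom.comp (AddMonoidHom.mk' (fun f : g ⟶ a ⊗ b => c ≫ f)
      (fun f f' => Preadditive.comp_add _ _ _ _ _ _)) (RBimod.homOf (mulMap g a b)))
    (fun (x' : g ⟶ a) (y' : g ⟶ b) => by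
      refine (mulMap_orbit x' y' x).trans ?_
      rw [hc, Category.assoc]
      rfl) z

/-- The comultiplication of the bialgebroid `End g`. -/
def γ : (sourceTarget g).reg ⟶ (sourceTarget g).reg ⊗ (sourceTarget g).reg :=
  (homFunctor g).map Δ[g] ≫ (mulIso (h g g)).inv

/-- The counit of the bialgebroid `End g`. -/
def π : (sourceTarget g).reg ⟶ 𝟙_ (RBimod.{v} (ConvRing g)) :=
  (homFunctor g).map ε[g] ≫ (coreMonoidal h).εIso.inv

lemma mulMap_γ (c : g ⟶ g) : RBimod.homOf (mulMap g g g) (RBimod.homOf (γ h) c) = c ≫ Δ[g] :=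
  (AddEquiv.ofBijective _ (h g g)).apply_symm_apply (c ≫ Δ[g])

/-- The product map is injective, and inside Hom(g, g ⊗ g) the condition becomes `convol_balanced`
for two identities, precomposed with c. -/
lemma γ_mem (c : g ⟶ g) : RBimod.homOf (γ h) c ∈ (sourceTarget g).Takeuchi := fun r => by
  have e1 := mulMap_naturality (g := g) ((sourceTarget g).s r : g ⟶ g) (𝟙 g)
  have e2 := mulMap_naturality (g := g) (𝟙 g) ((sourceTarget g).t (op r) : g ⟶ g)
  rw [CategoryTheory.Functor.map_id] at e1 e2
  refine (h g g).1 ((congrArg (fun f => RBimod.homOf f (RBimod.homOf (γ h) c)) e1).trans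
    (Eq.trans ?_ (congrArg (fun f => RBimod.homOf f (RBimod.homOf (γ h) c)) e2).symm))
  change (RBimod.homOf (mulMap g g g) (RBimod.homOf (γ h) c) : g ⟶ g ⊗ g) ≫
      (convRight (𝟙 g) r.toHom ⊗ₘ 𝟙 g) =
    (RBimod.homOf (mulMap g g g) (RBimod.homOf (γ h) c) : g ⟶ g ⊗ g) ≫
      (𝟙 g ⊗ₘ convLeft r.toHom (𝟙 g))
  rw [mulMap_γ, Category.assoc, Category.assoc]
  exact congrArg (c ≫ ·) (convol_balanced (𝟙 g) r.toHom (𝟙 g))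

/-- The bialgebroid structure on `End g` for a comonoid `g`. -/
def bialgebroid : Bialgebroid (ConvRing g) (End g) where
  __ := sourceTarget g
  γ := γ h
  π := π h
  coassoc := by
    -- A strong monoidal functor sends the comonoid g to a comonoid, whose structure maps are γ and
    -- π by construction; the counit axioms below follow in the same way.
    let _ : (homFunctor g).Monoidal := (coreMonoidal h).toMonoidal
    let _ : ComonObj ((homFunctor g).obj g) := Functor.obj.instComonObj g (homFunctor g)
    exact (ComonObj.comul_assoc ((homFunctor g).obj g)).symm
  counit_left := by
    let _ : (homFunctor g).Monoidal := (coreMonoidal h).toMonoidal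
    let _ : ComonObj ((homFunctor g).obj g) := Functor.obj.instComonObj g (homFunctor g)
    exact ((ComonObj.counit_comul_assoc ((homFunctor g).obj g) _).trans (Iso.inv_hom_id _))
  counit_right := by
    let _ : (homFunctor g).Monoidal := (coreMonoidal h).toMonoidal
    let _ : ComonObj ((homFunctor g).obj g) := Functor.obj.instComonObj g (homFunctor g)
    exact ((ComonObj.comul_counit_assoc ((homFunctor g).obj g) _).trans (Iso.inv_hom_id _))
  γ_mem := γ_mem h
  γ_mul a b := by
    -- After the injective product map both sides become b ≫ a ≫ Δ.
    refine (h g g).1 ?_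
    refine (mulMap_act b _ (γ_mem h b) (mulMap_γ h b) _).trans ?_
    refine (congrArg (fun z => (show g ⟶ g from b) ≫ z) (mulMap_γ h a)).trans ?_
    exact (Category.assoc _ _ _).symm.trans (mulMap_γ h (show End g from a * b)).symm
  γ_one := by
    refine (h g g).1 ?_
    refine (mulMap_γ h (𝟙 g)).trans ?_
    rw [Category.id_comp]
    exact convol_id_id.symm
  π_one := Category.id_comp ε[g]
  π_t a b := by
    change (b ≫ convLeft (a ≫ ε[g]) (𝟙 g)) ≫ ε[g] = (b ≫ a) ≫ ε[g]
    -- The counit of g is the neutral element of convolution; the same fact proves `π_s`.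
    rw [Category.assoc, convLeft_id_comp, convLeft_eq_convRight, convRight_counit, Category.assoc]
  π_s a b := by
    change (b ≫ convRight (𝟙 g) (a ≫ ε[g])) ≫ ε[g] = (b ≫ a) ≫ ε[g]
    rw [Category.assoc, convRight_id_comp, ← convLeft_eq_convRight, convLeft_counit, Category.assoc]

/-- The strong monoidal structure of `Hom(g, -)` with values in right `End g`-modules. -/
def coreMonoidalHom : (bialgebroid h).hom.CoreMonoidal where
  εIso := (bialgebroid h).mkMorIso (V := (bialgebroid h).unitObj)
    (W := (bialgebroid h).hom.obj (𝟙_ C))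
    ((bialgebroid h).εIso.symm ≪≫ (coreMonoidal h).εIso)
    (fun (r : g ⟶ 𝟙_ C) => RBimod.hom_ext fun (c : g ⟶ g) => by
      -- A-linearity of the unit comparison: c acts on R by r ↦ π(s(r)c) and on Hom(g,u) by
      -- precomposition.
      change (c ≫ convRight (𝟙 g) r) ≫ ε[g] = c ≫ r
      rw [Category.assoc, convRight_id_comp, ← convLeft_eq_convRight, convLeft_counit])
  μIso a b := (bialgebroid h).mkMorIso
    (V := (bialgebroid h).tensorObj' ((bialgebroid h).hom.obj a) ((bialgebroid h).hom.obj b))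
    (W := (bialgebroid h).hom.obj (a ⊗ b))
    (((bialgebroid h).μIso _ _).symm ≪≫ mulIso (h a b))
    (fun z => RBimod.hom_ext fun c => mulMap_act c _ (γ_mem h c) (mulMap_γ h c) z)
  μIso_hom_natural_left f _ := (bialgebroid h).hom_ext_tm fun x y => convol_comp_left x y f
  μIso_hom_natural_right _ f := (bialgebroid h).hom_ext_tm fun x y => convol_comp_right x y f
  associativity _ _ _ := (bialgebroid h).hom_ext_tm₃ fun x y z => convol_assoc x y z
  left_unitality _ := (bialgebroid h).hom_ext_tm fun r x => convLeft_id_comp r x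
  right_unitality _ := (bialgebroid h).hom_ext_tm fun x r => convRight_id_comp r x

end

end ConvRing

end

/-! ### Separability elements, central endomorphisms and the realization of a comonoid. -/

section

open scoped ComonObj

namespace SeparabilityStructure

variable {Z R : Type v} [CommRing Z] [Ring R] [Algebra Z R]

/-- The separability structure defined by an element `x = ∑ eᵢ ⊗ fᵢ` with `r x = x r`,
`∑ eᵢ fᵢ = 1` and a counit. -/
def ofIdem (x : R ⊗[Z] R) (ψ : R →ₗ[Z] Z)
    (hx : ∀ r : R, (r ⊗ₜ[Z] (1 : R)) * x = x * ((1 : R) ⊗ₜ[Z] r))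
    (hm : LinearMap.mul' Z R x = 1) (hl : TensorProduct.lid Z R (ψ.rTensor R x) = 1)
    (hr : TensorProduct.rid Z R (ψ.lTensor R x) = 1) : SeparabilityStructure Z R :=
  let δ : R →ₗ[Z] R ⊗[Z] R :=
    LinearMap.mulRight Z x ∘ₗ (Algebra.TensorProduct.includeLeft : R →ₐ[Z] R ⊗[Z] R).toLinearMap
  have hδ : ∀ r, δ r = (r ⊗ₜ[Z] (1 : R)) * x := fun _ => rfl
  { comul := δ
    counit := ψ
    coassoc := by
      obtain ⟨s, hs⟩ := TensorProduct.exists_finset x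
      have h1 : ∀ r, δ r = ∑ i ∈ s, (r * i.1) ⊗ₜ[Z] i.2 := fun r => by
        rw [hδ, hs, Finset.mul_sum]
        exact Finset.sum_congr rfl fun i _ => by
          rw [Algebra.TensorProduct.tmul_mul_tmul, one_mul]
      have h2 : ∀ r, δ r = ∑ i ∈ s, i.1 ⊗ₜ[Z] (i.2 * r) := fun r => by
        rw [hδ, hx, hs, Finset.sum_mul]
        exact Finset.sum_congr rfl fun i _ => by
          rw [Algebra.TensorProduct.tmul_mul_tmul, mul_one]
      refine LinearMap.ext fun r => ?_
      change TensorProduct.assoc Z R R R (δ.rTensor R (δ r)) = δ.lTensor R (δ r)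
      rw [h2 r]
      simp only [map_sum, LinearMap.rTensor_tmul, LinearMap.lTensor_tmul]
      have h3 : ∀ i : R × R, TensorProduct.assoc Z R R R (δ i.1 ⊗ₜ[Z] (i.2 * r)) =
          ∑ j ∈ s, j.1 ⊗ₜ[Z] ((j.2 * i.1) ⊗ₜ[Z] (i.2 * r)) := fun i => by
        rw [h2 i.1, TensorProduct.sum_tmul, map_sum]
        rfl
      have h4 : ∀ j : R × R, j.1 ⊗ₜ[Z] δ (j.2 * r) =
          ∑ i ∈ s, j.1 ⊗ₜ[Z] ((j.2 * i.1) ⊗ₜ[Z] (i.2 * r)) := fun j => by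
        have h5 : δ (j.2 * r) = ∑ i ∈ s, (j.2 * i.1) ⊗ₜ[Z] (i.2 * r) := by
          have h6 : δ (j.2 * r) = ((j.2 ⊗ₜ[Z] (1 : R)) * δ r) := by
            rw [hδ, hδ, ← mul_assoc, Algebra.TensorProduct.tmul_mul_tmul, one_mul]
          rw [h6, h2 r, Finset.mul_sum]
          exact Finset.sum_congr rfl fun i _ => by
            rw [Algebra.TensorProduct.tmul_mul_tmul, one_mul]
        rw [h5, TensorProduct.tmul_sum]
      -- Both bracketings equal ∑ eⱼ ⊗ fⱼeᵢ ⊗ fᵢr; only the order of summation differs.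
      rw [Finset.sum_congr rfl fun i _ => h3 i, Finset.sum_congr rfl fun i _ => h4 i,
        Finset.sum_comm]
    rTensor_counit_comp_comul := by
      refine LinearMap.ext fun r => (TensorProduct.lid Z R).injective ?_
      have h : ∀ y : R ⊗[Z] R, TensorProduct.lid Z R (ψ.rTensor R (y * ((1 : R) ⊗ₜ[Z] r))) =
          TensorProduct.lid Z R (ψ.rTensor R y) * r := fun y => by
        induction y using TensorProduct.induction_on with
        | zero => simp
        | tmul a b => simp
        | add y z hy hz => rw [add_mul, map_add, map_add, hy, hz, map_add, map_add, add_mul]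
      change TensorProduct.lid Z R (ψ.rTensor R (δ r)) = TensorProduct.lid Z R (1 ⊗ₜ r)
      -- Counitality is assumed only for the element x; moving r to the second leg by `hx` gives it
      -- at every r.
      rw [hδ, hx, h, hl, one_mul, TensorProduct.lid_tmul, one_smul]
    lTensor_counit_comp_comul := by
      refine LinearMap.ext fun r => (TensorProduct.rid Z R).injective ?_
      have h : ∀ y : R ⊗[Z] R, TensorProduct.rid Z R (ψ.lTensor R ((r ⊗ₜ[Z] (1 : R)) * y)) =
          r * TensorProduct.rid Z R (ψ.lTensor R y) := fun y => by
        induction y using TensorProduct.induction_on with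
        | zero => simp
        | tmul a b => simp
        | add y z hy hz => rw [mul_add, map_add, map_add, hy, hz, map_add, map_add, mul_add]
      change TensorProduct.rid Z R (ψ.lTensor R (δ r)) = TensorProduct.rid Z R (r ⊗ₜ 1)
      rw [hδ, h, hr, mul_one, TensorProduct.rid_tmul, one_smul]
    frobenius_left := by
      refine TensorProduct.ext' fun r r' => ?_
      have h : ∀ y : R ⊗[Z] R, (LinearMap.mul' Z R).lTensor R (TensorProduct.assoc Z R R R
          (y ⊗ₜ[Z] r')) = y * ((1 : R) ⊗ₜ[Z] r') := fun y => by
        induction y using TensorProduct.induction_on with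
        | zero => simp
        | tmul a b => simp
        | add y z hy hz => rw [TensorProduct.add_tmul, map_add, map_add, hy, hz, add_mul]
      change (LinearMap.mul' Z R).lTensor R (TensorProduct.assoc Z R R R (δ r ⊗ₜ[Z] r')) =
        δ (r * r')
      rw [h, hδ, hδ, mul_assoc, ← hx, ← mul_assoc, Algebra.TensorProduct.tmul_mul_tmul, one_mul]
    frobenius_right := by
      refine TensorProduct.ext' fun r r' => ?_
      have h : ∀ y : R ⊗[Z] R, (LinearMap.mul' Z R).rTensor R ((TensorProduct.assoc Z R R R).symm
          (r ⊗ₜ[Z] y)) = (r ⊗ₜ[Z] (1 : R)) * y := fun y => by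
        induction y using TensorProduct.induction_on with
        | zero => simp
        | tmul a b => simp
        | add y z hy hz => rw [TensorProduct.tmul_add, map_add, map_add, hy, hz, mul_add]
      change (LinearMap.mul' Z R).rTensor R ((TensorProduct.assoc Z R R R).symm (r ⊗ₜ[Z] δ r')) =
        δ (r * r')
      rw [h, hδ, hδ, ← mul_assoc, Algebra.TensorProduct.tmul_mul_tmul, one_mul]
    separable := by
      refine LinearMap.ext fun r => ?_
      have h : ∀ y : R ⊗[Z] R, LinearMap.mul' Z R ((r ⊗ₜ[Z] (1 : R)) * y) =
          r * LinearMap.mul' Z R y := fun y => by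
        induction y using TensorProduct.induction_on with
        | zero => simp
        | tmul a b => simp [mul_assoc]
        | add y z hy hz => rw [mul_add, map_add, hy, hz, map_add, mul_add]
      change LinearMap.mul' Z R (δ r) = r
      rw [hδ, h, hm, mul_one] }

lemma idem_ofIdem (x : R ⊗[Z] R) (ψ : R →ₗ[Z] Z) (hx hm hl hr) :
    (ofIdem x ψ hx hm hl hr).idem = x := by
  change ((1 : R) ⊗ₜ[Z] (1 : R)) * x = x
  exact one_mul x

end SeparabilityStructure

/-- Two morphisms out of any object agree if they agree after composition with morphisms from a
finite progenerator. -/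
lemma IsFiniteProgenerator.hom_ext {C : Type u} [Category.{v} C] [Preadditive C]
    [HasFiniteBiproducts C] {g : C} (hg : IsFiniteProgenerator g) {X Y : C} {f f' : X ⟶ Y}
    (h : ∀ x : g ⟶ X, x ≫ f = x ≫ f') : f = f' := by
  obtain ⟨n, ⟨i⟩⟩ := hg X
  have h' : i.r ≫ f = i.r ≫ f' := biproduct.hom_ext' _ _ fun k => by
    rw [← Category.assoc, ← Category.assoc]; exact h _
  rw [← Category.id_comp f, ← Category.id_comp f', ← i.retract, Category.assoc, h', Category.assoc]

/-- Central endomorphisms of a finite progenerator act on all objects. -/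
lemma IsFiniteProgenerator.exists_of_mem_center {C : Type u} [Category.{v} C] [Preadditive C]
    [HasFiniteBiproducts C] {g : C} (hg : IsFiniteProgenerator g) {c : End g}
    (hc : c ∈ Subring.center (End g)) (X : C) :
    ∃ z : X ⟶ X, ∀ x : g ⟶ X, x ≫ z = (c : g ⟶ g) ≫ x := by
  obtain ⟨n, ⟨i⟩⟩ := hg X
  -- Let c act on every summand of gⁿ and restrict to the retract X. Each component of x ≫ i is an
  -- endomorphism of g, so it commutes with the central c.
  refine ⟨i.i ≫ biproduct.map (fun _ => (c : g ⟶ g)) ≫ i.r, fun x => ?_⟩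
  have h : (x ≫ i.i) ≫ biproduct.map (fun _ => (c : g ⟶ g)) = (c : g ⟶ g) ≫ (x ≫ i.i) :=
    biproduct.hom_ext _ _ fun k => by
      rw [Category.assoc, biproduct.map_π, ← Category.assoc, Category.assoc (c : g ⟶ g)]
      exact Subring.mem_center_iff.1 hc (((x ≫ i.i) ≫ biproduct.π _ k : g ⟶ g) : End g) |>.symm
  rw [← Category.assoc, ← Category.assoc, h, Category.assoc, Category.assoc, i.retract,
    Category.comp_id]

namespace ConvRing

variable {C : Type u} [Category.{v} C] [MonoidalCategory C] [Preadditive C] [MonoidalPreadditive C]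
  {g : C} [ComonObj g]

lemma leftEnd_unit (z : End (𝟙_ C)) : leftEnd (𝟙_ C) z = z := by
  change (λ_ (𝟙_ C)).inv ≫ ((z : 𝟙_ C ⟶ 𝟙_ C) ▷ 𝟙_ C) ≫ (λ_ (𝟙_ C)).hom = z
  rw [unitors_equal, unitors_inv_equal, rightUnitor_naturality, Iso.inv_hom_id_assoc]

lemma rightEnd_unit (z : End (𝟙_ C)) : rightEnd (𝟙_ C) z = z := by
  change (ρ_ (𝟙_ C)).inv ≫ (𝟙_ C ◁ (z : 𝟙_ C ⟶ 𝟙_ C)) ≫ (ρ_ (𝟙_ C)).hom = z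
  rw [← unitors_equal, ← unitors_inv_equal, leftUnitor_naturality, Iso.inv_hom_id_assoc]

/-- Convolution with the counit followed by z is the action of z. Hence z ↦ ε ≫ z is the map Z → R
for which the bimodule structures over Z and over R are compatible. -/
lemma convLeft_counit_comp {b : C} (z : End (𝟙_ C)) (x : g ⟶ b) :
    convLeft (ε[g] ≫ (z : 𝟙_ C ⟶ 𝟙_ C)) x = x ≫ leftEnd b z := by
  rw [convLeft, convol_comp_left, counit_convol, Category.assoc, Category.assoc]; rfl

lemma convRight_counit_comp {b : C} (z : End (𝟙_ C)) (x : g ⟶ b) :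
    convRight x (ε[g] ≫ (z : 𝟙_ C ⟶ 𝟙_ C)) = x ≫ rightEnd b z := by
  rw [convRight, convol_comp_right, convol_counit, Category.assoc, Category.assoc]; rfl

instance : Algebra (End (𝟙_ C)) (ConvRing g) where
  smul z r := r.toHom ≫ (z : 𝟙_ C ⟶ 𝟙_ C)
  algebraMap :=
    { toFun := fun z => ε[g] ≫ (z : 𝟙_ C ⟶ 𝟙_ C)
      map_one' := Category.comp_id ε[g]
      map_mul' := fun z w => by
        refine Eq.trans ?_ (convLeft_counit_comp z (ε[g] ≫ (w : 𝟙_ C ⟶ 𝟙_ C))).symm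
        rw [leftEnd_unit]
        exact (Category.assoc ε[g] (w : 𝟙_ C ⟶ 𝟙_ C) (z : 𝟙_ C ⟶ 𝟙_ C)).symm
      map_zero' := (comp_zero : ε[g] ≫ (0 : 𝟙_ C ⟶ 𝟙_ C) = 0)
      map_add' := fun z w => Preadditive.comp_add _ _ _ _ _ _ }
  commutes' z r := by
    refine (convLeft_counit_comp z r.toHom).trans
      (Eq.trans ?_ (mul_def' r _).symm)
    refine Eq.trans ?_ (convRight_counit_comp z r.toHom).symm
    rw [leftEnd_unit, rightEnd_unit]
  smul_def' z r := by
    refine Eq.trans ?_ (convLeft_counit_comp z r.toHom).symm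
    rw [leftEnd_unit]; rfl

lemma s_algebraMap (z : End (𝟙_ C)) :
    (sourceTarget g).s (algebraMap (End (𝟙_ C)) (ConvRing g) z) = rightEnd g z :=
  (convRight_counit_comp z (𝟙 g)).trans (Category.id_comp _)

lemma t_algebraMap (z : End (𝟙_ C)) :
    (sourceTarget g).t (op (algebraMap (End (𝟙_ C)) (ConvRing g) z)) = leftEnd g z :=
  (convLeft_counit_comp z (𝟙 g)).trans (Category.id_comp _)

/-- The realization of a monoidal category defined by the structure of a comonoid on a
finite progenerator `g`. -/
def realization [HasFiniteBiproducts C] (hg : IsFiniteProgenerator g)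
    (h : ∀ a b : C, Function.Bijective (RBimod.homOf (mulMap g a b)))
    (sep : SeparabilityStructure (End (𝟙_ C)) (ConvRing g)) : Realization g where
  R := ConvRing g
  B := bialgebroid h
  sep := sep
  -- If z and w have the same image in R, they act equally on Hom(g,u), hence are equal because g
  -- generates.
  injective z w e := hg.hom_ext fun x => by
    have e' : convLeft (ε[g] ≫ (z : 𝟙_ C ⟶ 𝟙_ C)) x = convLeft (ε[g] ≫ (w : 𝟙_ C ⟶ 𝟙_ C)) x :=
      congrArg (fun r : ConvRing g => convLeft r.toHom x) e
    rw [convLeft_counit_comp, convLeft_counit_comp, leftEnd_unit, leftEnd_unit] at e'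
    exact e'
  s_central r := by
    constructor
    · intro hr
      -- The central endomorphism s(r) acts on u as some z. Evaluating at the counit gives ε ≫ z =
      -- s(r) ≫ ε = r, so r is the image of z.
      obtain ⟨z, hz⟩ := hg.exists_of_mem_center hr (𝟙_ C)
      refine ⟨z, (hz ε[g]).trans ?_⟩
      refine (convRight_id_comp r.toHom ε[g]).trans ?_
      rw [← convLeft_eq_convRight, convLeft_counit]; rfl
    · rintro ⟨z, rfl⟩
      refine Subring.mem_center_iff.2 fun f => ?_
      change f * (sourceTarget g).s _ = (sourceTarget g).s _ * f
      rw [s_algebraMap]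
      exact (rightEnd_naturality (f : g ⟶ g) z).symm
  t_central r := by
    constructor
    · intro hr
      obtain ⟨z, hz⟩ := hg.exists_of_mem_center hr (𝟙_ C)
      refine ⟨z, (hz ε[g]).trans ?_⟩
      refine (convLeft_id_comp r.toHom ε[g]).trans ?_
      rw [convLeft_eq_convRight, convRight_counit]; rfl
    · rintro ⟨z, rfl⟩
      refine Subring.mem_center_iff.2 fun f => ?_
      change f * (sourceTarget g).t _ = (sourceTarget g).t _ * f
      rw [t_algebraMap]
      exact (leftEnd_naturality (f : g ⟶ g) z).symm
  κ := (coreMonoidalHom h).toMonoidal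
  compat_left b z x := (convLeft_id_comp _ x).trans (convLeft_counit_comp z x)
  compat_right b z x := (convRight_id_comp _ x).trans (convRight_counit_comp z x)

end ConvRing

end

/-! ### From a split monoidal structure to a comonoid and the formula for δ. -/

section

open scoped ComonObj

variable {C : Type u} [Category.{v} C] [MonoidalCategory C] [Preadditive C] [MonoidalPreadditive C]
  {g : C}

namespace SplitMonoidal

open Realization (ztm)

/-- Additive maps on `Hom(g, a) ⊗_Z Hom(g, b)` agree if they agree on elements `x ⊗ y`. -/
lemma ztm_ext {a b : C} {M : Type v} [AddCommGroup M]
    {φ ψ : ((homFunctor g).obj a ⊗ (homFunctor g).obj b : RBimod.{v} (End (𝟙_ C))) →+ M}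
    (h : ∀ x y, φ (ztm a b x y) = ψ (ztm a b x y)) (w) : φ w = ψ w :=
  RBimod.tens_hom_ext (V := homBimod g a) (W := homBimod g b) h w

section

variable (S : SplitMonoidal (homFunctor g))

/-- The value of `μ` on elements. -/
def mulElt (a b : C) :
    ((homFunctor g).obj a ⊗ (homFunctor g).obj b : RBimod.{v} (End (𝟙_ C))) →+ (g ⟶ a ⊗ b) :=
  RBimod.homOf (S.μ a b)

/-- The Yoneda argument: x ⊗ y is the image of two identities, and μ is natural. So μ is convolution
for Δ = μ(1 ⊗ 1). -/
lemma mulElt_ztm {a b : C} (x : g ⟶ a) (y : g ⟶ b) :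
    S.mulElt a b (ztm a b x y) = S.mulElt g g (ztm g g (𝟙 g) (𝟙 g)) ≫ (x ⊗ₘ y) := by
  let _ := S.toLaxMonoidal
  have h := congrArg (fun f => RBimod.homOf f (ztm g g (𝟙 g) (𝟙 g)))
    (Functor.LaxMonoidal.μ_natural (homFunctor g) x y)
  refine Eq.trans ?_ h
  change S.mulElt a b (ztm a b x y) = S.mulElt a b (ztm a b (𝟙 g ≫ x) (𝟙 g ≫ y))
  rw [Category.id_comp, Category.id_comp]

/-- The image of `1` under the unit of the monoidal structure. -/
def counitElt : g ⟶ 𝟙_ C := RBimod.homOf S.ε (1 : End (𝟙_ C))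

/-- The comonoid structure of `g` defined by a monoidal structure on `Hom(g, -)`. -/
@[reducible] def comonObj : ComonObj g where
  comul := S.mulElt g g (ztm g g (𝟙 g) (𝟙 g))
  counit := S.counitElt
  counit_comul := by
    -- The left unit axiom evaluated at 1 ⊗ 1; the other comonoid axioms likewise come from
    -- evaluating at identities.
    have h : 𝟙 g = S.mulElt _ _ (ztm _ _ S.counitElt (𝟙 g)) ≫ (λ_ g).hom :=
      (one_smul (End (𝟙_ C)) (show homBimod g g from 𝟙 g)).symm.trans
        (congrArg (fun f => RBimod.homOf f (RBimod.tmul (V := RBimod.regular (End (𝟙_ C)))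
          (W := homBimod g g) (1 : End (𝟙_ C)) (𝟙 g))) (S.left_unitality g))
    rw [mulElt_ztm, tensorHom_id] at h
    exact ((Iso.comp_inv_eq _).2 h).symm.trans (Category.id_comp _)
  comul_counit := by
    have h : 𝟙 g = S.mulElt _ _ (ztm _ _ (𝟙 g) S.counitElt) ≫ (ρ_ g).hom :=
      (one_smul (End (𝟙_ C))ᵐᵒᵖ (show homBimod g g from 𝟙 g)).symm.trans
        (congrArg (fun f => RBimod.homOf f (RBimod.tmul (V := homBimod g g)
          (W := RBimod.regular (End (𝟙_ C))) (𝟙 g) (1 : End (𝟙_ C)))) (S.right_unitality g))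
    rw [mulElt_ztm, id_tensorHom] at h
    exact ((Iso.comp_inv_eq _).2 h).symm.trans (Category.id_comp _)
  comul_assoc := by
    have h : S.mulElt _ _ (ztm _ _ (S.mulElt g g (ztm g g (𝟙 g) (𝟙 g))) (𝟙 g)) ≫ (α_ g g g).hom =
        S.mulElt _ _ (ztm _ _ (𝟙 g) (S.mulElt g g (ztm g g (𝟙 g) (𝟙 g)))) :=
      congrArg (fun f => RBimod.homOf f (RBimod.tmul
        (V := RBimod.tensor (homBimod g g) (homBimod g g)) (W := homBimod g g)
        (ztm g g (𝟙 g) (𝟙 g)) (𝟙 g))) (S.associativity g g g)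
    rw [S.mulElt_ztm (S.mulElt g g _) (𝟙 g), S.mulElt_ztm (𝟙 g) (S.mulElt g g _), tensorHom_id,
      id_tensorHom, Category.assoc] at h
    exact h.symm

end

variable [ComonObj g] (S : SplitMonoidal (homFunctor g))

/-- For `x : g ⟶ a` and `y : g ⟶ b`, the map `e ⊗ f ↦ x · e ⊗ f · y`. -/
def insertMap {a b : C} (x : g ⟶ a) (y : g ⟶ b) :
    ((homFunctor g).obj (𝟙_ C) ⊗ (homFunctor g).obj (𝟙_ C) : RBimod.{v} (End (𝟙_ C))) →+
      ((homFunctor g).obj a ⊗ (homFunctor g).obj b : RBimod.{v} (End (𝟙_ C))) :=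
  RBimod.tensMap (V := homBimod g (𝟙_ C)) (W := homBimod g (𝟙_ C)) (V' := homBimod g a)
    (W' := homBimod g b) (convRightHom g a x)
    (fun z (r : g ⟶ 𝟙_ C) => by
      change convRight x (r ≫ rightEnd (𝟙_ C) z) = convRight x r ≫ rightEnd a z
      rw [← ConvRing.convRight_counit_comp, ← ConvRing.convRight_counit_comp, convRight_convRight])
    ((convLeftHom g b).flip y)
    (fun z (r : g ⟶ 𝟙_ C) => by
      change convLeft (r ≫ leftEnd (𝟙_ C) z) y = convLeft r y ≫ leftEnd b z
      rw [← ConvRing.convLeft_counit_comp, ← ConvRing.convLeft_counit_comp, convLeft_convLeft])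

lemma insertMap_ztm {a b : C} (x : g ⟶ a) (y : g ⟶ b) (e f : g ⟶ 𝟙_ C) :
    insertMap x y (ztm _ _ e f) = ztm _ _ (convRight x e) (convLeft f y) := rfl

/-- The element `δ(1)` of `Hom(g, u) ⊗_Z Hom(g, u)`. -/
def casimir : ((homFunctor g).obj (𝟙_ C) ⊗ (homFunctor g).obj (𝟙_ C) :
    RBimod.{v} (End (𝟙_ C))) :=
  RBimod.homOf (S.δ (𝟙_ C) (𝟙_ C)) (ε[g] ≫ (λ_ (𝟙_ C)).inv : g ⟶ 𝟙_ C ⊗ 𝟙_ C)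

/-- The value of `δ` on elements. -/
def comulElt (a b : C) : (g ⟶ a ⊗ b) →+
    ((homFunctor g).obj a ⊗ (homFunctor g).obj b : RBimod.{v} (End (𝟙_ C))) :=
  RBimod.homOf (S.δ a b)

/-- This is where μ ∘ δ = id enters; it becomes ∑ eᵢfᵢ = 1 in the convolution ring. -/
lemma mulElt_casimir : S.mulElt _ _ S.casimir = ε[g] ≫ (λ_ (𝟙_ C)).inv :=
  congrArg (fun f => RBimod.homOf f (ε[g] ≫ (λ_ (𝟙_ C)).inv)) (S.split (𝟙_ C) (𝟙_ C))

/-- The case x = ε of the formula for δ. The second compatibility at u, u, b is evaluated on the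
unit element tensored with y: one side multiplies the second leg of δ(1) into y, the other is δ of
the convolution up to unit constraints. -/
lemma comulElt_counit_convol
    (hμ : ∀ (a b : C) (x : g ⟶ a) (y : g ⟶ b), S.mulElt a b (ztm a b x y) = convol x y)
    {b : C} (y : g ⟶ b) :
    S.comulElt (𝟙_ C) b (convol ε[g] y) = insertMap ε[g] y S.casimir := by
  let _ := S.toOplaxMonoidal
  have h := congrArg (fun f => RBimod.homOf (f ≫ ((homFunctor g).obj (𝟙_ C) ◁
    (homFunctor g).map (λ_ b).hom)) (ztm (𝟙_ C ⊗ 𝟙_ C) b (ε[g] ≫ (λ_ (𝟙_ C)).inv) y))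
    (S.compat_right (𝟙_ C) (𝟙_ C) b)
  have hl : RBimod.homOf (((S.δ (𝟙_ C) (𝟙_ C) ▷ (homFunctor g).obj b) ≫ (α_ _ _ _).hom ≫
      ((homFunctor g).obj (𝟙_ C) ◁ S.μ (𝟙_ C) b)) ≫ ((homFunctor g).obj (𝟙_ C) ◁
        (homFunctor g).map (λ_ b).hom)) (ztm (𝟙_ C ⊗ 𝟙_ C) b (ε[g] ≫ (λ_ (𝟙_ C)).inv) y) =
      insertMap ε[g] y S.casimir := by
    refine ztm_ext (φ := (RBimod.homOf ((α_ ((homFunctor g).obj (𝟙_ C)) ((homFunctor g).obj (𝟙_ C))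
      ((homFunctor g).obj b)).hom ≫ ((homFunctor g).obj (𝟙_ C) ◁ S.μ (𝟙_ C) b) ≫
        ((homFunctor g).obj (𝟙_ C) ◁ (homFunctor g).map (λ_ b).hom))).comp
        ((RBimod.tmulHom (RBimod.tensor (homBimod g (𝟙_ C)) (homBimod g (𝟙_ C)))
          (homBimod g b)).flip y)) (ψ := insertMap ε[g] y) (fun e f => ?_) S.casimir
    rw [insertMap_ztm, convRight_counit_left]
    exact congrArg (fun q => ztm (𝟙_ C) b e (q ≫ (λ_ b).hom)) (hμ _ _ f y)
  have hr : RBimod.homOf ((S.μ (𝟙_ C ⊗ 𝟙_ C) b ≫ (homFunctor g).map (α_ (𝟙_ C) (𝟙_ C) b).hom ≫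
      S.δ (𝟙_ C) (𝟙_ C ⊗ b)) ≫ ((homFunctor g).obj (𝟙_ C) ◁ (homFunctor g).map (λ_ b).hom))
        (ztm (𝟙_ C ⊗ 𝟙_ C) b (ε[g] ≫ (λ_ (𝟙_ C)).inv) y) =
      S.comulElt (𝟙_ C) b (convol ε[g] y) := by
    rw [Category.assoc, Category.assoc, S.δ_natural_right]
    change S.comulElt (𝟙_ C) b (((S.mulElt _ _ (ztm _ _ (ε[g] ≫ (λ_ (𝟙_ C)).inv) y)) ≫
      (α_ _ _ _).hom) ≫ (𝟙_ C ◁ (λ_ b).hom)) = _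
    rw [hμ, convol_comp_left, Category.assoc, Category.assoc, triangle, ← unitors_equal,
      inv_hom_whiskerRight, Category.comp_id]
  exact hr.symm.trans (h.symm.trans hl)

/-- The key formula δ(x * y) = ∑ x·eᵢ ⊗ fᵢ·y. The first compatibility at a, u, b, evaluated on x ⊗
(ε * y), reduces it to the previous case by multiplying the first leg of δ(1) into x. -/
lemma comulElt_convol
    (hμ : ∀ (a b : C) (x : g ⟶ a) (y : g ⟶ b), S.mulElt a b (ztm a b x y) = convol x y)
    {a b : C} (x : g ⟶ a) (y : g ⟶ b) :
    S.comulElt a b (convol x y) = insertMap x y S.casimir := by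
  let _ := S.toOplaxMonoidal
  have h := congrArg (fun f => RBimod.homOf (f ≫ ((homFunctor g).map (ρ_ a).hom ▷
    (homFunctor g).obj b)) (ztm a (𝟙_ C ⊗ b) x (convol ε[g] y))) (S.compat_left a (𝟙_ C) b)
  have hl : RBimod.homOf ((((homFunctor g).obj a ◁ S.δ (𝟙_ C) b) ≫ (α_ _ _ _).inv ≫
      (S.μ a (𝟙_ C) ▷ (homFunctor g).obj b)) ≫ ((homFunctor g).map (ρ_ a).hom ▷
        (homFunctor g).obj b)) (ztm a (𝟙_ C ⊗ b) x (convol ε[g] y)) =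
      insertMap x y S.casimir := by
    have h1 := S.comulElt_counit_convol hμ y
    refine (congrArg (fun w => RBimod.homOf ((α_ ((homFunctor g).obj a) ((homFunctor g).obj (𝟙_ C))
      ((homFunctor g).obj b)).inv ≫ (S.μ a (𝟙_ C) ▷ (homFunctor g).obj b) ≫
        ((homFunctor g).map (ρ_ a).hom ▷ (homFunctor g).obj b))
        (RBimod.tmulHom (homBimod g a) (RBimod.tensor (homBimod g (𝟙_ C))
          (homBimod g b)) x w)) h1).trans ?_
    refine ztm_ext (φ := ((RBimod.homOf ((α_ ((homFunctor g).obj a) ((homFunctor g).obj (𝟙_ C))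
      ((homFunctor g).obj b)).inv ≫ (S.μ a (𝟙_ C) ▷ (homFunctor g).obj b) ≫
        ((homFunctor g).map (ρ_ a).hom ▷ (homFunctor g).obj b))).comp
        (RBimod.tmulHom (homBimod g a) (RBimod.tensor (homBimod g (𝟙_ C))
          (homBimod g b)) x)).comp (insertMap ε[g] y)) (ψ := insertMap x y)
          (fun e f => ?_) S.casimir
    have h2 : insertMap ε[g] y (ztm _ _ e f) = ztm _ _ e (convLeft f y) := by
      rw [insertMap_ztm, convRight_counit_left]
    refine (congrArg (fun w => RBimod.homOf ((α_ ((homFunctor g).obj a)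
      ((homFunctor g).obj (𝟙_ C)) ((homFunctor g).obj b)).inv ≫
        (S.μ a (𝟙_ C) ▷ (homFunctor g).obj b) ≫ ((homFunctor g).map (ρ_ a).hom ▷
          (homFunctor g).obj b)) (RBimod.tmulHom (homBimod g a) (RBimod.tensor
            (homBimod g (𝟙_ C)) (homBimod g b)) x w)) h2).trans ?_
    exact congrArg (fun q => ztm a b (q ≫ (ρ_ a).hom) (convLeft f y)) (hμ _ _ x e)
  have hr : RBimod.homOf ((S.μ a (𝟙_ C ⊗ b) ≫ (homFunctor g).map (α_ a (𝟙_ C) b).inv ≫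
      S.δ (a ⊗ 𝟙_ C) b) ≫ ((homFunctor g).map (ρ_ a).hom ▷ (homFunctor g).obj b))
        (ztm a (𝟙_ C ⊗ b) x (convol ε[g] y)) = S.comulElt a b (convol x y) := by
    rw [Category.assoc, Category.assoc, S.δ_natural_left]
    change S.comulElt a b (((S.mulElt _ _ (ztm _ _ x (convol ε[g] y))) ≫
      (α_ _ _ _).inv) ≫ ((ρ_ a).hom ▷ b)) = _
    rw [hμ, convol_assoc_inv, ← convol_comp_left]
    exact congrArg (fun q => S.comulElt a b (convol q y)) (convRight_counit x)
  exact hr.symm.trans (h.symm.trans hl)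

end SplitMonoidal

end

/-! ### The realization defined by a split monoidal structure. -/

section

open scoped ComonObj

variable {C : Type u} [Category.{v} C] [MonoidalCategory C] [Preadditive C] [MonoidalPreadditive C]
  {g : C} [ComonObj g]

namespace ConvRing

open Realization (ztm)

variable (g) in
/-- The map `(x, y) ↦ x ⊗ y` to `R ⊗_Z R` for the convolution ring `R`. -/
def tensorMk : ConvRing g →+ ConvRing g →+ ConvRing g ⊗[End (𝟙_ C)] ConvRing g :=
  AddMonoidHom.mk' (fun x => AddMonoidHom.mk' (fun y => x ⊗ₜ y)
      (fun y y' => TensorProduct.tmul_add x y y'))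
    (fun x x' => AddMonoidHom.ext fun y => TensorProduct.add_tmul x x' y)

/-- The identity map `Hom(g, u) ⊗_Z Hom(g, u) → R ⊗_Z R` for the convolution ring `R`. -/
def toTensor : ((_root_.homFunctor g).obj (𝟙_ C) ⊗ (_root_.homFunctor g).obj (𝟙_ C) :
    RBimod.{v} (End (𝟙_ C))) →+ ConvRing g ⊗[End (𝟙_ C)] ConvRing g :=
  RBimod.lift (V := _root_.homBimod g (𝟙_ C)) (W := _root_.homBimod g (𝟙_ C)) (tensorMk g)
    (fun (x : g ⟶ 𝟙_ C) z (y : g ⟶ 𝟙_ C) => by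
      change (show ConvRing g from x ≫ rightEnd (𝟙_ C) z) ⊗ₜ[End (𝟙_ C)] (show ConvRing g from y) =
        (show ConvRing g from x) ⊗ₜ[End (𝟙_ C)] (show ConvRing g from y ≫ leftEnd (𝟙_ C) z)
      rw [rightEnd_unit, leftEnd_unit]
      exact TensorProduct.smul_tmul z (show ConvRing g from x) (show ConvRing g from y))

lemma toTensor_ztm (x y : g ⟶ 𝟙_ C) :
    toTensor (ztm _ _ x y) = (show ConvRing g from x) ⊗ₜ[End (𝟙_ C)] (show ConvRing g from y) := rfl

/-- Multiplication by r on the outer side of a leg is insertion next to r, so r·δ(1) and δ(1)·r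
become values of δ at r * ε and ε * r. -/
lemma tmul_one_mul_toTensor (r : ConvRing g) (w) :
    (r ⊗ₜ[End (𝟙_ C)] (1 : ConvRing g)) * toTensor w =
      toTensor (SplitMonoidal.insertMap r.toHom ε[g] w) :=
  SplitMonoidal.ztm_ext (φ := (AddMonoidHom.mulLeft (r ⊗ₜ[End (𝟙_ C)] (1 : ConvRing g))).comp toTensor)
    (ψ := toTensor.comp (SplitMonoidal.insertMap r.toHom ε[g])) (fun x y => by
      change (r ⊗ₜ[End (𝟙_ C)] (1 : ConvRing g)) * toTensor (ztm _ _ x y) =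
        toTensor (ztm _ _ (convRight r.toHom x) (convLeft y ε[g]))
      rw [toTensor_ztm, toTensor_ztm, Algebra.TensorProduct.tmul_mul_tmul, one_mul,
        convLeft_counit_right, mul_def']
      rfl) w

lemma toTensor_mul_one_tmul (r : ConvRing g) (w) :
    toTensor w * ((1 : ConvRing g) ⊗ₜ[End (𝟙_ C)] r) =
      toTensor (SplitMonoidal.insertMap ε[g] r.toHom w) :=
  SplitMonoidal.ztm_ext (φ := (AddMonoidHom.mulRight ((1 : ConvRing g) ⊗ₜ[End (𝟙_ C)] r)).comp toTensor)
    (ψ := toTensor.comp (SplitMonoidal.insertMap ε[g] r.toHom)) (fun x y => by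
      change toTensor (ztm _ _ x y) * ((1 : ConvRing g) ⊗ₜ[End (𝟙_ C)] r) =
        toTensor (ztm _ _ (convRight ε[g] x) (convLeft y r.toHom))
      rw [toTensor_ztm, toTensor_ztm, Algebra.TensorProduct.tmul_mul_tmul, mul_one,
        convRight_counit_left, mul_def]
      rfl) w

/-- The element `x ⊗ y` of `Hom(g, a) ⊗_R Hom(g, b)` for the convolution ring `R`. -/
def rtm {a b : C} (x : g ⟶ a) (y : g ⟶ b) :
    (homBimod g a ⊗ homBimod g b : RBimod.{v} (ConvRing g)) :=
  RBimod.tmul (V := homBimod g a) (W := homBimod g b) x y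

lemma rtm_balanced {a b : C} (x : g ⟶ a) (r : g ⟶ 𝟙_ C) (y : g ⟶ b) :
    rtm (convRight x r) y = rtm x (convLeft r y) :=
  (congrArg (fun q => rtm q y) (op_smul_def (show ConvRing g from r) x)).symm.trans
    ((RBimod.balanced (V := homBimod g a) (W := homBimod g b) x (show ConvRing g from r) y).trans
      (congrArg (fun q => rtm x q) (smul_def (show ConvRing g from r) y)))

end ConvRing

namespace SplitMonoidal

open Realization (ztm)

variable (S : SplitMonoidal (homFunctor g))

/-- The counit of a split monoidal structure as a linear map. -/
def counitLin : ConvRing g →ₗ[End (𝟙_ C)] End (𝟙_ C) where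
  toFun := RBimod.homOf S.η
  map_add' := map_add (RBimod.homOf S.η)
  map_smul' z r := by
    refine Eq.trans ?_ (RBimod.homOf_smul S.η z (show homBimod g (𝟙_ C) from r))
    change RBimod.homOf S.η (r.toHom ≫ (z : 𝟙_ C ⟶ 𝟙_ C)) =
      RBimod.homOf S.η (r.toHom ≫ leftEnd (𝟙_ C) z)
    rw [ConvRing.leftEnd_unit]

/-- The element `δ(1)` of `R ⊗_Z R` for the convolution ring `R`. -/
def idemElt : ConvRing g ⊗[End (𝟙_ C)] ConvRing g := ConvRing.toTensor S.casimir

/-- The left counit axiom of δ at u, evaluated at the counit of g, which is the unit of R. -/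
lemma lid_idemElt : TensorProduct.lid (End (𝟙_ C)) (ConvRing g)
    (S.counitLin.rTensor (ConvRing g) S.idemElt) = 1 := by
  have h := congrArg (fun f => RBimod.homOf (f ≫ (λ_ ((homFunctor g).obj (𝟙_ C))).hom)
    (show homBimod g (𝟙_ C) from ε[g]))
    (S.oplax_left_unitality (𝟙_ C))
  refine (ztm_ext (φ := (((TensorProduct.lid (End (𝟙_ C)) (ConvRing g)).toLinearMap ∘ₗ
      S.counitLin.rTensor (ConvRing g)).toAddMonoidHom).comp ConvRing.toTensor)
    (ψ := RBimod.homOf ((S.η ▷ (homFunctor g).obj (𝟙_ C)) ≫ (λ_ _).hom)) (fun x y => ?_)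
    S.casimir).trans (h.symm.trans ?_)
  · change (show ConvRing g from y).toHom ≫ (RBimod.homOf S.η x : 𝟙_ C ⟶ 𝟙_ C) =
      y ≫ leftEnd (𝟙_ C) (RBimod.homOf S.η x)
    rw [ConvRing.leftEnd_unit]; rfl
  · exact congrArg (fun f => RBimod.homOf f (show homBimod g (𝟙_ C) from ε[g])) (Iso.inv_hom_id _)

lemma rid_idemElt : TensorProduct.rid (End (𝟙_ C)) (ConvRing g)
    (S.counitLin.lTensor (ConvRing g) S.idemElt) = 1 := by
  have h := congrArg (fun f => RBimod.homOf (f ≫ (ρ_ ((homFunctor g).obj (𝟙_ C))).hom)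
    (show homBimod g (𝟙_ C) from ε[g]))
    (S.oplax_right_unitality (𝟙_ C))
  refine (ztm_ext (φ := (((TensorProduct.rid (End (𝟙_ C)) (ConvRing g)).toLinearMap ∘ₗ
      S.counitLin.lTensor (ConvRing g)).toAddMonoidHom).comp ConvRing.toTensor)
    (ψ := RBimod.homOf (((homFunctor g).obj (𝟙_ C) ◁ S.η) ≫ (ρ_ _).hom)) (fun x y => ?_)
    S.casimir).trans (Eq.trans ?_ (h.symm.trans ?_))
  · change (show ConvRing g from x).toHom ≫ (RBimod.homOf S.η y : 𝟙_ C ⟶ 𝟙_ C) =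
      x ≫ rightEnd (𝟙_ C) (RBimod.homOf S.η y)
    rw [ConvRing.rightEnd_unit]; rfl
  · change _ = RBimod.homOf (((homFunctor g).obj (𝟙_ C) ◁ S.η) ≫ (ρ_ _).hom)
      (RBimod.homOf (S.δ (𝟙_ C) (𝟙_ C)) (ε[g] ≫ (ρ_ (𝟙_ C)).inv : g ⟶ 𝟙_ C ⊗ 𝟙_ C))
    -- The element δ(1) was defined with the left unit constraint, while this axiom produces the
    -- right one; they agree on u.
    rw [← unitors_inv_equal]
    rfl
  · exact congrArg (fun f => RBimod.homOf f (show homBimod g (𝟙_ C) from ε[g])) (Iso.inv_hom_id _)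

/-- Multiplication in R is μ at u, u followed by the unit constraint, so the splitting of μ can be
used to compute ∑ eᵢfᵢ. -/
lemma mul'_toTensor
    (hμ : ∀ (a b : C) (x : g ⟶ a) (y : g ⟶ b), S.mulElt a b (ztm a b x y) = convol x y) (w) :
    LinearMap.mul' (End (𝟙_ C)) (ConvRing g) (ConvRing.toTensor w) =
      (S.mulElt _ _ w ≫ (λ_ (𝟙_ C)).hom : g ⟶ 𝟙_ C) :=
  ztm_ext (M := g ⟶ 𝟙_ C)
    (φ := (LinearMap.mul' (End (𝟙_ C)) (ConvRing g)).toAddMonoidHom.comp ConvRing.toTensor)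
    (ψ := (AddMonoidHom.mk' (fun f : g ⟶ 𝟙_ C ⊗ 𝟙_ C => f ≫ (λ_ (𝟙_ C)).hom)
      (fun _ _ => Preadditive.add_comp _ _ _ _ _ _)).comp (S.mulElt _ _))
    (fun x y => by
      change LinearMap.mul' (End (𝟙_ C)) (ConvRing g) (ConvRing.toTensor (ztm _ _ x y)) =
        S.mulElt _ _ (ztm _ _ x y) ≫ (λ_ (𝟙_ C)).hom
      rw [hμ]; rfl) w

/-- The separability structure on the convolution ring. -/
def separability
    (hμ : ∀ (a b : C) (x : g ⟶ a) (y : g ⟶ b), S.mulElt a b (ztm a b x y) = convol x y) :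
    SeparabilityStructure (End (𝟙_ C)) (ConvRing g) :=
  .ofIdem S.idemElt S.counitLin
    (fun r => by
      -- By the formula for δ, both sides are δ of r followed by the inverse unit constraint of u ⊗
      -- u.
      rw [idemElt, ConvRing.tmul_one_mul_toTensor, ConvRing.toTensor_mul_one_tmul,
        ← S.comulElt_convol hμ, ← S.comulElt_convol hμ, convol_counit, counit_convol,
        unitors_inv_equal])
    (by
      rw [idemElt, S.mul'_toTensor hμ, mulElt_casimir, Category.assoc, Iso.inv_hom_id,
        Category.comp_id]
      rfl)
    S.lid_idemElt S.rid_idemElt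

lemma idem_separability
    (hμ : ∀ (a b : C) (x : g ⟶ a) (y : g ⟶ b), S.mulElt a b (ztm a b x y) = convol x y) :
    (S.separability hμ).idem = ConvRing.toTensor S.casimir :=
  SeparabilityStructure.idem_ofIdem ..

/-- The canonical map `Hom(g, a) ⊗_Z Hom(g, b) → Hom(g, a) ⊗_R Hom(g, b)` for the convolution
ring `R`. -/
def canonElt (a b : C) : ((homFunctor g).obj a ⊗ (homFunctor g).obj b :
    RBimod.{v} (End (𝟙_ C))) →+
    (ConvRing.homBimod g a ⊗ ConvRing.homBimod g b : RBimod.{v} (ConvRing g)) :=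
  RBimod.lift (V := homBimod g a) (W := homBimod g b)
    (RBimod.tmulHom (ConvRing.homBimod g a) (ConvRing.homBimod g b))
    (fun x z y => (congrArg (fun q => ConvRing.rtm q y)
        (ConvRing.convRight_counit_comp z (show g ⟶ a from x))).symm.trans
      ((ConvRing.rtm_balanced _ _ _).trans
        (congrArg (fun q => ConvRing.rtm x q) (ConvRing.convLeft_counit_comp z _))))

lemma mulMap_canonElt
    (hμ : ∀ (a b : C) (x : g ⟶ a) (y : g ⟶ b), S.mulElt a b (ztm a b x y) = convol x y)
    {a b : C} (w) : RBimod.homOf (ConvRing.mulMap g a b) (canonElt a b w) = S.mulElt a b w :=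
  ztm_ext (φ := (RBimod.homOf (ConvRing.mulMap g a b)).comp (canonElt a b)) (ψ := S.mulElt a b)
    (fun x y => (hμ a b x y).symm) w

/-- Over R the first leg moves across the tensor sign and multiplies the second, so only the product
of the legs is left. -/
lemma canonElt_insertMap
    (hμ : ∀ (a b : C) (x : g ⟶ a) (y : g ⟶ b), S.mulElt a b (ztm a b x y) = convol x y)
    {a b : C} (x : g ⟶ a) (y : g ⟶ b) (w) :
    canonElt a b (insertMap x y w) =
      ConvRing.rtm x (convLeft (S.mulElt _ _ w ≫ (λ_ (𝟙_ C)).hom) y) :=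
  ztm_ext (φ := (canonElt a b).comp (insertMap x y))
    (ψ := AddMonoidHom.comp
      (RBimod.tmulHom (ConvRing.homBimod g a) (ConvRing.homBimod g b) x)
      (((convLeftHom g b).flip y).comp ((AddMonoidHom.mk' (fun f : g ⟶ 𝟙_ C ⊗ 𝟙_ C =>
        f ≫ (λ_ (𝟙_ C)).hom) (fun _ _ => Preadditive.add_comp _ _ _ _ _ _)).comp
          (S.mulElt _ _))))
    (fun e f => (ConvRing.rtm_balanced x e (convLeft f y)).trans
      (congrArg (ConvRing.rtm x) ((convLeft_convLeft _ _ _).symm.trans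
        (congrArg (fun q => convLeft (q ≫ (λ_ (𝟙_ C)).hom) y) (hμ _ _ e f).symm)))) w

/-- The inverse is δ followed by the projection to ⊗_R. One composite is ∑ x·eᵢ ⊗_R fᵢ·y = x ⊗_R y
because ∑ eᵢfᵢ = 1; the other is the splitting of μ by δ. -/
lemma mulMap_bijective
    (hμ : ∀ (a b : C) (x : g ⟶ a) (y : g ⟶ b), S.mulElt a b (ztm a b x y) = convol x y)
    (a b : C) : Function.Bijective (RBimod.homOf (ConvRing.mulMap g a b)) := by
  refine Function.bijective_iff_has_inverse.2 ⟨fun f => canonElt a b (S.comulElt a b f),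
    fun w => ?_, fun f => ?_⟩
  · refine RBimod.tens_hom_ext (V := ConvRing.homBimod g a) (W := ConvRing.homBimod g b)
      (f := ((canonElt a b).comp (S.comulElt a b)).comp (RBimod.homOf (ConvRing.mulMap g a b)))
      (g := .id _) (fun (x : g ⟶ a) (y : g ⟶ b) => ?_) w
    change canonElt a b (S.comulElt a b (convol x y)) = ConvRing.rtm x y
    rw [S.comulElt_convol hμ, S.canonElt_insertMap hμ, mulElt_casimir, Category.assoc,
      Iso.inv_hom_id, Category.comp_id, convLeft_counit]
  · refine (S.mulMap_canonElt hμ _).trans ?_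
    exact congrArg (fun k => RBimod.homOf k (show homBimod g (a ⊗ b) from f)) (S.split a b)

variable [HasFiniteBiproducts C]

/-- The realization defined by a split monoidal structure. -/
def realization (hg : IsFiniteProgenerator g)
    (hμ : ∀ (a b : C) (x : g ⟶ a) (y : g ⟶ b), S.mulElt a b (ztm a b x y) = convol x y) :
    Realization g :=
  ConvRing.realization hg (S.mulMap_bijective hμ) (S.separability hμ)

lemma insert_toTensor (hg : IsFiniteProgenerator g)
    (hμ : ∀ (a b : C) (x : g ⟶ a) (y : g ⟶ b), S.mulElt a b (ztm a b x y) = convol x y)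
    {a b : C} (x : g ⟶ a) (y : g ⟶ b) (w) :
    (S.realization hg hμ).insert x y (ConvRing.toTensor w) = insertMap x y w :=
  ztm_ext (φ := ((S.realization hg hμ).insert x y).comp ConvRing.toTensor) (ψ := insertMap x y)
    (fun e f => by
      change ztm a b (convRight (𝟙 g) e ≫ x) (convLeft f (𝟙 g) ≫ y) = _
      rw [convRight_id_comp, convLeft_id_comp]; rfl) w

lemma realization_induces (hg : IsFiniteProgenerator g)
    (hμ : ∀ (a b : C) (x : g ⟶ a) (y : g ⟶ b), S.mulElt a b (ztm a b x y) = convol x y)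
    (hε : S.counitElt = ε[g]) : (S.realization hg hμ).Induces S := by
  refine ((S.realization hg hμ).induces_iff S).2 ⟨hμ, fun z => ?_, fun a b x y => ?_, fun r => rfl⟩
  · change _ = ε[g] ≫ (z : 𝟙_ C ⟶ 𝟙_ C)
    rw [← hε]
    -- The unit map is Z-linear, so its value at 1 determines it.
    have h : RBimod.homOf S.ε (z * 1 : End (𝟙_ C)) = S.counitElt ≫ leftEnd (𝟙_ C) z :=
      RBimod.homOf_smul S.ε z (1 : End (𝟙_ C))
    rwa [mul_one, ConvRing.leftEnd_unit] at h
  · refine (S.comulElt_convol hμ x y).trans ((S.insert_toTensor hg hμ x y S.casimir).symm.trans ?_)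
    exact congrArg ((S.realization hg hμ).insert x y) (S.idem_separability hμ).symm

end SplitMonoidal

/-- The preceding results hold for any comonoid structure on g whose convolution is μ. Here it is
the structure extracted from S, for which this is the Yoneda identity. -/
lemma exists_induces {C : Type u} [Category.{v} C] [MonoidalCategory C] [Preadditive C]
    [MonoidalPreadditive C] [HasFiniteBiproducts C] {g : C} (hg : IsFiniteProgenerator g)
    (S : SplitMonoidal (homFunctor g)) : ∃ P : Realization g, P.Induces S :=
  let _ := S.comonObj
  ⟨S.realization hg fun _ _ x y => S.mulElt_ztm x y,
    S.realization_induces hg (fun _ _ x y => S.mulElt_ztm x y) rfl⟩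

end

/-! ### Strong monoidal functors into full monoidal subcategories. -/

namespace CategoryTheory.ObjectProperty

open Functor.LaxMonoidal

variable {C D : Type*} [Category C] [MonoidalCategory C] [Category D] [MonoidalCategory D]
  (P : ObjectProperty D) [P.IsMonoidal] (F : C ⥤ D) [F.Monoidal] (hF : ∀ X, P (F.obj X))

/-- The lift of a strong monoidal functor to a full monoidal subcategory is strong monoidal. -/
def liftCoreMonoidal : (P.lift F hF).CoreMonoidal where
  εIso := P.isoMk (X := 𝟙_ P.FullSubcategory) (Y := (P.lift F hF).obj (𝟙_ C)) (Functor.Monoidal.εIso F)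
  μIso X Y := P.isoMk (X := (P.lift F hF).obj X ⊗ (P.lift F hF).obj Y)
    (Y := (P.lift F hF).obj (X ⊗ Y)) (Functor.Monoidal.μIso F X Y)
  μIso_hom_natural_left f X' := P.hom_ext (μ_natural_left F f X')
  μIso_hom_natural_right X' f := P.hom_ext (μ_natural_right F X' f)
  associativity X Y Z := P.hom_ext (associativity F X Y Z)
  left_unitality X := P.hom_ext (left_unitality F X)
  right_unitality X := P.hom_ext (right_unitality F X)

/-- All components of the isomorphism are identities, and the structure maps of the lift are those
of `F`. -/
lemma isMonoidal_liftCompιIso :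
    let _ : (P.lift F hF).Monoidal := (P.liftCoreMonoidal F hF).toMonoidal
    NatTrans.IsMonoidal (P.liftCompιIso F hF).hom :=
  let _ : (P.lift F hF).Monoidal := (P.liftCoreMonoidal F hF).toMonoidal
  { unit := (Category.comp_id _).trans (Category.id_comp _)
    tensor := fun X Y => by
      refine (Category.comp_id _).trans ((Category.id_comp _).trans ?_)
      refine Eq.trans ?_ (congrArg (· ≫ μ F X Y) (id_tensorHom_id (F.obj X) (F.obj Y)).symm)
      exact (Category.id_comp _).symm }

end CategoryTheory.ObjectProperty

/-! ### Full faithfulness of Hom(g,-) and its essential image. -/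

section FullyFaithful

variable {C : Type u} [Category.{v} C] [Preadditive C] [HasFiniteBiproducts C] {g : C}

/-- For a finite progenerator `g`, linear maps `Hom(g, X) → Hom(g, Y)` are compositions with
morphisms `X ⟶ Y`. -/
lemma IsFiniteProgenerator.exists_comp_eq (hg : IsFiniteProgenerator g) {X Y : C}
    (φ : (g ⟶ X) →ₗ[(End g)ᵐᵒᵖ] (g ⟶ Y)) : ∃ f : X ⟶ Y, ∀ x, x ≫ f = φ x := by
  obtain ⟨n, ⟨i⟩⟩ := hg X
  -- The maps g → gⁿ → X given by the inclusions generate Hom(g,X) over A; f is built from the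
  -- values of φ on these generators.
  refine ⟨i.i ≫ biproduct.desc fun k => φ (biproduct.ι (fun _ : Fin n => g) k ≫ i.r), fun x => ?_⟩
  have h : ∀ (c : g ⟶ g) (y : g ⟶ X), φ (c ≫ y) = c ≫ φ y := fun c y => φ.map_smul (op c) y
  have hx : x = ∑ k, (x ≫ i.i ≫ biproduct.π _ k) ≫ biproduct.ι (fun _ : Fin n => g) k ≫ i.r := by
    have e : x = (x ≫ i.i) ≫ 𝟙 _ ≫ i.r := by
      rw [Category.id_comp, Category.assoc, i.retract, Category.comp_id]
    rw [← biproduct.total, Preadditive.sum_comp, Preadditive.comp_sum] at e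
    exact e.trans (Finset.sum_congr rfl fun k _ => by simp only [Category.assoc])
  conv_rhs => rw [hx, map_sum]
  rw [biproduct.desc_eq, Preadditive.comp_sum, Preadditive.comp_sum]
  exact Finset.sum_congr rfl fun k _ => by rw [h]; simp only [Category.assoc]

/-- `Hom(g, gⁿ) = Aⁿ` for `A = End g`. -/
def homBiproductEquiv (g : C) (n : ℕ) :
    (g ⟶ ⨁ fun _ : Fin n => g) ≃ₗ[(End g)ᵐᵒᵖ] (Fin n → (End g)ᵐᵒᵖ) where
  toFun x k := op (x ≫ biproduct.π _ k : g ⟶ g)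
  invFun c := biproduct.lift fun k => (unop (c k) : g ⟶ g)
  map_add' x y := funext fun _ => congrArg op (Preadditive.add_comp _ _ _ x y _)
  map_smul' a x := funext fun _ => congrArg op (Category.assoc (unop a : g ⟶ g) x _)
  left_inv _ := biproduct.hom_ext _ _ fun _ => biproduct.lift_π _ _
  right_inv _ := funext fun _ => congrArg op (biproduct.lift_π _ _)

end FullyFaithful

namespace Bialgebroid

section

variable {R A : Type v} [Ring R] [Ring A] (B : Bialgebroid R A)

lemma fgp_of_retract {V W : B.RMod} (r : Retract V W) (h : B.fgp W) : B.fgp V :=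
  have e : ∀ x, B.asLin r.r (B.asLin r.i x) = x := B.asLin_asLin r.retract
  have := h.1
  have := h.2
  ⟨Module.Finite.of_surjective (B.asLin r.r) fun x => ⟨_, e x⟩,
    Module.Projective.of_split (B.asLin r.i) (B.asLin r.r) (LinearMap.ext e)⟩

end

variable {C : Type u} [Category.{v} C] [Preadditive C] {g : C} {R : Type v} [Ring R]
  (B : Bialgebroid R (End g)) [HasFiniteBiproducts C]

lemma fgp_hom_biproduct (n : ℕ) : B.fgp (B.hom.obj (⨁ fun _ : Fin n => g)) :=
  ⟨Module.Finite.equiv (homBiproductEquiv g n).symm,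
    Module.Projective.of_equiv (homBiproductEquiv g n).symm⟩

lemma fgp_hom_obj (hg : IsFiniteProgenerator g) (X : C) : B.fgp (B.hom.obj X) :=
  let ⟨n, ⟨i⟩⟩ := hg X
  B.fgp_of_retract (i.map B.hom) (B.fgp_hom_biproduct n)

/-- A finite projective module is a direct summand of some Aⁿ, and Aⁿ is Hom(g, gⁿ). -/
lemma exists_retract {V : B.RMod} (h : B.fgp V) :
    ∃ n : ℕ, Nonempty (Retract V (B.hom.obj (⨁ fun _ : Fin n => g))) := by
  have := h.1
  have := h.2
  obtain ⟨n, f, hf⟩ := Module.Finite.exists_fin' (End g)ᵐᵒᵖ (B.asModule V)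
  obtain ⟨s, hs⟩ := Module.projective_lifting_property f LinearMap.id hf
  exact ⟨n, ⟨{
    i := B.ofLin (V := V) (W := B.hom.obj (⨁ fun _ : Fin n => g))
      ((homBiproductEquiv g n).symm.toLinearMap ∘ₗ s)
    r := B.ofLin (V := B.hom.obj (⨁ fun _ : Fin n => g)) (W := V)
      (f ∘ₗ (homBiproductEquiv g n).toLinearMap)
    retract := ModuleCat.hom_ext (M := B.asModule V) (N := B.asModule V) <| LinearMap.ext fun x =>
      (congrArg f ((homBiproductEquiv g n).apply_symm_apply (s x))).trans (LinearMap.congr_fun hs x) }⟩⟩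

lemma full_hom (hg : IsFiniteProgenerator g) : B.hom.Full where
  map_surjective {X Y} φ :=
    let ⟨f, hf⟩ := hg.exists_comp_eq (B.asLin φ)
    ⟨f, ModuleCat.hom_ext (M := B.asModule (B.hom.obj X)) (N := B.asModule (B.hom.obj Y))
      (LinearMap.ext hf)⟩

lemma faithful_hom (hg : IsFiniteProgenerator g) : B.hom.Faithful where
  map_injective {X _ _ _} e := hg.hom_ext fun x =>
    congrArg (fun k => B.asLin k (show B.asModule (B.hom.obj X) from x)) e

/-- The idempotent of Hom(g, gⁿ) with image V lifts to an idempotent of gⁿ by full faithfulness. The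
object that splits it has image isomorphic to V. -/
lemma exists_iso_hom_obj [IsIdempotentComplete C] (hg : IsFiniteProgenerator g) {V : B.RMod}
    (h : B.fgp V) : ∃ X : C, Nonempty (B.hom.obj X ≅ V) := by
  have := B.full_hom hg
  have := B.faithful_hom hg
  obtain ⟨n, ⟨r⟩⟩ := B.exists_retract h
  obtain ⟨p, hp⟩ := B.hom.map_surjective (r.r ≫ r.i)
  obtain ⟨X, i, q, h1, h2⟩ := IsIdempotentComplete.idempotents_split _ p (B.hom.map_injective (by
    rw [Functor.map_comp, hp, Category.assoc, r.retract_assoc]))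
  refine ⟨X, ⟨⟨B.hom.map i ≫ r.r, r.i ≫ B.hom.map q, ?_, ?_⟩⟩⟩
  · rw [Category.assoc, ← Category.assoc r.r, ← hp, ← B.hom.map_comp, ← B.hom.map_comp, ← h2,
      Category.assoc, h1, Category.comp_id, h1, CategoryTheory.Functor.map_id]
  · rw [Category.assoc, ← B.hom.map_comp_assoc, h2, hp, Category.assoc, r.retract_assoc, r.retract]

/-- Since Hom(g,-) is strong monoidal, a tensor product of retracts of Hom(g, gⁿ) and Hom(g, gᵐ) is
a retract of Hom(g, gⁿ ⊗ gᵐ), which is again finite projective. The unit is isomorphic to Hom(g,u).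
-/
lemma fgp_isMonoidal [MonoidalCategory C] [B.hom.Monoidal] (hg : IsFiniteProgenerator g) :
    B.fgp.IsMonoidal where
  prop_unit := B.fgp_of_retract (Retract.ofIso (Functor.Monoidal.εIso B.hom)) (B.fgp_hom_obj hg _)
  prop_tensor V W hV hW := by
    obtain ⟨n, ⟨r⟩⟩ := B.exists_retract hV
    obtain ⟨m, ⟨r'⟩⟩ := B.exists_retract hW
    let t : Retract (V ⊗ W) (B.hom.obj (⨁ fun _ : Fin n => g) ⊗ B.hom.obj (⨁ fun _ : Fin m => g)) :=
      { i := r.i ⊗ₘ r'.i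
        r := r.r ⊗ₘ r'.r
        retract := by rw [tensorHom_comp_tensorHom, r.retract, r'.retract, id_tensorHom_id] }
    exact B.fgp_of_retract (t.trans (Retract.ofIso (Functor.Monoidal.μIso B.hom _ _)))
      (B.fgp_hom_obj hg _)

lemma isEquivalence_lift_hom [IsIdempotentComplete C] (hg : IsFiniteProgenerator g) :
    (B.fgp.lift B.hom (B.fgp_hom_obj hg)).IsEquivalence :=
  have := B.full_hom hg
  have := B.faithful_hom hg
  { essSurj := ⟨fun V =>
      let ⟨X, ⟨e⟩⟩ := B.exists_iso_hom_obj hg V.property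
      ⟨X, ⟨B.fgp.isoMk e⟩⟩⟩ }

end Bialgebroid

/-! ### The bijection and the monoidal equivalence. -/

section

variable {C : Type u} [Category.{v} C] [MonoidalCategory C] [Preadditive C]
  [MonoidalPreadditive C] {g : C}

namespace Realization

/-- The split monoidal structure induced by a realization. -/
def split (P : Realization g) : SplitMonoidal (homFunctor g) := P.existsUnique_induces.choose

lemma induces_split (P : Realization g) : P.Induces P.split :=
  P.existsUnique_induces.choose_spec.1

lemma split_eq_iff {P : Realization g} {S : SplitMonoidal (homFunctor g)} :
    P.split = S ↔ P.Induces S :=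
  ⟨fun h => h ▸ P.induces_split, fun h => P.existsUnique_induces.unique P.induces_split h⟩

variable [HasFiniteBiproducts C]

/-- Isomorphism classes of realizations correspond to split monoidal structures. -/
def quotEquiv (hg : IsFiniteProgenerator g) :
    Quot (fun P Q : Realization g => Nonempty (P.Iso Q)) ≃ SplitMonoidal (homFunctor g) :=
  Equiv.ofBijective
    -- Isomorphic realizations induce the same structure, so the map descends to classes.
    -- Injectivity is `nonempty_iso` and surjectivity is `exists_induces`.
    (Quot.lift split fun P Q ⟨i⟩ => (split_eq_iff.2 (i.induces P.induces_split)).symm)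
    ⟨by
      rintro ⟨P⟩ ⟨Q⟩ h
      exact Quot.sound (nonempty_iso P.induces_split (split_eq_iff.1 (Eq.symm h))), fun S =>
      let ⟨P, hP⟩ := exists_induces hg S
      ⟨Quot.mk _ P, split_eq_iff.2 hP⟩⟩

/-- The equivalence is Hom(g,-) with its codomain restricted to finite projective modules. Its
comparison with Hom(g,-) is a monoidal isomorphism, so the structure of S is respected through
`P.compIso`. -/
lemma exists_equivalence [IsIdempotentComplete C] (hg : IsFiniteProgenerator g)
    (P : Realization g) {S : SplitMonoidal (homFunctor g)} (hS : P.Induces S) :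
    ∃ (_ : P.B.fgp.IsMonoidal) (E : C ⥤ P.B.fgp.FullSubcategory) (_ : E.Monoidal)
      (i : E ⋙ P.B.fgp.ι ≅ P.B.hom),
      E.IsEquivalence ∧ NatTrans.IsMonoidal i.hom ∧
      S.Respects (F := (E ⋙ P.B.fgp.ι) ⋙ P.forgetZ)
        (Functor.isoWhiskerRight i P.forgetZ ≪≫ P.compIso) :=
  have := P.B.fgp_isMonoidal hg
  let h := P.B.fgp_hom_obj hg
  let _ : (P.B.fgp.lift P.B.hom h).Monoidal := (P.B.fgp.liftCoreMonoidal P.B.hom h).toMonoidal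
  have hi := P.B.fgp.isMonoidal_liftCompιIso P.B.hom h
  ⟨this, P.B.fgp.lift P.B.hom h, inferInstance, P.B.fgp.liftCompιIso P.B.hom h,
    P.B.isEquivalence_lift_hom hg, hi, hS.whiskerRight_trans _⟩

end Realization

end

end

theorem mainTheorem3 {C : Type u} [Category.{v} C] [MonoidalCategory C] [Preadditive C]
    [MonoidalPreadditive C] [HasFiniteBiproducts C] [IsIdempotentComplete C] (g : C)
    (hg : IsFiniteProgenerator g) :
    (∃ Φ : Quot (fun P Q : Realization g => Nonempty (P.Iso Q)) ≃ SplitMonoidal (homFunctor g),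
      ∀ (P : Realization g) (S : SplitMonoidal (homFunctor g)),
        Φ (Quot.mk _ P) = S ↔ P.Induces S) ∧
    (∀ P Q : Realization g, Subsingleton (P.Iso Q)) ∧
    (∀ (P : Realization g) (S : SplitMonoidal (homFunctor g)), P.Induces S →
      ∃ (_ : P.B.fgp.IsMonoidal) (E : C ⥤ P.B.fgp.FullSubcategory) (_ : E.Monoidal)
        (i : E ⋙ P.B.fgp.ι ≅ P.B.hom),
        E.IsEquivalence ∧ NatTrans.IsMonoidal i.hom ∧
        S.Respects (F := (E ⋙ P.B.fgp.ι) ⋙ P.forgetZ)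
          (Functor.isoWhiskerRight i P.forgetZ ≪≫ P.compIso)) :=
  ⟨⟨Realization.quotEquiv hg, fun _ _ => Realization.split_eq_iff⟩, fun _ _ => inferInstance,
    fun P _ hS => P.exists_equivalence hg hS⟩
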